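/- **Model.** Fix class sizes $n_1,n_2$, $n=n_1+n_2$, and numbers of spikes $m_1,m_2$ with $1\le m_k<n_k$. For each class $k=1,2$ and each dimension $p$ let $\mu_{(k)}\in\mathbb R^p$, let $u_{(k),1},\dots,u_{(k),p}$ be an orthonormal basis of $\mathbb R^p$ and let $$\lambda_{(k),i}=\sigma_{(k),i}^2\,p+\tau_{(k),i}^2\ (i\le m_k),\qquad \lambda_{(k),i}=\tau_{(k),i}^2\ (i>m_k),$$ with $\sigma_{(k),i}^2,\tau_{(k),i}^2>0$ not depending on $p$ (strong spikes). An observation of class $k$ is $X=\mu_{(k)}+\sum_{i\le p}\lambda_{(k),i}^{1/2}z_iu_{(k),i}$, where $(z_1,z_2,\dots)$ is an infinite random sequence (the same for all $p$) whose law depends only on $k$; its entries are uncorrelated with mean $0$, variance $1$ and uniformly bounded fourth moments, $(z_1,\dots,z_p)$ has a density on $\mathbb R^p$ for every $p$, and the sequence is $\rho$-mixing after some permutation of the indices. Training data $\mathcal X=(X_{kj})_{k=1,2,\,j\le n_k}$ and test observations are all mutually independent. With $\mu=\mu_{(1)}-\mu_{(2)}$ assume, as $p\to\infty$: 1. $p^{-1/2}\|\mu\|\to\delta>0$.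 2. The $\tau_{(k),i}^2$ are uniformly bounded and $p^{-1}\sum_{i\le p}\tau_{(k),i}^2\to\tau^2>0$, with the same $\tau^2$ for $k=1,2$ (equal tail eigenvalues). 3. $\mathrm{Angle}(u_{(k),i},\mu)$ converges to a limit in $[0,\pi/2]$ for $i\le m_k$, $k=1,2$. 4. The common leading eigenspace $\mathcal U=\mathrm{span}\{u_{(k),i}:k=1,2,\ i\le m_k\}$ has, for all large $p$, an orthonormal basis $u_1,\dots,u_m$ ($m$ fixed) such that each $\mathrm{Angle}(u_j,\mu)$ converges to a limit in $[0,\pi/2]$, the matrices $R_{(k)}^{(p)}=(u_j^\top u_{(k),i})_{j\le m,\,i\le m_k}$ converge to matrices $R_{(k)}$ with orthonormal columns, and $[R_{(1)}\ R_{(2)}]$ has rank $m$. Let $\varphi$ be the limiting angle between $\mu$ and $\mathcal U$. **Sample quantities.** Let $\bar X_k$, $\bar X$ be the class and total sample means, $d=\bar X_1-\bar X_2$, $S_W=\sum_{k,j}(X_{kj}-\bar X_k)(X_{kj}-\bar X_k)^\top$, let $\hat\lambda_1\ge\dots\ge\hat\lambda_p$ be its eigenvalues with orthonormal eigenvectors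 $\hat u_1,\dots,\hat u_p$ (chosen measurably in the data), and let $\mathcal S_X=\mathrm{span}\{X_{kj}-\bar X\}$. For a real $\alpha$ let $v_\alpha$ be the normalization to length one of $$\sum_{i=1}^m\frac{\alpha p}{\hat\lambda_i+\alpha p}\,\hat u_i\hat u_i^\top d+\sum_{i=n-1}^p\hat u_i\hat u_i^\top d .$$ **Data piling.** $\mathfrak W_X$ is the set of sequences $\{w\}$ such that in every dimension $p>n$, $w\in\mathbb R^p$ is a measurable function of $\mathcal X$ and almost surely $w\in\mathcal S_X$, $\|w\|=1$. $\mathcal A$ is the set of $\{w\}\in\mathfrak W_X$ with $p^{-1/2}w^\top(Y-Y')\xrightarrow{P}0$ for all test observations $Y,Y'$ of the same class. $D(w)$ is the limit in probability, if it exists, of $p^{-1/2}|w^\top(Y_1-Y_2)|$ for test observations $Y_1,Y_2$ of class $1$ and $2$; it is a random variable. $\{w\}$ is *second maximal* if $\{w\}\in\mathcal A$, $D(w)$ exists, and $D(w')\le D(w)$ almost surely for every $\{w'\}\in\mathcal A$ for which $D(w')$ exists. **Theorem.** If $m+2<n$, then $-\frac1{n-m-2}\sum_{i=m+1}^{n-2}\hat\lambda_i/p\xrightarrow{P}-\tau^2$.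 For this estimator, and more generally for every measurable function $\hat\alpha$ of the training data in dimension $p$ with $\hat\alpha\xrightarrow{P}-\tau^2$: (i) For every $\{w\}\in\mathcal A$ there is $\{v\}\in\mathfrak W_X$ with, for every $p>n$, almost surely $v\in\mathrm{span}(v_{\hat\alpha})\oplus\mathrm{span}(\hat u_{m+1},\dots,\hat u_{n-2})$, such that $\|w-v\|\xrightarrow{P}0$. (ii) If $\varphi>0$, then a sequence $\{w\}\in\mathfrak W_X$ is second maximal if and only if it converges to $v_{\hat\alpha}$ up to sign, that is, $\min(\|w-v_{\hat\alpha}\|,\|w+v_{\hat\alpha}\|)\xrightarrow{P}0$. -/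

import Mathlib

open MeasureTheory ProbabilityTheory Filter Topology
open scoped ENNReal

noncomputable section

namespace DataPiling

/-- `ℝ^p` with the Euclidean norm. -/
abbrev E (p : ℕ) : Type := EuclideanSpace ℝ (Fin p)

/-! ### Mixing -/

/-- The `σ`-field generated by the random variables `Y i`, `i ∈ J`. -/
abbrev sigmaOf {Ω : Type*} (Y : ℕ → Ω → ℝ) (J : Set ℕ) : MeasurableSpace Ω :=
  ⨆ i ∈ J, MeasurableSpace.comap (Y i) inferInstance

/-- Correlation of two square-integrable random variables
(it is `0` when one of them is almost surely constant). -/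
def corr {Ω : Type*} [MeasurableSpace Ω] (μ : Measure Ω) (f g : Ω → ℝ) : ℝ :=
  covariance f g μ / (√(variance f μ) * √(variance g μ))

/-- Maximal correlation `ρ(𝓕, 𝓖)` of two `σ`-fields. -/
def rho {Ω : Type*} (F G : MeasurableSpace Ω) [MeasurableSpace Ω] (μ : Measure Ω) : ℝ≥0∞ :=
  ⨆ (f : Ω → ℝ) (g : Ω → ℝ) (_ : Measurable[F] f) (_ : MemLp f 2 μ)
    (_ : Measurable[G] g) (_ : MemLp g 2 μ), ENNReal.ofReal |corr μ f g|

/-- The sequence `Y` is `ρ`-mixing under `μ`. -/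
def IsRhoMixing {Ω : Type*} [MeasurableSpace Ω] (μ : Measure Ω) (Y : ℕ → Ω → ℝ) : Prop :=
  Tendsto (fun k : ℕ => ⨆ j : ℕ, rho (sigmaOf Y {i | i ≤ j}) (sigmaOf Y {i | j + k ≤ i}) μ)
    atTop (𝓝 0)

/-! ### Laws of the principal component scores -/

/-- `ν` is the law of an infinite sequence of principal component scores: the entries have
mean zero and unit variance and are uncorrelated, every finite initial segment has an
absolutely continuous law, the fourth moments are uniformly bounded, and the sequence is
`ρ`-mixing after some permutation of the indices. -/
structure IsScoreLaw (ν : Measure (ℕ → ℝ)) : Prop where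
  absCont : ∀ p : ℕ, ν.map (fun (z : ℕ → ℝ) (i : Fin p) => z i) ≪ volume
  memLp : ∀ i, MemLp (fun z : ℕ → ℝ => z i) 4 ν
  mean_zero : ∀ i, ∫ z, z i ∂ν = 0
  unit_var : ∀ i, ∫ z, z i ^ 2 ∂ν = 1
  uncorrelated : ∀ i j, i ≠ j → ∫ z, z i * z j ∂ν = 0
  fourth_moment : ∃ C : ℝ, ∀ i, ∫ z, z i ^ 4 ∂ν ≤ C
  mixing : ∃ π : Equiv.Perm ℕ, IsRhoMixing ν (fun i (z : ℕ → ℝ) => z (π i))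

/-! ### The two-class model with strong spikes -/

/-- The deterministic data of the model. The classes are indexed by `Fin 2`; indices of
eigenvectors start at `0`, so the leading ones of class `k` are those with index `< m k`. -/
structure TwoClassModel where
  /-- training sample sizes -/
  n : Fin 2 → ℕ
  /-- numbers of spikes -/
  m : Fin 2 → ℕ
  /-- population means, in every dimension -/
  mean : Fin 2 → ∀ p, E p
  /-- orthonormal eigenvectors of the population covariance matrices -/
  eigvec : Fin 2 → ∀ p, OrthonormalBasis (Fin p) ℝ (E p)
  /-- `σ_{(k),i}²` -/
  spikeVar : Fin 2 → ℕ → ℝ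
  /-- `τ_{(k),i}²` -/
  tailVar : Fin 2 → ℕ → ℝ

namespace TwoClassModel

variable (M : TwoClassModel)

/-- Total training sample size. -/
def N : ℕ := M.n 0 + M.n 1

/-- The mean difference vector. -/
def mu (p : ℕ) : E p := M.mean 0 p - M.mean 1 p

/-- The eigenvalues of the population covariance matrix of class `k` in dimension `p`:
`σ_{(k),i}² p + τ_{(k),i}²` for the leading ones and `τ_{(k),i}²` for the others. -/
def eigval (k : Fin 2) (p i : ℕ) : ℝ :=
  (if i < M.m k then M.spikeVar k i * p else 0) + M.tailVar k i

/-- The leading eigenvectors `u_{(k),i}`, `i < m k` (they exist once `m k ≤ p`). -/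
def lead (k : Fin 2) (p : ℕ) (i : Fin (M.m k)) : E p :=
  if h : (i : ℕ) < p then M.eigvec k p ⟨i, h⟩ else 0

/-- The common leading eigenspace. -/
def commonLead (p : ℕ) : Submodule ℝ (E p) :=
  Submodule.span ℝ (⋃ k : Fin 2, Set.range (M.lead k p))

/-- The observation `μ_{(k)} + U_{(k)} Λ_{(k)}^{1/2} z` of class `k` in dimension `p` whose
principal component scores `Λ_{(k)}^{-1/2} U_{(k)}ᵀ (X - μ_{(k)})` are the first `p` entries
of the sequence `z`. -/
def obs (k : Fin 2) (p : ℕ) (z : ℕ → ℝ) : E p :=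
  M.mean k p + ∑ i : Fin p, (√(M.eigval k p i) * z i) • M.eigvec k p i

/-- The mean difference has length of exact order `√p`. -/
def MeanDifference (δ : ℝ) : Prop :=
  0 < δ ∧ Tendsto (fun p : ℕ => (√(p : ℝ))⁻¹ * ‖M.mu p‖) atTop (𝓝 δ)

/-- Positive spike and tail parameters, uniformly bounded tail eigenvalues, and averages of the
tail eigenvalues that converge to the same limit `τ²` in both classes. -/
structure EqualTail (τ : ℝ) : Prop where
  tau_pos : 0 < τ
  spike_pos : ∀ k i, i < M.m k → 0 < M.spikeVar k i
  tail_pos : ∀ k i, 0 < M.tailVar k i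
  tail_bdd : ∃ C : ℝ, ∀ k i, M.tailVar k i ≤ C
  tail_avg : ∀ k, Tendsto (fun p : ℕ => (p : ℝ)⁻¹ * ∑ i ∈ Finset.range p, M.tailVar k i)
    atTop (𝓝 (τ ^ 2))

/-- The angles between the leading eigenvectors of each class and the mean difference
converge, to limits in `[0, π/2]`. -/
def LeadAngles : Prop :=
  ∀ (k : Fin 2) (i : Fin (M.m k)), ∃ θ ∈ Set.Icc (0 : ℝ) (Real.pi / 2),
    Tendsto (fun p => InnerProductGeometry.angle (M.lead k p i) (M.mu p)) atTop (𝓝 θ)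

/-- The common leading eigenspace has dimension `m` (for all large `p`) and an orthonormal basis
`b_1, …, b_m` whose angles with the mean difference converge to limits in `[0, π/2]`, and for
which the coordinate matrices of the leading eigenvectors of the two classes converge to
matrices `R_{(1)}`, `R_{(2)}` with orthonormal columns such that `[R_{(1)} R_{(2)}]` has rank
`m`. -/
def CommonBasis (m : ℕ) : Prop :=
  ∃ (b : ∀ p, Fin m → E p) (θ : Fin m → ℝ)
    (R : ∀ k : Fin 2, Matrix (Fin m) (Fin (M.m k)) ℝ),
    (∀ᶠ p in atTop, Orthonormal ℝ (b p) ∧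
      Submodule.span ℝ (Set.range (b p)) = M.commonLead p) ∧
    (∀ j, θ j ∈ Set.Icc (0 : ℝ) (Real.pi / 2) ∧
      Tendsto (fun p => InnerProductGeometry.angle (b p j) (M.mu p)) atTop (𝓝 (θ j))) ∧
    (∀ k j i, Tendsto (fun p => inner ℝ (b p j) (M.lead k p i)) atTop (𝓝 (R k j i))) ∧
    (∀ k, (R k).transpose * R k = 1) ∧
    (Matrix.fromCols (R 0) (R 1)).rank = m

/-- The limiting angle between the mean difference and the common leading eigenspace is `φ`. -/
def LimitAngle (φ : ℝ) : Prop :=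
  Tendsto (fun p => InnerProductGeometry.angle (M.mu p) ((M.commonLead p).starProjection (M.mu p)))
    atTop (𝓝 φ)

/-- Labels of all observations: `n k` training observations and an unlimited supply of test
observations in each class `k`. -/
abbrev Index : Type := (Σ k : Fin 2, Fin (M.n k)) ⊕ (Fin 2 × ℕ)

/-- The class of an observation. -/
def label : M.Index → Fin 2 := Sum.elim (fun a => a.1) (fun a => a.1)

/-- A training sample in `ℝ^p`. -/
abbrev Sample (p : ℕ) : Type := ∀ k : Fin 2, Fin (M.n k) → E p

variable {Ω : Type*} (Z : M.Index → Ω → ℕ → ℝ)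

/-- The training sample in dimension `p`; `Z` lists the score sequences of all observations. -/
def train (p : ℕ) (ω : Ω) : M.Sample p := fun k j => M.obs k p (Z (Sum.inl ⟨k, j⟩) ω)

/-- The `l`-th test observation of class `k` in dimension `p`. -/
def test (k : Fin 2) (l p : ℕ) (ω : Ω) : E p := M.obs k p (Z (Sum.inr (k, l)) ω)

end TwoClassModel

/-! ### Sample quantities -/

variable {M : TwoClassModel} {p : ℕ}

/-- Class-wise sample mean. -/
def classMean (x : M.Sample p) (k : Fin 2) : E p := (M.n k : ℝ)⁻¹ • ∑ j, x k j

/-- Total sample mean. -/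
def totalMean (x : M.Sample p) : E p := (M.N : ℝ)⁻¹ • ∑ k, ∑ j, x k j

/-- Sample mean difference `d`. -/
def meanDiff (x : M.Sample p) : E p := classMean x 0 - classMean x 1

/-- The sample space, spanned by the observations centred at the total mean. -/
def sampleSpace (x : M.Sample p) : Submodule ℝ (E p) :=
  Submodule.span ℝ {v | ∃ (k : Fin 2) (j : Fin (M.n k)), v = x k j - totalMean x}

/-- The within-class scatter matrix `∑_{k,j} (X_{kj} - X̄_k)(X_{kj} - X̄_k)ᵀ`, applied to `v`. -/
def withinScatter (x : M.Sample p) (v : E p) : E p :=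
  ∑ k, ∑ j, inner ℝ (x k j - classMean x k) v • (x k j - classMean x k)

/-- `u`, `lam` is an eigen-decomposition of the within-class scatter matrix, with the eigenvalues
in descending order. -/
structure IsEigenDecomp (x : M.Sample p) (u : Fin p → E p) (lam : Fin p → ℝ) : Prop where
  orthonormal : Orthonormal ℝ u
  eigen : ∀ i, withinScatter x (u i) = lam i • u i
  descending : Antitone lam

/-- The unnormalized projected ridged discriminant vector
`∑_{i ≤ m} α_p / (λ̂_i + α_p) û_i û_iᵀ d + Û₂ Û₂ᵀ d`, where `α_p = α p` and the columns of `Û₂`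
are `û_{n-1}, …, û_p`. -/
def ridgeVec (m : ℕ) (α : ℝ) (u : Fin p → E p) (lam : Fin p → ℝ) (x : M.Sample p) : E p :=
  (∑ i with i.val < m, (α * p / (lam i + α * p) * inner ℝ (u i) (meanDiff x)) • u i) +
    ∑ i with M.N - 2 ≤ i.val, inner ℝ (u i) (meanDiff x) • u i

/-- The projected ridged discriminant direction `v_α`. -/
def ridgeDir (m : ℕ) (α : ℝ) (u : Fin p → E p) (lam : Fin p → ℝ) (x : M.Sample p) : E p :=
  ‖ridgeVec m α u lam x‖⁻¹ • ridgeVec m α u lam x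

/-- `span(v_α) ⊕ span(û_{m+1}, …, û_{n-2})`. -/
def pilingSpace (m : ℕ) (α : ℝ) (u : Fin p → E p) (lam : Fin p → ℝ) (x : M.Sample p) :
    Submodule ℝ (E p) :=
  Submodule.span ℝ {ridgeDir m α u lam x} ⊔
    Submodule.span ℝ (u '' {i | m ≤ i.val ∧ i.val < M.N - 2})

/-- The estimator `-(n-m-2)⁻¹ ∑_{i=m+1}^{n-2} λ̂_i / p` of `-τ²`. -/
def alphaHat (M : TwoClassModel) (m : ℕ) {p : ℕ} (lam : Fin p → ℝ) : ℝ :=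
  -(((M.N : ℝ) - m - 2)⁻¹ * ∑ i with m ≤ i.val ∧ i.val < M.N - 2, lam i / p)

/-! ### Second data piling -/

variable {Ω : Type*} [MeasurableSpace Ω]

/-- The class `𝔚_X` of sequences of directions: in every dimension `p > n` the direction is a
measurable function of the training sample, and it is (almost surely) a unit vector in the
sample space. -/
def IsDirSeq (P : Measure Ω) (Z : M.Index → Ω → ℕ → ℝ) (w : ∀ p, M.Sample p → E p) : Prop :=
  ∀ p, M.N < p → Measurable (w p) ∧
    ∀ᵐ ω ∂P, w p (M.train Z p ω) ∈ sampleSpace (M.train Z p ω) ∧ ‖w p (M.train Z p ω)‖ = 1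

/-- The class `𝒜` of sequences of second data piling directions. -/
def IsSecondPiling (P : Measure Ω) (Z : M.Index → Ω → ℕ → ℝ)
    (w : ∀ p, M.Sample p → E p) : Prop :=
  IsDirSeq P Z w ∧ ∀ (k : Fin 2) (l l' : ℕ),
    TendstoInMeasure P (fun (p : ℕ) ω => (√(p : ℝ))⁻¹ *
      inner ℝ (w p (M.train Z p ω)) (M.test Z k l p ω - M.test Z k l' p ω)) atTop (fun _ => 0)

/-- `D(w)` exists and equals the random variable `D`: it is the limit in probability of
`p^{-1/2} |wᵀ(Y₁ - Y₂)|` for test observations `Y₁`, `Y₂` of the first and second class. -/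
def HasPilingDistance (P : Measure Ω) (Z : M.Index → Ω → ℕ → ℝ)
    (w : ∀ p, M.Sample p → E p) (D : Ω → ℝ) : Prop :=
  ∀ l l' : ℕ, TendstoInMeasure P (fun (p : ℕ) ω => (√(p : ℝ))⁻¹ *
    |inner ℝ (w p (M.train Z p ω)) (M.test Z 0 l p ω - M.test Z 1 l' p ω)|) atTop D

/-- `w` is a sequence of second maximal data piling directions. -/
def IsSecondMaximal (P : Measure Ω) (Z : M.Index → Ω → ℕ → ℝ)
    (w : ∀ p, M.Sample p → E p) : Prop :=
  IsSecondPiling P Z w ∧ ∃ D : Ω → ℝ, HasPilingDistance P Z w D ∧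
    ∀ (w' : ∀ p, M.Sample p → E p) (D' : Ω → ℝ),
      IsSecondPiling P Z w' → HasPilingDistance P Z w' D' → D' ≤ᵐ[P] D

end DataPiling

end

/-! After division by `√p` an observation is its mean plus a part in the common leading eigenspace
plus noise. The coordinates of the leading parts converge to vectors `g a` of `ℝ^m` that depend on
finitely many scores. Noise vectors of different observations become orthogonal to each other and to
bounded vectors that are deterministic or independent of them. Their squared norms tend to `τ²`, by
a law of large numbers for squared scores that rests on mixing. So all inner products between scaled
data, mean difference and leading basis converge, and the problem becomes linear algebra of fixed
size.

Let `K` be the space of coefficient vectors with zero sum in each class and let `A : K → ℝ^m`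
combine the `g a`. The Gram form of the centred data on `K` tends to `‖A c‖² + τ² ‖c‖²`. Densities
put the scores in general position, so `A` is onto `ℝ^m`. Hence exactly `m` limiting eigenvalues `L
i` exceed `τ²`; the others equal `τ²`, which gives the consistent estimator, and their eigenvectors
are asymptotically orthogonal to the leading space. For `i < m` the vectors `A (c i)` form an
orthogonal basis of `ℝ^m` with `‖A (c i)‖² = L i - τ²`, whereas the sample eigenvector `û_i` has
limiting leading coordinates `A (c i) / √(L i)`. A ridge parameter tending to `-τ²` replaces a
weight `1 / L i` by `1 / (L i - τ²)`, exactly the correction that makes `v_α` asymptotically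
orthogonal to the leading space (`IsSampleLimit.tendsto_inner_ridge`). Conversely, this
orthogonality determines the leading coefficients of a unit vector of the sample space up to one
factor, so the vector is close to the span of `v_α` and the tail eigenvectors
(`IsSampleLimit.tendsto_residual`).

Membership in `𝒜` is the same as asymptotic orthogonality to the leading eigenspace
(`IsScoreArray.isSecondPiling_iff`): the direction is independent of the test scores, and a linear
form in uncorrelated scores with independent coefficients can vanish asymptotically only if its
coefficients do. This gives (i). For (ii), `D(w)` is the limit of `|⟪w, r⟫|`, with `r` the part of
the scaled mean difference outside the leading space. Tail eigenvectors are asymptotically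
orthogonal to `r`, so `D(w) = |β| κ` with `β = lim ⟪v_α, w⟫` and `κ = lim ⟪v_α, r⟫`, and `κ > 0`
because `φ > 0`. Maximality means `|β| = 1`, that is, `w` is close to `± v_α`.

Convergence in probability is treated as almost sure convergence along subsequences and, for fixed
`ω`, as convergence along ultrafilters (`AsympAE`). Sample eigenvectors and coefficients of `w`,
which need not converge, then have limits without an `ω`-dependent choice of subsequence. -/

noncomputable section

namespace DataPiling

/-! ### Almost sure convergence along subsequences -/

section AsympAE

variable {Ω : Type*} [MeasurableSpace Ω] {P : Measure Ω}

/-- `Q` holds asymptotically: every subsequence has a further subsequence such that, for almost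
every `ω`, the property `Q U ω` holds for every ultrafilter `U` finer than it. -/
def AsympAE (P : Measure Ω) (Q : Ultrafilter ℕ → Ω → Prop) : Prop :=
  ∀ ns : ℕ → ℕ, StrictMono ns → ∃ ms : ℕ → ℕ, StrictMono ms ∧
    ∀ᵐ ω ∂P, ∀ U : Ultrafilter ℕ, (U : Filter ℕ) ≤ map (ns ∘ ms) atTop → Q U ω

theorem AsympAE.of_ae {Q : Ultrafilter ℕ → Ω → Prop}
    (h : ∀ᵐ ω ∂P, ∀ U : Ultrafilter ℕ, (U : Filter ℕ) ≤ atTop → Q U ω) : AsympAE P Q := by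
  intro ns hns
  refine ⟨id, strictMono_id, ?_⟩
  filter_upwards [h] with ω hω U hU
  exact hω U (hU.trans hns.tendsto_atTop)

theorem AsympAE.mono {Q R : Ultrafilter ℕ → Ω → Prop} (h : AsympAE P Q)
    (hQR : ∀ᵐ ω ∂P, ∀ U : Ultrafilter ℕ, (U : Filter ℕ) ≤ atTop → Q U ω → R U ω) :
    AsympAE P R := by
  intro ns hns
  obtain ⟨ms, hms, hae⟩ := h ns hns
  refine ⟨ms, hms, ?_⟩
  filter_upwards [hae, hQR] with ω hω h2 U hU
  exact h2 U (hU.trans (hns.comp hms).tendsto_atTop) (hω U hU)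

/-- A further subsequence serves both properties, since an ultrafilter finer than it is also finer
than the subsequence found first. -/
theorem AsympAE.and {Q R : Ultrafilter ℕ → Ω → Prop} (hQ : AsympAE P Q) (hR : AsympAE P R) :
    AsympAE P (fun U ω => Q U ω ∧ R U ω) := by
  intro ns hns
  obtain ⟨ms, hms, hae⟩ := hQ ns hns
  obtain ⟨ks, hks, hae'⟩ := hR (ns ∘ ms) (hns.comp hms)
  refine ⟨ms ∘ ks, hms.comp hks, ?_⟩
  filter_upwards [hae, hae'] with ω h1 h2 U hU
  refine ⟨h1 U (hU.trans ?_), h2 U hU⟩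
  rw [show ns ∘ ms ∘ ks = (ns ∘ ms) ∘ ks from rfl, ← Filter.map_map]
  exact Filter.map_mono hks.tendsto_atTop

theorem AsympAE.forall {ι : Type*} [Finite ι] {Q : ι → Ultrafilter ℕ → Ω → Prop}
    (h : ∀ i, AsympAE P (Q i)) : AsympAE P (fun U ω => ∀ i, Q i U ω) := by
  classical
  have := Fintype.ofFinite ι
  suffices H : ∀ s : Finset ι, AsympAE P (fun U ω => ∀ i ∈ s, Q i U ω) by
    refine (H Finset.univ).mono (.of_forall fun ω U _ hω i => hω i (Finset.mem_univ i))
  intro s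
  induction s using Finset.induction_on with
  | empty => exact AsympAE.of_ae (.of_forall fun ω U _ i hi => absurd hi (Finset.notMem_empty i))
  | insert a s ha ih =>
    refine ((h a).and ih).mono (.of_forall fun ω U _ hω i hi => ?_)
    rcases Finset.mem_insert.1 hi with rfl | hi
    · exact hω.1
    · exact hω.2 i hi

theorem AsympAE.of_tendstoInMeasure {f : ℕ → Ω → ℝ} {g : Ω → ℝ}
    (h : TendstoInMeasure P f atTop g) :
    AsympAE P (fun U ω => Tendsto (fun p => f p ω) U (𝓝 (g ω))) := by
  intro ns hns
  obtain ⟨ms, hms, hae⟩ := (h.comp hns.tendsto_atTop).exists_seq_tendsto_ae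
  refine ⟨ms, hms, ?_⟩
  filter_upwards [hae] with ω hω U hU
  refine Tendsto.mono_left ?_ hU
  rw [Filter.tendsto_map'_iff]
  exact hω

/-- Convergence along every ultrafilter finer than a filter is convergence along the filter, so this
reduces to the subsequence criterion for convergence in measure. -/
theorem AsympAE.tendstoInMeasure [IsFiniteMeasure P] {f : ℕ → Ω → ℝ} {g : Ω → ℝ}
    (hf : ∀ᶠ p in atTop, AEMeasurable (f p) P)
    (h : AsympAE P (fun U ω => Tendsto (fun p => f p ω) U (𝓝 (g ω)))) :
    TendstoInMeasure P f atTop g := by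
  obtain ⟨N, hN⟩ := eventually_atTop.1 hf
  -- The criterion wants measurability for every index, but directions are measurable only for `p >
  -- n`; the first terms are replaced by zero.
  set f' : ℕ → Ω → ℝ := fun p => if N ≤ p then f p else 0 with hf'
  have hm : ∀ p, AEStronglyMeasurable (f' p) P := by
    intro p
    by_cases hp : N ≤ p
    · simpa [hf', hp] using (hN p hp).aestronglyMeasurable
    · simp only [hf', hp, if_false]; exact aestronglyMeasurable_const
  have key : TendstoInMeasure P f' atTop g := by
    refine (exists_seq_tendstoInMeasure_atTop_iff hm).2 fun ns hns => ?_
    obtain ⟨ms, hms, hae⟩ := h ns hns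
    refine ⟨ms, hms, ?_⟩
    filter_upwards [hae] with ω hω
    have h1 : Tendsto (fun i => f (ns (ms i)) ω) atTop (𝓝 (g ω)) := by
      have : Tendsto (fun p => f p ω) (map (ns ∘ ms) atTop) (𝓝 (g ω)) :=
        (tendsto_iff_ultrafilter _ _ _).2 fun U hU => hω U hU
      exact Filter.tendsto_map'_iff.1 this
    refine h1.congr' ?_
    filter_upwards [(hns.comp hms).tendsto_atTop.eventually_ge_atTop N] with i hi
    have hi' : N ≤ ns (ms i) := hi
    simp [hf', hi']
  refine TendstoInMeasure.congr' ?_ EventuallyEq.rfl key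
  filter_upwards [eventually_ge_atTop N] with p hp
  simp [hf', hp]

/-- Bounded real sequences converge along ultrafilters. -/
theorem exists_tendsto_of_abs_le (U : Ultrafilter ℕ) {f : ℕ → ℝ} {C : ℝ}
    (h : ∀ᶠ p in U, |f p| ≤ C) : ∃ x, Tendsto f U (𝓝 x) := by
  have hK : IsCompact (Set.Icc (-C) C) := isCompact_Icc
  obtain ⟨x, -, hx⟩ := hK.ultrafilter_le_nhds (U.map f) (by
    rw [le_principal_iff]
    exact h.mono fun p hp => abs_le.1 hp)
  exact ⟨x, hx⟩

/-- Convergence to `0` in mean square implies convergence in measure. -/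
theorem tendstoInMeasure_zero_of_lintegral_sq {f : ℕ → Ω → ℝ}
    (hf : ∀ᶠ p in atTop, AEMeasurable (f p) P) {B : ℕ → ℝ≥0∞} (hB : Tendsto B atTop (𝓝 0))
    (h : ∀ᶠ p in atTop, ∫⁻ ω, ENNReal.ofReal (f p ω ^ 2) ∂P ≤ B p) :
    TendstoInMeasure P f atTop (fun _ => 0) := by
  rw [tendstoInMeasure_iff_norm]
  intro ε hε
  have hε2 : ENNReal.ofReal (ε ^ 2) ≠ 0 := by
    rw [Ne, ENNReal.ofReal_eq_zero, not_le]; positivity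
  have hlim : Tendsto (fun p => B p / ENNReal.ofReal (ε ^ 2)) atTop (𝓝 0) := by
    have := ENNReal.Tendsto.div_const hB (b := ENNReal.ofReal (ε ^ 2)) (Or.inr hε2)
    simpa using this
  refine tendsto_of_tendsto_of_tendsto_of_le_of_le' tendsto_const_nhds hlim
    (Eventually.of_forall fun _ => zero_le) ?_
  filter_upwards [h, hf] with p hp hm
  have hsub : {ω | ε ≤ ‖f p ω - 0‖} ⊆
      {ω | ENNReal.ofReal (ε ^ 2) ≤ ENNReal.ofReal (f p ω ^ 2)} := by
    intro ω hω
    have h1 : ε ≤ |f p ω| := by simpa using hω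
    refine ENNReal.ofReal_le_ofReal ?_
    rw [← sq_abs (f p ω)]
    gcongr
  refine (measure_mono hsub).trans ?_
  refine (meas_ge_le_lintegral_div ?_ hε2 ENNReal.ofReal_ne_top).trans ?_
  · exact (hm.pow_const 2).ennreal_ofReal
  · gcongr

end AsympAE

/-! ### Affine independence of independent random points -/

section AffineIndependence

variable {V : Type*} [NormedAddCommGroup V] [NormedSpace ℝ V] [MeasurableSpace V] [BorelSpace V]
  [FiniteDimensional ℝ V]

omit [MeasurableSpace V] [BorelSpace V] [FiniteDimensional ℝ V] in
theorem affineIndependent_fin_succ {n : ℕ} {y : Fin (n + 1) → V}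
    (h : AffineIndependent ℝ (fun i => y (Fin.succ i)))
    (h0 : y 0 ∉ affineSpan ℝ (Set.range fun i => y (Fin.succ i))) : AffineIndependent ℝ y := by
  refine AffineIndependent.affineIndependent_of_notMem_span (i := 0) ?_ ?_
  · exact (affineIndependent_equiv (finSuccAboveEquiv (0 : Fin (n + 1)))
      (p := fun x : { y // y ≠ (0 : Fin (n + 1)) } => y x)).1 h
  · have : y '' {x | x ≠ 0} = Set.range fun i => y (Fin.succ i) := by
      ext v
      simp only [Set.mem_image, Set.mem_range]
      constructor
      · rintro ⟨i, hi, rfl⟩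
        obtain ⟨j, rfl⟩ := Fin.exists_succ_eq.2 hi
        exact ⟨j, rfl⟩
      · rintro ⟨j, rfl⟩
        exact ⟨_, Fin.succ_ne_zero j, rfl⟩
    rwa [this]

/-- By Fubini, with the other points fixed and affinely independent, the first point is bad only on
their affine span. At most `dim V` points span a proper affine subspace, which is null for Haar
measure. -/
theorem ae_pi_affineIndependent (vol : Measure V) [vol.IsAddHaarMeasure] (n : ℕ)
    (hn : n ≤ Module.finrank ℝ V + 1) (μ : Fin n → Measure V) [∀ i, IsProbabilityMeasure (μ i)]
    (hμ : ∀ i, μ i ≪ vol) : ∀ᵐ y ∂(Measure.pi μ), AffineIndependent ℝ y := by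
  induction n with
  | zero => exact .of_forall fun y => affineIndependent_of_subsingleton ℝ y
  | succ n ih =>
    have := FiniteDimensional.proper ℝ V
    have : SecondCountableTopology V := inferInstance
    have hmeas : MeasurableSet {y : Fin (n + 1) → V | ¬ AffineIndependent ℝ y} :=
      (isOpen_setOfPred_affineIndependent (𝕜 := ℝ) (E := V)
        (ι := Fin (n + 1))).measurableSet.compl
    have hmp := (measurePreserving_piFinSuccAbove μ 0).symm
    rw [ae_iff, ← hmp.measure_preimage hmeas.nullMeasurableSet,
      Measure.prod_apply_symm (hmp.measurable hmeas), lintegral_eq_zero_iff']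
    · have hi := ih (by omega) (fun j => μ (Fin.succAbove 0 j)) (fun j => hμ _)
      filter_upwards [hi] with y hy
      refine measure_mono_null (t := (affineSpan ℝ (Set.range y) : Set V)) ?_ ?_
      · intro x hx
        by_contra hx'
        refine hx (affineIndependent_fin_succ ?_ ?_)
        · simpa using hy
        · simpa using hx'
      · refine hμ 0 (Measure.addHaar_affineSubspace vol _ fun htop => ?_)
        have hdir : vectorSpan ℝ (Set.range y) = ⊤ := by
          rw [← direction_affineSpan, htop, AffineSubspace.direction_top]
        have hfin : Module.finrank ℝ (vectorSpan ℝ (Set.range y)) = Module.finrank ℝ V := by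
          rw [hdir, finrank_top]
        -- Without other points the span is empty; otherwise `k + 1 ≤ dim V` points have a direction
        -- space of dimension at most `k`.
        rcases n with _ | k
        · rw [Set.range_eq_empty, AffineSubspace.span_empty] at htop
          exact AffineSubspace.bot_ne_top ℝ V V htop
        · have := finrank_vectorSpan_range_le ℝ y (n := k) (by simp)
          omega
    · exact (measurable_measure_prodMk_right (hmp.measurable hmeas)).aemeasurable

theorem ae_affineIndependent {Ω : Type*} [MeasurableSpace Ω] {P : Measure Ω}
    [IsProbabilityMeasure P] (vol : Measure V) [vol.IsAddHaarMeasure] {ι : Type*} [Fintype ι]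
    (hn : Fintype.card ι ≤ Module.finrank ℝ V + 1) {Y : ι → Ω → V}
    (hY : ∀ i, AEMeasurable (Y i) P) (hac : ∀ i, P.map (Y i) ≪ vol) (hind : iIndepFun Y P) :
    ∀ᵐ ω ∂P, AffineIndependent ℝ fun i => Y i ω := by
  have := FiniteDimensional.proper ℝ V
  have : SecondCountableTopology V := inferInstance
  set e := (Fintype.equivFin ι).symm
  have hind' : iIndepFun (fun i => Y (e i)) P := hind.precomp e.injective
  have hprob : ∀ i, IsProbabilityMeasure (P.map (Y (e i))) := fun i =>
    Measure.isProbabilityMeasure_map (hY _)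
  have h := ae_pi_affineIndependent vol _ hn (fun i => P.map (Y (e i))) (fun i => hac _)
  rw [← (iIndepFun_iff_map_fun_eq_pi_map (fun i => hY (e i))).1 hind'] at h
  have h' := ae_of_ae_map (aemeasurable_pi_lambda _ fun i => hY (e i)) h
  filter_upwards [h'] with ω hω
  exact (affineIndependent_equiv e (p := fun i => Y i ω)).1 hω

end AffineIndependence

end DataPiling

namespace DataPiling

/-! ### Moments of principal component scores -/

section Scores

variable {ν : Measure (ℕ → ℝ)}

theorem IsScoreLaw.memLp_two [IsProbabilityMeasure ν] (hν : IsScoreLaw ν) (i : ℕ) :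
    MemLp (fun z : ℕ → ℝ => z i) 2 ν :=
  (hν.memLp i).mono_exponent (by norm_num)

theorem IsScoreLaw.memLp_sq (hν : IsScoreLaw ν) (i : ℕ) :
    MemLp (fun z : ℕ → ℝ => z i ^ 2) 2 ν := by
  have h : MemLp (fun z : ℕ → ℝ => z i • z i) 2 ν :=
    MemLp.smul (p := 4) (q := 4) (r := 2) (hν.memLp i) (hν.memLp i) (hpqr := ⟨by
      rw [← two_mul, show (4 : ℝ≥0∞) = 2 * 2 by norm_num,
        ENNReal.mul_inv (by simp) (by simp), ← mul_assoc,
        ENNReal.mul_inv_cancel (by simp) (by simp), one_mul]⟩)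
  simpa [pow_two] using h

theorem IsScoreLaw.integral_mul [IsProbabilityMeasure ν] (hν : IsScoreLaw ν) (i j : ℕ) :
    ∫ z, z i * z j ∂ν = if i = j then 1 else 0 := by
  split_ifs with h
  · subst h
    simpa [pow_two] using hν.unit_var i
  · exact hν.uncorrelated i j h

theorem IsScoreLaw.integrable_mul [IsProbabilityMeasure ν] (hν : IsScoreLaw ν) (i j : ℕ) :
    Integrable (fun z : ℕ → ℝ => z i * z j) ν :=
  (hν.memLp_two i).integrable_mul (hν.memLp_two j)

theorem IsScoreLaw.integrable_linear_sq [IsProbabilityMeasure ν] (hν : IsScoreLaw ν) {n : ℕ}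
    (a : Fin n → ℝ) : Integrable (fun z : ℕ → ℝ => (∑ i, a i * z i) ^ 2) ν :=
  MemLp.integrable_sq (memLp_finsetSum (f := fun (i : Fin n) (z : ℕ → ℝ) => a i * z i) Finset.univ
    fun i _ => (hν.memLp_two i).const_mul (a i))

theorem IsScoreLaw.integral_linear_sq [IsProbabilityMeasure ν] (hν : IsScoreLaw ν) {n : ℕ}
    (a : Fin n → ℝ) : ∫ z, (∑ i, a i * z i) ^ 2 ∂ν = ∑ i, a i ^ 2 := by
  have h : ∀ z : ℕ → ℝ, (∑ i, a i * z i) ^ 2 = ∑ i, ∑ j, (a i * a j) * (z i * z j) := by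
    intro z
    rw [pow_two, Finset.sum_mul_sum]
    exact Finset.sum_congr rfl fun i _ => Finset.sum_congr rfl fun j _ => by ring
  simp_rw [h]
  have hint : ∀ i j : Fin n, Integrable (fun z : ℕ → ℝ => a i * a j * (z i * z j)) ν :=
    fun i j => (hν.integrable_mul i j).const_mul _
  rw [integral_finsetSum _ fun i _ => integrable_finsetSum _ fun j _ => hint i j]
  refine Finset.sum_congr rfl fun i _ => ?_
  rw [integral_finsetSum _ fun j _ => hint i j]
  simp_rw [integral_const_mul, hν.integral_mul, Fin.val_inj]
  simp [pow_two]

theorem IsScoreLaw.lintegral_linear_sq [IsProbabilityMeasure ν] (hν : IsScoreLaw ν) {n : ℕ}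
    (a : Fin n → ℝ) :
    ∫⁻ z, ENNReal.ofReal ((∑ i, a i * z i) ^ 2) ∂ν = ENNReal.ofReal (∑ i, a i ^ 2) := by
  rw [← ofReal_integral_eq_lintegral_ofReal (hν.integrable_linear_sq a)
    (.of_forall fun z => sq_nonneg _), hν.integral_linear_sq]

/-- Covariances are controlled by the maximal correlation of the generated `σ`-fields. -/
theorem abs_covariance_le_of_rho_le {Ω : Type*} {F G : MeasurableSpace Ω} [MeasurableSpace Ω]
    {μ : Measure Ω} [IsProbabilityMeasure μ] {ε B : ℝ} (hε : 0 ≤ ε) (hB : 0 ≤ B)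
    (hrho : rho F G μ ≤ ENNReal.ofReal ε)
    {f g : Ω → ℝ} (hf : Measurable[F] f) (hg : Measurable[G] g) (hf2 : MemLp f 2 μ)
    (hg2 : MemLp g 2 μ) (hfB : variance f μ ≤ B) (hgB : variance g μ ≤ B) :
    |covariance f g μ| ≤ ε * B := by
  have hcorr : |corr μ f g| ≤ ε := by
    have h1 : ENNReal.ofReal |corr μ f g| ≤ rho F G μ :=
      le_iSup_of_le f <| le_iSup_of_le g <| le_iSup_of_le hf <| le_iSup_of_le hf2 <|
        le_iSup_of_le hg <| le_iSup_of_le hg2 le_rfl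
    exact (ENNReal.ofReal_le_ofReal_iff hε).1 (h1.trans hrho)
  have hnonneg : 0 ≤ ε * B := mul_nonneg hε hB
  -- If a variance vanishes, `corr` is `0` by the convention for division by zero and bounds
  -- nothing, but then the covariance itself is `0`.
  have zero_case : ∀ {f g : Ω → ℝ}, MemLp f 2 μ → variance f μ = 0 → covariance f g μ = 0 := by
    intro f g hf2 h0
    have hae := ae_eq_integral_of_variance_eq_zero hf2 h0
    rw [covariance]
    refine integral_eq_zero_of_ae ?_
    filter_upwards [hae] with ω hω
    simp [hω]
  by_cases hf0 : variance f μ = 0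
  · simpa [zero_case hf2 hf0] using hnonneg
  by_cases hg0 : variance g μ = 0
  · rw [covariance_comm, zero_case hg2 hg0]
    simpa using hnonneg
  have hfp : 0 < variance f μ := lt_of_le_of_ne (variance_nonneg _ _) (Ne.symm hf0)
  have hgp : 0 < variance g μ := lt_of_le_of_ne (variance_nonneg _ _) (Ne.symm hg0)
  have hpos : 0 < √(variance f μ) * √(variance g μ) := by positivity
  rw [corr, abs_div, abs_of_pos hpos, div_le_iff₀ hpos] at hcorr
  refine hcorr.trans ?_
  have hle : √(variance f μ) * √(variance g μ) ≤ B := by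
    calc √(variance f μ) * √(variance g μ) ≤ √B * √B := by gcongr
      _ = B := Real.mul_self_sqrt hB
  gcongr

theorem IsScoreLaw.variance_sq_le [IsProbabilityMeasure ν] (hν : IsScoreLaw ν) {B : ℝ}
    (hB : ∀ i, ∫ z, z i ^ 4 ∂ν ≤ B) (i : ℕ) : variance (fun z : ℕ → ℝ => z i ^ 2) ν ≤ B := by
  refine (variance_le_expectation_sq (hν.memLp_sq i).aestronglyMeasurable).trans ?_
  refine le_trans (le_of_eq ?_) (hB i)
  refine integral_congr_ae (.of_forall fun z => ?_)
  simp only [Pi.pow_apply]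
  ring

/-- Both signs follow from the nonnegativity of the variances of `f + g` and `f - g`. -/
theorem abs_covariance_le_of_variance_le {Ω : Type*} [MeasurableSpace Ω]
    {μ : Measure Ω} [IsProbabilityMeasure μ] {B : ℝ} {f g : Ω → ℝ} (hf2 : MemLp f 2 μ)
    (hg2 : MemLp g 2 μ) (hfB : variance f μ ≤ B) (hgB : variance g μ ≤ B) :
    |covariance f g μ| ≤ B := by
  have h1 := variance_nonneg (f + g) μ
  have h2 := variance_nonneg (f - g) μ
  rw [variance_add hf2 hg2] at h1
  rw [variance_sub hf2 hg2] at h2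
  rw [abs_le]
  constructor <;> linarith

/-- Squared scores with distant (permuted) indices are nearly uncorrelated. -/
theorem IsScoreLaw.exists_covariance_sq_le [IsProbabilityMeasure ν] (hν : IsScoreLaw ν) {B : ℝ}
    (hB : ∀ i, ∫ z, z i ^ 4 ∂ν ≤ B) : ∃ π : Equiv.Perm ℕ, ∀ ε > 0, ∃ K : ℕ, ∀ i j,
      π i + K ≤ π j ∨ π j + K ≤ π i →
      |covariance (fun z : ℕ → ℝ => z i ^ 2) (fun z => z j ^ 2) ν| ≤ ε * B := by
  obtain ⟨π, hπ⟩ := hν.mixing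
  have hB0 : 0 ≤ B := (variance_nonneg _ _).trans (hν.variance_sq_le hB 0)
  -- The mixing sequence is `i ↦ z (π i)`, so score `i` occupies position `π.symm i`, and distances
  -- are measured between positions.
  refine ⟨π.symm, fun ε hε => ?_⟩
  have hev := (ENNReal.tendsto_atTop_zero.1 hπ) (ENNReal.ofReal ε) (by simpa using hε)
  obtain ⟨K, hK⟩ := hev
  have key : ∀ i j, π.symm i + K ≤ π.symm j →
      |covariance (fun z : ℕ → ℝ => z i ^ 2) (fun z => z j ^ 2) ν| ≤ ε * B := by
    intro i j hij
    have hr := (le_iSup _ (π.symm i)).trans (hK K le_rfl)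
    refine abs_covariance_le_of_rho_le hε.le hB0 hr ?_ ?_ (hν.memLp_sq i) (hν.memLp_sq j)
      (hν.variance_sq_le hB i) (hν.variance_sq_le hB j)
    · refine Measurable.pow_const ?_ 2
      have h1 : MeasurableSpace.comap (fun z : ℕ → ℝ => z (π (π.symm i))) inferInstance ≤
          sigmaOf (fun i (z : ℕ → ℝ) => z (π i)) {l | l ≤ π.symm i} :=
        le_iSup₂_of_le (π.symm i) (by simp) le_rfl
      rw [Equiv.apply_symm_apply] at h1
      exact (comap_measurable _).mono h1 le_rfl
    · refine Measurable.pow_const ?_ 2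
      have h1 : MeasurableSpace.comap (fun z : ℕ → ℝ => z (π (π.symm j))) inferInstance ≤
          sigmaOf (fun i (z : ℕ → ℝ) => z (π i)) {l | π.symm i + K ≤ l} :=
        le_iSup₂_of_le (π.symm j) (by simpa using hij) le_rfl
      rw [Equiv.apply_symm_apply] at h1
      exact (comap_measurable _).mono h1 le_rfl
  refine ⟨K, fun i j hij => ?_⟩
  rcases hij with hij | hij
  · exact key i j hij
  · rw [covariance_comm]
    exact key j i hij

/-- The permutation maps the indices close to `i` injectively into an interval of length at most `2
* K`. -/
theorem card_close_le (π : Equiv.Perm ℕ) (K p i : ℕ) :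
    ((Finset.range p).filter fun j => ¬ (π i + K ≤ π j ∨ π j + K ≤ π i)).card ≤ 2 * K := by
  have : ((Finset.range p).filter fun j => ¬ (π i + K ≤ π j ∨ π j + K ≤ π i)).card ≤
      (Finset.Ico (π i - K) (π i + K)).card := by
    refine Finset.card_le_card_of_injOn π ?_ π.injective.injOn
    intro j hj
    simp only [Finset.coe_filter, Set.mem_ofPred_eq] at hj
    simp only [Finset.coe_Ico, Set.mem_Ico]
    omega
  refine this.trans ?_
  rw [Nat.card_Ico]
  omega

theorem IsScoreLaw.integral_weighted_sq_sub_one [IsProbabilityMeasure ν] (hν : IsScoreLaw ν)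
    (t : ℕ → ℝ) (p : ℕ) :
    ∫ z, (∑ i ∈ Finset.range p, t i * (z i ^ 2 - 1)) ^ 2 ∂ν =
      ∑ i ∈ Finset.range p, ∑ j ∈ Finset.range p,
        t i * t j * covariance (fun z : ℕ → ℝ => z i ^ 2) (fun z => z j ^ 2) ν := by
  have hm : ∀ i, MemLp (fun z : ℕ → ℝ => z i ^ 2 - 1) 2 ν := fun i =>
    (hν.memLp_sq i).sub (memLp_const 1)
  have h : ∀ z : ℕ → ℝ, (∑ i ∈ Finset.range p, t i * (z i ^ 2 - 1)) ^ 2 =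
      ∑ i ∈ Finset.range p, ∑ j ∈ Finset.range p,
        (t i * t j) * ((z i ^ 2 - 1) * (z j ^ 2 - 1)) := by
    intro z
    rw [pow_two, Finset.sum_mul_sum]
    exact Finset.sum_congr rfl fun i _ => Finset.sum_congr rfl fun j _ => by ring
  have hint : ∀ i j, Integrable (fun z : ℕ → ℝ => (z i ^ 2 - 1) * (z j ^ 2 - 1)) ν := fun i j =>
    (hm i).integrable_mul (hm j)
  simp_rw [h]
  rw [integral_finsetSum _ fun i _ => integrable_finsetSum _ fun j _ => (hint i j).const_mul _]
  refine Finset.sum_congr rfl fun i _ => ?_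
  rw [integral_finsetSum _ fun j _ => (hint i j).const_mul _]
  refine Finset.sum_congr rfl fun j _ => ?_
  rw [integral_const_mul, covariance, hν.unit_var, hν.unit_var]

/-- The mean square of the averages of weighted centred squared scores tends to zero. -/
theorem IsScoreLaw.tendsto_integral_average_sq [IsProbabilityMeasure ν] (hν : IsScoreLaw ν)
    {t : ℕ → ℝ} {C : ℝ} (ht : ∀ i, |t i| ≤ C) :
    Tendsto (fun p : ℕ => ∫ z, ((p : ℝ)⁻¹ * ∑ i ∈ Finset.range p, t i * (z i ^ 2 - 1)) ^ 2 ∂ν)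
      atTop (𝓝 0) := by
  obtain ⟨B, hB⟩ := hν.fourth_moment
  have hB0 : 0 ≤ B := (variance_nonneg _ _).trans (hν.variance_sq_le hB 0)
  have hC0 : 0 ≤ C := (abs_nonneg _).trans (ht 0)
  obtain ⟨π, hπ⟩ := hν.exists_covariance_sq_le hB
  have hcov : ∀ i j, |covariance (fun z : ℕ → ℝ => z i ^ 2) (fun z => z j ^ 2) ν| ≤ B :=
    fun i j => abs_covariance_le_of_variance_le (hν.memLp_sq i) (hν.memLp_sq j)
      (hν.variance_sq_le hB i) (hν.variance_sq_le hB j)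
  rw [Metric.tendsto_atTop]
  intro η hη
  -- Distant pairs contribute at most `C² ε B`, which this choice keeps below `η / 2`; the summand
  -- `1` avoids division by zero. The bound `p0` does the same for the `2 * K` close indices of each
  -- row.
  set ε := η / (2 * (C ^ 2 * B + 1)) with hεdef
  have hε : 0 < ε := by positivity
  obtain ⟨K, hK⟩ := hπ ε hε
  obtain ⟨p0, hp0⟩ := exists_nat_gt (C ^ 2 * B * (2 * K) / (η / 2))
  refine ⟨max p0 1, fun p hp => ?_⟩
  have hp1 : 1 ≤ p := (le_max_right _ _).trans hp
  have hpp : (p0 : ℝ) ≤ p := by exact_mod_cast (le_max_left _ _).trans hp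
  have hppos : (0 : ℝ) < p := by exact_mod_cast hp1
  -- Each row splits into distant indices, with covariance at most `ε * B` by mixing, and at most `2
  -- * K` close ones, with the trivial bound `B`.
  have hrow : ∀ i, ∑ j ∈ Finset.range p,
      |covariance (fun z : ℕ → ℝ => z i ^ 2) (fun z => z j ^ 2) ν| ≤ p * (ε * B) + 2 * K * B := by
    intro i
    rw [← Finset.sum_filter_add_sum_filter_not (Finset.range p)
      (fun j => π i + K ≤ π j ∨ π j + K ≤ π i)]
    refine add_le_add ?_ ?_
    · refine (Finset.sum_le_card_nsmul _ _ (ε * B) fun j hj => ?_).trans ?_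
      · exact hK i j (Finset.mem_filter.1 hj).2
      · rw [nsmul_eq_mul]
        refine mul_le_mul_of_nonneg_right ?_ (by positivity)
        exact_mod_cast (Finset.card_filter_le _ _).trans (Finset.card_range p).le
    · refine (Finset.sum_le_card_nsmul _ _ B fun j _ => hcov i j).trans ?_
      rw [nsmul_eq_mul]
      refine mul_le_mul_of_nonneg_right ?_ hB0
      exact_mod_cast card_close_le π K p i
  have hbound : ∫ z, ((p : ℝ)⁻¹ * ∑ i ∈ Finset.range p, t i * (z i ^ 2 - 1)) ^ 2 ∂ν ≤
      C ^ 2 * (ε * B) + C ^ 2 * B * (2 * K) / p := by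
    simp_rw [mul_pow]
    rw [integral_const_mul, hν.integral_weighted_sq_sub_one]
    have hsum : ∑ i ∈ Finset.range p, ∑ j ∈ Finset.range p,
        t i * t j * covariance (fun z : ℕ → ℝ => z i ^ 2) (fun z => z j ^ 2) ν ≤
        ∑ i ∈ Finset.range p, C ^ 2 * (p * (ε * B) + 2 * K * B) := by
      refine Finset.sum_le_sum fun i _ => ?_
      refine le_trans ?_ (mul_le_mul_of_nonneg_left (hrow i) (sq_nonneg C))
      rw [Finset.mul_sum]
      refine Finset.sum_le_sum fun j _ => (le_abs_self _).trans ?_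
      rw [abs_mul, abs_mul, pow_two]
      gcongr
      exacts [ht i, ht j]
    rw [Finset.sum_const, Finset.card_range, nsmul_eq_mul] at hsum
    refine (mul_le_mul_of_nonneg_left hsum (by positivity)).trans (le_of_eq ?_)
    field_simp
  have hnonneg : 0 ≤ ∫ z, ((p : ℝ)⁻¹ * ∑ i ∈ Finset.range p, t i * (z i ^ 2 - 1)) ^ 2 ∂ν :=
    integral_nonneg fun z => sq_nonneg _
  rw [Real.dist_eq, sub_zero, abs_of_nonneg hnonneg]
  have h1 : C ^ 2 * (ε * B) ≤ η / 2 := by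
    have : C ^ 2 * (ε * B) = (η / 2) * (C ^ 2 * B / (C ^ 2 * B + 1)) := by
      rw [hεdef]; field_simp
    rw [this]
    refine mul_le_of_le_one_right (by positivity) ?_
    rw [div_le_one (by positivity)]
    linarith
  have h2 : C ^ 2 * B * (2 * K) / p < η / 2 := by
    rw [div_lt_iff₀ hppos]
    rw [div_lt_iff₀ (by positivity)] at hp0
    nlinarith
  linarith

end Scores

end DataPiling

/-! ### Decomposition of an observation into mean, spikes and noise; limits for the noise -/

namespace DataPiling

namespace TwoClassModel

variable (M : TwoClassModel)

/-- The scaled noise part of an observation: the tail eigenvalues in all directions. -/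
def noise (k : Fin 2) (p : ℕ) (z : ℕ → ℝ) : E p :=
  (√(p : ℝ))⁻¹ • ∑ i : Fin p, (√(M.tailVar k i) * z i) • M.eigvec k p i

/-- The scaled standard deviation of the spike in direction `u_{(k),i}` in excess of the noise. -/
def spikeCoef (k : Fin 2) (p i : ℕ) : ℝ :=
  (√(M.eigval k p i) - √(M.tailVar k i)) / √(p : ℝ)

/-- Writing `√eigval = (√eigval - √tailVar) + √tailVar` puts a tail-sized component in every
direction, the leading ones included, into the noise. The noise thus has a uniform description and
its squared norm averages all `τ_i²`; the spike coefficient is zero beyond `m k`. -/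
theorem smul_obs {k : Fin 2} {p : ℕ} (hp : M.m k ≤ p) (z : ℕ → ℝ) :
    (√(p : ℝ))⁻¹ • M.obs k p z = (√(p : ℝ))⁻¹ • M.mean k p +
      ∑ i : Fin (M.m k), (M.spikeCoef k p i * z i) • M.lead k p i + M.noise k p z := by
  set G : ℕ → E p := fun i => if h : i < p then
    (M.spikeCoef k p i * z i) • M.eigvec k p ⟨i, h⟩ else 0 with hG
  have h1 : ∑ i : Fin (M.m k), (M.spikeCoef k p i * z i) • M.lead k p i = ∑ i : Fin p, G i := by
    rw [Fin.sum_univ_eq_sum_range G p, ← Finset.sum_subset (Finset.range_mono hp),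
      ← Fin.sum_univ_eq_sum_range G]
    · refine Finset.sum_congr rfl fun i _ => ?_
      have hi : (i : ℕ) < p := lt_of_lt_of_le i.2 hp
      simp [hG, hi, lead]
    · intro i hi hi'
      simp only [Finset.mem_range] at hi hi'
      simp [hG, hi, spikeCoef, eigval, hi']
  have h2 : ∑ i : Fin p, G i + M.noise k p z =
      (√(p : ℝ))⁻¹ • ∑ i : Fin p, (√(M.eigval k p i) * z i) • M.eigvec k p i := by
    rw [noise, Finset.smul_sum, Finset.smul_sum, ← Finset.sum_add_distrib]
    refine Finset.sum_congr rfl fun i _ => ?_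
    simp only [hG, i.2, dif_pos, Fin.eta, smul_smul, ← add_smul]
    congr 1
    rw [spikeCoef]
    ring
  rw [obs, smul_add, h1, add_assoc, h2]

theorem tendsto_spikeCoef (k : Fin 2) {i : ℕ} (hi : i < M.m k) :
    Tendsto (fun p => M.spikeCoef k p i) atTop (𝓝 √(M.spikeVar k i)) := by
  have hinv : Tendsto (fun p : ℕ => (p : ℝ)⁻¹) atTop (𝓝 0) := tendsto_inv_atTop_nhds_zero_nat
  have h1 : Tendsto (fun p : ℕ => √(M.spikeVar k i + M.tailVar k i * (p : ℝ)⁻¹) -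
      √(M.tailVar k i) * √((p : ℝ)⁻¹)) atTop (𝓝 (√(M.spikeVar k i + M.tailVar k i * 0) -
      √(M.tailVar k i) * √0)) :=
    ((tendsto_const_nhds.add (hinv.const_mul _)).sqrt).sub ((hinv.sqrt).const_mul _)
  simp only [mul_zero, add_zero, Real.sqrt_zero, sub_zero] at h1
  refine h1.congr' ?_
  filter_upwards [eventually_gt_atTop 0] with p hp
  have hp' : (0 : ℝ) < p := by exact_mod_cast hp
  rw [spikeCoef, sub_div, eigval, if_pos hi, ← Real.sqrt_div' _ hp'.le, Real.sqrt_inv,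
    ← div_eq_mul_inv, ← div_eq_mul_inv]
  congr 2
  field_simp

theorem measurable_noise (k : Fin 2) (p : ℕ) : Measurable (M.noise k p) := by
  unfold noise
  fun_prop

theorem measurable_obs (k : Fin 2) (p : ℕ) : Measurable (M.obs k p) := by
  unfold obs
  fun_prop

theorem inner_noise (k : Fin 2) (p : ℕ) (z : ℕ → ℝ) (v : E p) :
    inner ℝ (M.noise k p z) v =
      ∑ i : Fin p, ((√(p : ℝ))⁻¹ * √(M.tailVar k i) * inner ℝ (M.eigvec k p i) v) * z i := by
  rw [noise, real_inner_smul_left, sum_inner, Finset.mul_sum]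
  refine Finset.sum_congr rfl fun i _ => ?_
  rw [real_inner_smul_left]
  ring

variable {M}

theorem norm_noise_sq (ht : ∀ k i, 0 < M.tailVar k i) (k : Fin 2) (p : ℕ) (z : ℕ → ℝ) :
    ‖M.noise k p z‖ ^ 2 = (p : ℝ)⁻¹ * ∑ i ∈ Finset.range p, M.tailVar k i * z i ^ 2 := by
  rw [noise, norm_smul, mul_pow, ← real_inner_self_eq_norm_sq (∑ i : Fin p, _),
    (M.eigvec k p).orthonormal.inner_sum, ← Fin.sum_univ_eq_sum_range]
  congr 1
  · simp
  · refine Finset.sum_congr rfl fun i _ => ?_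
    have := Real.mul_self_sqrt (ht k i).le
    simp only [conj_trivial]
    calc _ = (√(M.tailVar k i) * √(M.tailVar k i)) * z i ^ 2 := by ring
      _ = _ := by rw [this]

/-- Uncorrelated scores give the second moment `p⁻¹ ∑ τ_i² ⟪u_i, v⟫²`, and Parseval bounds it by `C
‖v‖² / p`. No mixing is needed here. -/
theorem lintegral_inner_noise_sq_le {k : Fin 2} {ν : Measure (ℕ → ℝ)} [IsProbabilityMeasure ν]
    (hν : IsScoreLaw ν) (ht : ∀ k i, 0 < M.tailVar k i) {C : ℝ} (hC : ∀ k i, M.tailVar k i ≤ C)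
    {p : ℕ} (v : E p) :
    ∫⁻ z, ENNReal.ofReal (inner ℝ (M.noise k p z) v ^ 2) ∂ν ≤
      ENNReal.ofReal (C / p) * ENNReal.ofReal (‖v‖ ^ 2) := by
  have hC0 : 0 ≤ C := (ht k 0).le.trans (hC k 0)
  simp_rw [M.inner_noise]
  rw [hν.lintegral_linear_sq, ← ENNReal.ofReal_mul (by positivity)]
  refine ENNReal.ofReal_le_ofReal ?_
  rw [← (M.eigvec k p).sum_sq_inner_right v, Finset.mul_sum]
  refine Finset.sum_le_sum fun i _ => ?_
  rw [mul_pow, mul_pow, inv_pow, Real.sq_sqrt (Nat.cast_nonneg p), Real.sq_sqrt (ht k i).le]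
  have := hC k i
  rw [div_eq_inv_mul]
  gcongr

variable {Ω : Type*} [MeasurableSpace Ω] {P : Measure Ω} [IsProbabilityMeasure P]

/-- Independence makes the joint law of `(W, Z)` a product, so the bound for fixed vectors can be
integrated over the law of `W`. -/
theorem lintegral_inner_noise_indep_le {k : Fin 2} {ν : Measure (ℕ → ℝ)} [IsProbabilityMeasure ν]
    (hν : IsScoreLaw ν) (ht : ∀ k i, 0 < M.tailVar k i) {C : ℝ} (hC : ∀ k i, M.tailVar k i ≤ C)
    {Z : Ω → ℕ → ℝ} (hZ : HasLaw Z ν P) {p : ℕ} {W : Ω → E p} (hW : AEMeasurable W P)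
    (hind : IndepFun W Z P) :
    ∫⁻ ω, ENNReal.ofReal (inner ℝ (M.noise k p (Z ω)) (W ω) ^ 2) ∂P ≤
      ENNReal.ofReal (C / p) * ∫⁻ ω, ENNReal.ofReal (‖W ω‖ ^ 2) ∂P := by
  have hprod := (indepFun_iff_map_prod_eq_prod_map_map hW hZ.aemeasurable).1 hind
  rw [hZ.map_eq] at hprod
  have hF : Measurable fun x : E p × (ℕ → ℝ) =>
      ENNReal.ofReal (inner ℝ (M.noise k p x.2) x.1 ^ 2) := by
    have := M.measurable_noise k p
    fun_prop
  have hWp : IsProbabilityMeasure (P.map W) := Measure.isProbabilityMeasure_map hW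
  calc ∫⁻ ω, ENNReal.ofReal (inner ℝ (M.noise k p (Z ω)) (W ω) ^ 2) ∂P
      = ∫⁻ x, ENNReal.ofReal (inner ℝ (M.noise k p x.2) x.1 ^ 2)
          ∂(P.map fun ω => (W ω, Z ω)) := by
        rw [lintegral_map' hF.aemeasurable (hW.prodMk hZ.aemeasurable)]
    _ = ∫⁻ w, ∫⁻ z, ENNReal.ofReal (inner ℝ (M.noise k p z) w ^ 2) ∂ν ∂(P.map W) := by
        rw [hprod, lintegral_prod _ hF.aemeasurable]
    _ ≤ ∫⁻ w, ENNReal.ofReal (C / p) * ENNReal.ofReal (‖w‖ ^ 2) ∂(P.map W) :=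
        lintegral_mono fun w => lintegral_inner_noise_sq_le hν ht hC w
    _ = ENNReal.ofReal (C / p) * ∫⁻ ω, ENNReal.ofReal (‖W ω‖ ^ 2) ∂P := by
        rw [lintegral_const_mul _ (by fun_prop), lintegral_map' (by fun_prop) hW]

/-- The noise is asymptotically orthogonal to independent vectors with bounded second moment. -/
theorem tendstoInMeasure_inner_noise {k : Fin 2} {ν : Measure (ℕ → ℝ)} [IsProbabilityMeasure ν]
    (hν : IsScoreLaw ν) (ht : ∀ k i, 0 < M.tailVar k i) {C : ℝ} (hC : ∀ k i, M.tailVar k i ≤ C)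
    {Z : Ω → ℕ → ℝ} (hZ : HasLaw Z ν P) {W : ∀ p, Ω → E p} {B : ℝ}
    (hW : ∀ᶠ p in atTop, AEMeasurable (W p) P ∧ IndepFun (W p) Z P ∧
      ∫⁻ ω, ENNReal.ofReal (‖W p ω‖ ^ 2) ∂P ≤ ENNReal.ofReal B) :
    TendstoInMeasure P (fun p ω => inner ℝ (M.noise k p (Z ω)) (W p ω)) atTop (fun _ => 0) := by
  refine tendstoInMeasure_zero_of_lintegral_sq
    (B := fun p : ℕ => ENNReal.ofReal (C / p) * ENNReal.ofReal B) ?_ ?_ ?_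
  · filter_upwards [hW] with p hp
    exact ((M.measurable_noise k p).comp_aemeasurable hZ.aemeasurable).inner hp.1
  · have h1 : Tendsto (fun p : ℕ => ENNReal.ofReal (C / p)) atTop (𝓝 0) := by
      have := ENNReal.tendsto_ofReal (tendsto_const_div_atTop_nhds_zero_nat C)
      simpa using this
    have := ENNReal.Tendsto.mul_const (b := ENNReal.ofReal B) h1 (Or.inr ENNReal.ofReal_ne_top)
    simpa using this
  · filter_upwards [hW] with p hp
    refine (lintegral_inner_noise_indep_le hν ht hC hZ hp.1 hp.2.1).trans ?_
    gcongr
    exact hp.2.2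

theorem integrable_norm_noise_sq {k : Fin 2} {ν : Measure (ℕ → ℝ)} [IsProbabilityMeasure ν]
    (hν : IsScoreLaw ν) (ht : ∀ k i, 0 < M.tailVar k i) (p : ℕ) :
    Integrable (fun z => ‖M.noise k p z‖ ^ 2) ν := by
  simp_rw [norm_noise_sq ht]
  exact (integrable_finsetSum _ fun i _ => ((hν.memLp_two i).integrable_sq).const_mul _).const_mul _

omit [IsProbabilityMeasure P] in
theorem lintegral_norm_noise_sq_le {k : Fin 2} {ν : Measure (ℕ → ℝ)} [IsProbabilityMeasure ν]
    (hν : IsScoreLaw ν) (ht : ∀ k i, 0 < M.tailVar k i) {C : ℝ} (hC : ∀ k i, M.tailVar k i ≤ C)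
    {Z : Ω → ℕ → ℝ} (hZ : HasLaw Z ν P) (p : ℕ) :
    ∫⁻ ω, ENNReal.ofReal (‖M.noise k p (Z ω)‖ ^ 2) ∂P ≤ ENNReal.ofReal C := by
  have hm := M.measurable_noise k p
  have hC0 : 0 ≤ C := (ht k 0).le.trans (hC k 0)
  have h := hZ.lintegral_comp (f := fun z => ENNReal.ofReal (‖M.noise k p z‖ ^ 2)) (by fun_prop)
  refine (le_of_eq h).trans ?_
  rw [← ofReal_integral_eq_lintegral_ofReal (integrable_norm_noise_sq hν ht p)
    (.of_forall fun z => sq_nonneg _)]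
  refine ENNReal.ofReal_le_ofReal ?_
  simp_rw [norm_noise_sq ht]
  rw [integral_const_mul,
    integral_finsetSum _ fun i _ => ((hν.memLp_two i).integrable_sq).const_mul _]
  simp_rw [integral_const_mul, hν.unit_var, mul_one]
  rcases Nat.eq_zero_or_pos p with rfl | hp
  · simpa using hC0
  have hp' : (0 : ℝ) < p := by exact_mod_cast hp
  rw [inv_mul_le_iff₀ hp']
  refine (Finset.sum_le_card_nsmul _ _ C fun i _ => hC k i).trans ?_
  simp

/-- The squared norm is the average of the `τ_i²`, which tends to `τ²`, plus the average of the
`τ_i² (z_i² - 1)`, which vanishes in mean square by mixing. -/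
theorem tendstoInMeasure_norm_noise_sq {τ : ℝ} (htail : M.EqualTail τ) {k : Fin 2}
    {ν : Measure (ℕ → ℝ)} [IsProbabilityMeasure ν] (hν : IsScoreLaw ν)
    {Z : Ω → ℕ → ℝ} (hZ : HasLaw Z ν P) :
    TendstoInMeasure P (fun p ω => ‖M.noise k p (Z ω)‖ ^ 2) atTop (fun _ => τ ^ 2) := by
  obtain ⟨C, hC⟩ := htail.tail_bdd
  have ht := htail.tail_pos
  have hZm := hZ.aemeasurable
  set f : ℕ → (ℕ → ℝ) → ℝ := fun p z =>
    (p : ℝ)⁻¹ * ∑ i ∈ Finset.range p, M.tailVar k i * (z i ^ 2 - 1) with hf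
  have hfm : ∀ p, Measurable (f p) := fun p => by rw [hf]; fun_prop
  have hint := hν.tendsto_integral_average_sq (t := M.tailVar k) (C := C)
    (fun i => by rw [abs_of_pos (ht k i)]; exact hC k i)
  have h0 : TendstoInMeasure P (fun p ω => f p (Z ω)) atTop (fun _ => 0) := by
    refine tendstoInMeasure_zero_of_lintegral_sq
      (B := fun p => ENNReal.ofReal (∫ z, f p z ^ 2 ∂ν)) ?_ ?_ ?_
    · exact .of_forall fun p => (hfm p).comp_aemeasurable hZm
    · simpa using ENNReal.tendsto_ofReal hint
    · refine .of_forall fun p => ?_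
      have hfp := hfm p
      have h := hZ.lintegral_comp (f := fun z => ENNReal.ofReal (f p z ^ 2)) (by fun_prop)
      refine (le_of_eq h).trans (le_of_eq ?_)
      rw [ofReal_integral_eq_lintegral_ofReal ?_ (.of_forall fun z => sq_nonneg _)]
      refine MemLp.integrable_sq ?_
      exact (memLp_finsetSum _ fun i _ =>
        ((hν.memLp_sq i).sub (memLp_const 1)).const_mul _).const_mul _
  refine AsympAE.tendstoInMeasure (.of_forall fun p => ?_)
    ((AsympAE.of_tendstoInMeasure h0).mono (.of_forall fun ω U hU hω => ?_))
  · have := (M.measurable_noise k p).comp_aemeasurable hZm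
    exact this.norm.pow_const 2
  · have h1 := hω.add ((htail.tail_avg k).mono_left hU)
    rw [zero_add] at h1
    refine h1.congr fun p => ?_
    rw [norm_noise_sq ht, hf]
    simp only
    rw [← mul_add, ← Finset.sum_add_distrib]
    congr 1
    exact Finset.sum_congr rfl fun i _ => by ring

end TwoClassModel

end DataPiling

namespace DataPiling

/-! ### Linear algebra of the limiting eigen-decomposition -/

/-- A downward closed subset of `Fin n` is an initial segment. For eigenvalues in descending order
this turns a count of indices into a condition `i < m`. -/
theorem mem_iff_lt_card_of_lower {n : ℕ} {s : Finset (Fin n)} (h : ∀ i ∈ s, ∀ j ≤ i, j ∈ s)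
    (i : Fin n) : i ∈ s ↔ (i : ℕ) < s.card := by
  constructor
  · intro hi
    have hsub : Finset.Iic i ⊆ s := fun j hj => h i hi j (Finset.mem_Iic.1 hj)
    have := Finset.card_le_card hsub
    rw [Fin.card_Iic] at this
    omega
  · intro hlt
    by_contra hi
    have hsub : s ⊆ Finset.Iio i := by
      intro j hj
      rw [Finset.mem_Iio]
      by_contra hij
      exact hi (h j hj i (not_lt.1 hij))
    have := Finset.card_le_card hsub
    rw [Fin.card_Iio] at this
    omega

/-- The eigenvectors `c i` of a quadratic form `‖A c‖² + τ² ‖c‖²` on `K`, with eigenvalues `L i` in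
descending order. -/
structure IsLimitEigen {ι : Type*} [Fintype ι] {m r : ℕ} (τ : ℝ)
    (K : Submodule ℝ (EuclideanSpace ℝ ι))
    (A : EuclideanSpace ℝ ι →ₗ[ℝ] EuclideanSpace ℝ (Fin m))
    (c : Fin r → EuclideanSpace ℝ ι) (L : Fin r → ℝ) : Prop where
  tau_pos : 0 < τ
  finrank_eq : Module.finrank ℝ K = r
  surj : K.map A = ⊤
  orthonormal : Orthonormal ℝ c
  mem : ∀ i, c i ∈ K
  inner_map : ∀ i j, inner ℝ (A (c i)) (A (c j)) = if i = j then L i - τ ^ 2 else 0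
  anti : Antitone L

namespace IsLimitEigen

variable {ι : Type*} [Fintype ι] {m r : ℕ} {τ : ℝ} {K : Submodule ℝ (EuclideanSpace ℝ ι)}
  {A : EuclideanSpace ℝ ι →ₗ[ℝ] EuclideanSpace ℝ (Fin m)} {c : Fin r → EuclideanSpace ℝ ι}
  {L : Fin r → ℝ} (h : IsLimitEigen τ K A c L)

include h

theorem norm_map_sq (i : Fin r) : ‖A (c i)‖ ^ 2 = L i - τ ^ 2 := by
  rw [← real_inner_self_eq_norm_sq, h.inner_map, if_pos rfl]

theorem sq_le (i : Fin r) : τ ^ 2 ≤ L i := by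
  have := h.norm_map_sq i
  nlinarith [sq_nonneg ‖A (c i)‖]

theorem pos (i : Fin r) : 0 < L i := lt_of_lt_of_le (pow_pos h.tau_pos 2) (h.sq_le i)

theorem map_eq_zero_iff (i : Fin r) : A (c i) = 0 ↔ L i = τ ^ 2 := by
  rw [← norm_eq_zero, ← sq_eq_zero_iff, h.norm_map_sq, sub_eq_zero]

theorem span_eq : Submodule.span ℝ (Set.range c) = K := by
  refine Submodule.eq_of_le_of_finrank_eq (Submodule.span_le.2 ?_) ?_
  · rintro _ ⟨i, rfl⟩
    exact h.mem i
  · rw [finrank_span_eq_card h.orthonormal.linearIndependent, Fintype.card_fin, h.finrank_eq]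

theorem span_map_eq_top : Submodule.span ℝ (Set.range fun i => A (c i)) = ⊤ := by
  rw [← h.surj, ← h.span_eq, Submodule.map_span, ← Set.range_comp]
  rfl

/-- The nonzero `A (c i)` are pairwise orthogonal, hence independent, and they span `ℝ^m` because
`A` is onto; so there are `m` of them. -/
theorem card_support : (Finset.univ.filter fun i => A (c i) ≠ 0).card = m := by
  set S := Finset.univ.filter fun i => A (c i) ≠ 0 with hS
  have hli : LinearIndependent ℝ fun i : S => A (c i) := by
    refine linearIndependent_of_ne_zero_of_inner_eq_zero (fun i => ?_) fun i j hij => ?_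
    · exact (Finset.mem_filter.1 i.2).2
    · exact (h.inner_map i j).trans (if_neg fun hh => hij (Subtype.ext hh))
  have hspan : Submodule.span ℝ (Set.range fun i : S => A (c i)) = ⊤ := by
    rw [eq_top_iff, ← h.span_map_eq_top, Submodule.span_le]
    rintro _ ⟨i, rfl⟩
    by_cases hi : A (c i) = 0
    · simp [hi]
    · exact Submodule.subset_span ⟨⟨i, by simp [hS, hi]⟩, rfl⟩
  have := finrank_span_eq_card hli
  rw [hspan, finrank_top, finrank_euclideanSpace_fin, Fintype.card_coe] at this
  exact this.symm

/-- `A (c i) ≠ 0` means `L i > τ²`, a downward closed condition for descending `L`, and it holds for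
exactly `m` indices. This is the spectral gap on which the ridge correction relies. -/
theorem map_ne_zero_iff_lt (i : Fin r) : A (c i) ≠ 0 ↔ (i : ℕ) < m := by
  have hlow := mem_iff_lt_card_of_lower (s := Finset.univ.filter fun i => A (c i) ≠ 0) (by
    intro i hi j hji
    simp only [Finset.mem_filter, Finset.mem_univ, true_and, Ne, h.map_eq_zero_iff] at hi ⊢
    have h1 := h.anti hji
    have h2 := lt_of_le_of_ne (h.sq_le i) (Ne.symm hi)
    exact (h2.trans_le h1).ne') i
  rw [h.card_support] at hlow
  simpa using hlow

theorem lt_of_lt {i : Fin r} (hi : (i : ℕ) < m) : τ ^ 2 < L i := by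
  have h1 := (h.map_ne_zero_iff_lt i).2 hi
  rw [Ne, h.map_eq_zero_iff] at h1
  exact lt_of_le_of_ne (h.sq_le i) (Ne.symm h1)

theorem map_eq_zero_of_le {i : Fin r} (hi : m ≤ (i : ℕ)) : A (c i) = 0 := by
  by_contra h1
  exact absurd ((h.map_ne_zero_iff_lt i).1 h1) (not_lt.2 hi)

theorem eq_of_le {i : Fin r} (hi : m ≤ (i : ℕ)) : L i = τ ^ 2 :=
  (h.map_eq_zero_iff i).1 (h.map_eq_zero_of_le hi)

theorem eq_zero_of_inner_eq_zero {q : EuclideanSpace ℝ (Fin m)}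
    (hq : ∀ i, inner ℝ (A (c i)) q = 0) : q = 0 := by
  have hmem : q ∈ Submodule.span ℝ (Set.range fun i => A (c i)) := by
    rw [h.span_map_eq_top]; trivial
  have : inner ℝ q q = 0 := by
    refine Submodule.span_induction (p := fun v _ => inner ℝ v q = 0) ?_ ?_ ?_ ?_ hmem
    · rintro _ ⟨i, rfl⟩
      exact hq i
    · simp
    · intro a b _ _ ha hb
      rw [inner_add_left, ha, hb, add_zero]
    · intro t a _ ha
      rw [real_inner_smul_left, ha, mul_zero]
  exact inner_self_eq_zero.1 this

/-- Expansion of a vector in the orthogonal basis `A (c i)`, `i < m`. -/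
theorem sum_eq (q : EuclideanSpace ℝ (Fin m)) :
    ∑ i with i.val < m, (inner ℝ (A (c i)) q / (L i - τ ^ 2)) • A (c i) = q := by
  rw [← sub_eq_zero]
  refine h.eq_zero_of_inner_eq_zero fun i => ?_
  rw [inner_sub_right, inner_sum]
  simp_rw [real_inner_smul_right, h.inner_map]
  by_cases hi : (i : ℕ) < m
  · have hne : L i - τ ^ 2 ≠ 0 := (sub_pos.2 (h.lt_of_lt hi)).ne'
    rw [Finset.sum_eq_single i]
    · rw [if_pos rfl, div_mul_cancel₀ _ hne, sub_self]
    · intro j _ hj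
      rw [if_neg (Ne.symm hj), mul_zero]
    · intro hn
      simp [hi] at hn
  · rw [h.map_eq_zero_of_le (not_lt.1 hi), inner_zero_left, sub_zero]
    refine Finset.sum_eq_zero fun j hj => ?_
    have : i ≠ j := by
      rintro rfl
      simp [hi] at hj
    rw [if_neg this, mul_zero]

theorem sum_inner_mul_inner (q w : EuclideanSpace ℝ (Fin m)) :
    ∑ i with i.val < m, inner ℝ (A (c i)) q * inner ℝ (A (c i)) w / (L i - τ ^ 2) =
      inner ℝ q w := by
  conv_rhs => rw [← h.sum_eq q, sum_inner]
  refine Finset.sum_congr rfl fun i _ => ?_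
  rw [real_inner_smul_left]
  ring

/-- The minimal squared norm of a preimage of `q` in `K`. -/
theorem isLeast_preimage (q : EuclideanSpace ℝ (Fin m)) :
    IsLeast ((fun v => ‖v‖ ^ 2) '' {v | v ∈ K ∧ A v = q})
      (∑ i with i.val < m, (inner ℝ (A (c i)) q / (L i - τ ^ 2)) ^ 2) := by
  set a : Fin r → ℝ := fun i => inner ℝ (A (c i)) q / (L i - τ ^ 2) with ha
  have hnorm : ‖∑ i with i.val < m, a i • c i‖ ^ 2 = ∑ i with i.val < m, a i ^ 2 := by
    rw [← real_inner_self_eq_norm_sq, h.orthonormal.inner_sum]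
    simp [pow_two]
  constructor
  · refine ⟨∑ i with i.val < m, a i • c i, ⟨?_, ?_⟩, hnorm⟩
    · exact Submodule.sum_mem _ fun i _ => K.smul_mem _ (h.mem i)
    · rw [map_sum]
      simp_rw [map_smul]
      exact h.sum_eq q
  · rintro _ ⟨v, ⟨hv, rfl⟩, rfl⟩
    -- On `K` one has `⟪A (c i), A v⟫ = (L i - τ²) ⟪c i, v⟫`, so every preimage of `q` has the same
    -- coefficients for `i < m`, and Bessel's inequality gives minimality.
    have hbes := h.orthonormal.sum_inner_products_le v (s := Finset.univ.filter (·.val < m))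
    refine le_trans (le_of_eq ?_) hbes
    refine Finset.sum_congr rfl fun i hi => ?_
    have him : (i : ℕ) < m := by simpa using hi
    have hne : L i - τ ^ 2 ≠ 0 := (sub_pos.2 (h.lt_of_lt him)).ne'
    rw [Real.norm_eq_abs, sq_abs]
    congr 1
    rw [div_eq_iff hne]
    rw [← h.span_eq] at hv
    refine Submodule.span_induction
      (p := fun v _ => inner ℝ (A (c i)) (A v) = inner ℝ (c i) v * (L i - τ ^ 2)) ?_ ?_ ?_ ?_ hv
    · rintro _ ⟨j, rfl⟩
      rw [h.inner_map, orthonormal_iff_ite.1 h.orthonormal]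
      split_ifs <;> simp
    · simp
    · intro x y _ _ hx hy
      rw [map_add, inner_add_right, hx, hy, inner_add_right, add_mul]
    · intro t x _ hx
      rw [map_smul, real_inner_smul_right, hx, real_inner_smul_right, mul_assoc]

end IsLimitEigen

end DataPiling

namespace DataPiling

/-! ### Limits of the sample eigenvectors and of the ridged discriminant vector -/

/-- The ridged discriminant vector in terms of the nonzero part of the eigen-decomposition. -/
def ridge {p m r : ℕ} (α : ℝ) (u : Fin r → E p) (ell : Fin r → ℝ) (D : E p) : E p :=
  D + ∑ i, (((if i.val < m then α / (ell i + α) else 0) - 1) * inner ℝ (u i) D) • u i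

/-- Along the ultrafilter `U`, the Gram matrix of the data `x` and of the mean difference `D`
converges to that of a sample with signal `A`, `q` and with noise level `τ`; `u`, `ell` are the
eigenvectors and eigenvalues of the scatter matrix of `x` with positive eigenvalues. -/
structure IsSampleLimit {ι : Type*} [Fintype ι] [DecidableEq ι] {m r : ℕ} (U : Ultrafilter ℕ)
    (τ s : ℝ) (K : Submodule ℝ (EuclideanSpace ℝ ι))
    (A : EuclideanSpace ℝ ι →ₗ[ℝ] EuclideanSpace ℝ (Fin m)) (q : EuclideanSpace ℝ (Fin m))
    (x : ∀ p, ι → E p) (D : ∀ p, E p) (b : ∀ p, Fin m → E p) (α : ℕ → ℝ)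
    (u : ∀ p, Fin r → E p) (ell : ℕ → Fin r → ℝ) : Prop where
  tau_pos : 0 < τ
  s_pos : 0 < s
  finrank_eq : Module.finrank ℝ K = r
  surj : K.map A = ⊤
  gram : ∃ Q : ι → ι → ℝ, (∀ a a', Tendsto (fun p => inner ℝ (x p a) (x p a')) U (𝓝 (Q a a'))) ∧
    ∀ c ∈ K, ∀ c' ∈ K, ∑ a, ∑ a', c a * c' a' * Q a a' =
      inner ℝ (A c) (A c') + τ ^ 2 * inner ℝ c c'
  basis : ∀ a j, Tendsto (fun p => inner ℝ (x p a) (b p j)) U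
    (𝓝 (A (EuclideanSpace.single a 1) j))
  diff : ∀ a, Tendsto (fun p => inner ℝ (x p a) (D p)) U
    (𝓝 (inner ℝ (A (EuclideanSpace.single a 1)) q))
  diff_basis : ∀ j, Tendsto (fun p => inner ℝ (D p) (b p j)) U (𝓝 (q j))
  norm_diff : Tendsto (fun p => ‖D p‖ ^ 2) U (𝓝 (‖q‖ ^ 2 + s))
  alpha : Tendsto α U (𝓝 (-τ ^ 2))
  orthonormal : ∀ᶠ p in U, Orthonormal ℝ (u p)
  eigen : ∀ᶠ p in U, ∀ i, ∑ a, inner ℝ (x p a) (u p i) • x p a = ell p i • u p i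
  pos : ∀ᶠ p in U, ∀ i, 0 < ell p i
  anti : ∀ᶠ p in U, Antitone (ell p)
  mem : ∀ᶠ p in U, ∀ i, WithLp.toLp 2 (fun a => inner ℝ (x p a) (u p i)) ∈ K

namespace IsSampleLimit

variable {ι : Type*} [Fintype ι] [DecidableEq ι] {m r : ℕ} {U : Ultrafilter ℕ}
    {τ s : ℝ} {K : Submodule ℝ (EuclideanSpace ℝ ι)}
    {A : EuclideanSpace ℝ ι →ₗ[ℝ] EuclideanSpace ℝ (Fin m)} {q : EuclideanSpace ℝ (Fin m)}
    {x : ∀ p, ι → E p} {D : ∀ p, E p} {b : ∀ p, Fin m → E p} {α : ℕ → ℝ}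
    {u : ∀ p, Fin r → E p} {ell : ℕ → Fin r → ℝ}
    (h : IsSampleLimit U τ s K A q x D b α u ell)

include h

/-- The normalized coefficient vectors of the sample eigenvectors are orthonormal in `K` and
diagonalize the Gram matrix of `x`. Being bounded, they converge along `U`, and the limit of the
Gram form makes the limits eigenvectors of `‖A c‖² + τ² ‖c‖²`. -/
theorem exists_limit : ∃ (c : Fin r → EuclideanSpace ℝ ι) (L : Fin r → ℝ),
    IsLimitEigen τ K A c L ∧ (∀ i, Tendsto (fun p => ell p i) U (𝓝 (L i))) ∧
    ∀ i a, Tendsto (fun p => inner ℝ (x p a) (u p i)) U (𝓝 (√(L i) * c i a)) := by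
  obtain ⟨Q, hQ, hQK⟩ := h.gram
  -- These are the right singular vectors of the data matrix: `√(ell p i) * cp p i a = ⟪x p a, u p
  -- i⟫`.
  set cp : ℕ → Fin r → ι → ℝ := fun p i a => (√(ell p i))⁻¹ * inner ℝ (x p a) (u p i) with hcp
  have horth : ∀ᶠ p in U, ∀ i j, ∑ a, cp p i a * cp p j a = if i = j then 1 else 0 := by
    filter_upwards [h.orthonormal, h.eigen, h.pos] with p ho he hpos i j
    have h1 : ∑ a, inner ℝ (x p a) (u p i) * inner ℝ (x p a) (u p j) =
        ell p i * if i = j then 1 else 0 := by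
      have := congrArg (fun v => inner ℝ v (u p j)) (he i)
      simp only [sum_inner, real_inner_smul_left, orthonormal_iff_ite.1 ho i j] at this
      exact this
    calc ∑ a, cp p i a * cp p j a = (√(ell p i))⁻¹ * (√(ell p j))⁻¹ *
          ∑ a, inner ℝ (x p a) (u p i) * inner ℝ (x p a) (u p j) := by
          rw [Finset.mul_sum]
          exact Finset.sum_congr rfl fun a _ => by simp only [hcp]; ring
      _ = _ := by
          rw [h1]
          split_ifs with hij
          · subst hij
            rw [← mul_inv, Real.mul_self_sqrt (hpos i).le, mul_one, inv_mul_cancel₀ (hpos i).ne']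
          · simp
  have hquad : ∀ᶠ p in U, ∀ i j, ∑ a, ∑ a', cp p i a * cp p j a' * inner ℝ (x p a) (x p a') =
      if i = j then ell p i else 0 := by
    filter_upwards [h.orthonormal, h.eigen, h.pos] with p ho he hpos i j
    have h1 : ∑ a, ∑ a', inner ℝ (x p a) (u p i) * inner ℝ (x p a') (u p j) *
        inner ℝ (x p a) (x p a') = ell p i * ell p j * if i = j then 1 else 0 := by
      have : inner ℝ (∑ a, inner ℝ (x p a) (u p i) • x p a)
          (∑ a, inner ℝ (x p a) (u p j) • x p a) = ell p i * ell p j * if i = j then 1 else 0 := by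
        rw [he i, he j, real_inner_smul_left, real_inner_smul_right,
          orthonormal_iff_ite.1 ho i j]
        ring
      rw [← this, sum_inner]
      refine Finset.sum_congr rfl fun a _ => ?_
      rw [inner_sum]
      refine Finset.sum_congr rfl fun a' _ => ?_
      rw [real_inner_smul_left, real_inner_smul_right]
      ring
    calc ∑ a, ∑ a', cp p i a * cp p j a' * inner ℝ (x p a) (x p a')
        = (√(ell p i))⁻¹ * (√(ell p j))⁻¹ *
          ∑ a, ∑ a', inner ℝ (x p a) (u p i) * inner ℝ (x p a') (u p j) *
            inner ℝ (x p a) (x p a') := by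
          simp only [Finset.mul_sum]
          exact Finset.sum_congr rfl fun a _ => Finset.sum_congr rfl fun a' _ => by
            simp only [hcp]; ring
      _ = _ := by
          rw [h1]
          split_ifs with hij
          · subst hij
            rw [← mul_inv, Real.mul_self_sqrt (hpos i).le]
            field_simp [(hpos i).ne']
          · simp
  have hbdd : ∀ i a, ∃ y, Tendsto (fun p => cp p i a) U (𝓝 y) := by
    intro i a
    refine exists_tendsto_of_abs_le U (C := 1) ?_
    filter_upwards [horth] with p hp
    have h1 := hp i i
    rw [if_pos rfl] at h1
    have h2 : cp p i a * cp p i a ≤ ∑ a, cp p i a * cp p i a :=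
      Finset.single_le_sum (f := fun a => cp p i a * cp p i a)
        (fun _ _ => mul_self_nonneg _) (Finset.mem_univ a)
    rw [abs_le]
    constructor <;> nlinarith
  choose c0 hc0 using hbdd
  set c : Fin r → EuclideanSpace ℝ ι := fun i => WithLp.toLp 2 (c0 i) with hc
  have hcK : ∀ i, c i ∈ K := by
    intro i
    have hcl : IsClosed (K : Set (EuclideanSpace ℝ ι)) := K.closed_of_finiteDimensional
    refine hcl.mem_of_tendsto (b := (U : Filter ℕ)) (f := fun p => WithLp.toLp 2 (cp p i)) ?_ ?_
    · exact ((PiLp.continuous_toLp 2 _).tendsto _).comp (tendsto_pi_nhds.2 fun a => hc0 i a)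
    · filter_upwards [h.mem] with p hp
      have := K.smul_mem (√(ell p i))⁻¹ (hp i)
      exact this
  have hco : Orthonormal ℝ c := by
    rw [orthonormal_iff_ite]
    intro i j
    have h1 : Tendsto (fun p => ∑ a, cp p i a * cp p j a) U (𝓝 (∑ a, c0 i a * c0 j a)) :=
      tendsto_finsetSum _ fun a _ => (hc0 i a).mul (hc0 j a)
    have h2 : Tendsto (fun p => ∑ a, cp p i a * cp p j a) U (𝓝 (if i = j then 1 else 0)) :=
      tendsto_const_nhds.congr' (by filter_upwards [horth] with p hp; exact (hp i j).symm)
    rw [← tendsto_nhds_unique h1 h2]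
    simp [hc, PiLp.inner_apply, mul_comm]
  have hlim : ∀ i j, Tendsto (fun p => if i = j then ell p i else 0) U
      (𝓝 (inner ℝ (A (c i)) (A (c j)) + τ ^ 2 * if i = j then 1 else 0)) := by
    intro i j
    have h1 : Tendsto (fun p => ∑ a, ∑ a', cp p i a * cp p j a' * inner ℝ (x p a) (x p a')) U
        (𝓝 (∑ a, ∑ a', c0 i a * c0 j a' * Q a a')) :=
      tendsto_finsetSum _ fun a _ => tendsto_finsetSum _ fun a' _ =>
        ((hc0 i a).mul (hc0 j a')).mul (hQ a a')
    have h2 := hQK (c i) (hcK i) (c j) (hcK j)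
    rw [orthonormal_iff_ite.1 hco] at h2
    rw [← h2]
    refine h1.congr' ?_
    filter_upwards [hquad] with p hp using hp i j
  set L : Fin r → ℝ := fun i => ‖A (c i)‖ ^ 2 + τ ^ 2 with hL
  have hLlim : ∀ i, Tendsto (fun p => ell p i) U (𝓝 (L i)) := by
    intro i
    have := hlim i i
    simpa [hL, real_inner_self_eq_norm_sq] using this
  refine ⟨c, L, ⟨h.tau_pos, h.finrank_eq, h.surj, hco, hcK, ?_, ?_⟩, hLlim, ?_⟩
  · intro i j
    split_ifs with hij
    · subst hij
      simp [hL]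
    · have h1 := hlim i j
      simp only [if_neg hij, mul_zero, add_zero] at h1
      exact tendsto_nhds_unique h1 tendsto_const_nhds
  · intro i j hij
    refine le_of_tendsto_of_tendsto (hLlim j) (hLlim i) ?_
    filter_upwards [h.anti] with p hp using hp hij
  · intro i a
    refine (((hLlim i).sqrt).mul (hc0 i a)).congr' ?_
    filter_upwards [h.pos] with p hp
    have : √(ell p i) ≠ 0 := (Real.sqrt_pos.2 (hp i)).ne'
    simp only [hcp]
    field_simp

omit h in
theorem sum_mul_inner_single (c : EuclideanSpace ℝ ι) (w : EuclideanSpace ℝ (Fin m)) :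
    ∑ a, c a * inner ℝ (A (EuclideanSpace.single a 1)) w = inner ℝ (A c) w := by
  have hc : c = ∑ a, c a • EuclideanSpace.single a (1 : ℝ) := by
    ext a
    simp [Finset.sum_apply, Pi.single_apply]
  conv_rhs => rw [hc, map_sum, sum_inner]
  refine Finset.sum_congr rfl fun a _ => ?_
  rw [map_smul, real_inner_smul_left]

/-- The eigenvector equation expresses `u i` as `(ell i)⁻¹ ∑ ⟪x a, u i⟫ x a`, so its inner product
with `v` is determined by those of the data. Here `w` stands for the leading coordinates of `v` as
far as the data can see them. -/
theorem tendsto_inner_eigvec {c : Fin r → EuclideanSpace ℝ ι} {L : Fin r → ℝ}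
    (hcL : IsLimitEigen τ K A c L) (hL : ∀ i, Tendsto (fun p => ell p i) U (𝓝 (L i)))
    (hc : ∀ i a, Tendsto (fun p => inner ℝ (x p a) (u p i)) U (𝓝 (√(L i) * c i a)))
    {v : ∀ p, E p} {w : EuclideanSpace ℝ (Fin m)}
    (hv : ∀ a, Tendsto (fun p => inner ℝ (x p a) (v p)) U
      (𝓝 (inner ℝ (A (EuclideanSpace.single a 1)) w))) (i : Fin r) :
    Tendsto (fun p => inner ℝ (u p i) (v p)) U (𝓝 (inner ℝ (A (c i)) w / √(L i))) := by
  have h1 : Tendsto (fun p => (ell p i)⁻¹ * ∑ a, inner ℝ (x p a) (u p i) * inner ℝ (x p a) (v p)) U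
      (𝓝 ((L i)⁻¹ * ∑ a, (√(L i) * c i a) * inner ℝ (A (EuclideanSpace.single a 1)) w)) :=
    ((hL i).inv₀ (hcL.pos i).ne').mul (tendsto_finsetSum _ fun a _ => (hc i a).mul (hv a))
  have h2 : (L i)⁻¹ * ∑ a, (√(L i) * c i a) * inner ℝ (A (EuclideanSpace.single a 1)) w =
      inner ℝ (A (c i)) w / √(L i) := by
    simp_rw [mul_assoc]
    rw [← Finset.mul_sum, sum_mul_inner_single]
    have hs : √(L i) ≠ 0 := (Real.sqrt_pos.2 (hcL.pos i)).ne'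
    conv_lhs => rw [← Real.mul_self_sqrt (hcL.pos i).le]
    rw [Real.sqrt_mul_self (Real.sqrt_nonneg _)]
    field_simp
  rw [h2] at h1
  refine h1.congr' ?_
  filter_upwards [h.eigen, h.pos] with p he hp
  have h3 := congrArg (fun y => inner ℝ y (v p)) (he i)
  simp only [sum_inner, real_inner_smul_left] at h3
  rw [h3, inv_mul_cancel_left₀ (hp i).ne']

omit h [Fintype ι] in
theorem inner_single_basis (a : ι) (j : Fin m) :
    inner ℝ (A (EuclideanSpace.single a 1)) (EuclideanSpace.single j (1 : ℝ)) =
      A (EuclideanSpace.single a 1) j := by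
  simp [EuclideanSpace.inner_single_right]

theorem tendsto_coef {c : Fin r → EuclideanSpace ℝ ι} {L : Fin r → ℝ}
    (hcL : IsLimitEigen τ K A c L) (hL : ∀ i, Tendsto (fun p => ell p i) U (𝓝 (L i)))
    (i : Fin r) :
    Tendsto (fun p => if i.val < m then α p / (ell p i + α p) else 0) U
      (𝓝 (if i.val < m then -τ ^ 2 / (L i - τ ^ 2) else 0)) := by
  split_ifs with hi
  · have hne : L i + -τ ^ 2 ≠ 0 := by
      have := hcL.lt_of_lt hi
      rw [← sub_eq_add_neg]
      exact (sub_pos.2 this).ne'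
    rw [sub_eq_add_neg]
    exact h.alpha.div ((hL i).add h.alpha) hne
  · exact tendsto_const_nhds

/-- Inner products with the ridged discriminant vector. -/
theorem tendsto_inner_ridge {v : ∀ p, E p} {w : EuclideanSpace ℝ (Fin m)} {d : ℝ}
    (hv : ∀ a, Tendsto (fun p => inner ℝ (x p a) (v p)) U
      (𝓝 (inner ℝ (A (EuclideanSpace.single a 1)) w)))
    (hd : Tendsto (fun p => inner ℝ (D p) (v p)) U (𝓝 d)) :
    Tendsto (fun p => inner ℝ (ridge (m := m) (α p) (u p) (ell p) (D p)) (v p)) U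
      (𝓝 (d - inner ℝ q w)) := by
  obtain ⟨c, L, hcL, hL, hc⟩ := h.exists_limit
  have h1 := hd.add (tendsto_finsetSum Finset.univ fun (i : Fin r) _ =>
    (((h.tendsto_coef hcL hL i).sub_const 1).mul (h.tendsto_inner_eigvec hcL hL hc h.diff i)).mul
      (h.tendsto_inner_eigvec hcL hL hc hv i))
  -- For `i < m` the factor is `-τ² / (L - τ²) - 1 = -L / (L - τ²)`. Its `L` cancels the two square
  -- roots, leaving the Parseval sum for `⟪q, w⟫` in the orthogonal basis `A (c i)`.
  have h2 : d + ∑ i : Fin r, ((if i.val < m then -τ ^ 2 / (L i - τ ^ 2) else 0) - 1) *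
      (inner ℝ (A (c i)) q / √(L i)) * (inner ℝ (A (c i)) w / √(L i)) = d - inner ℝ q w := by
    rw [← hcL.sum_inner_mul_inner q w, Finset.sum_filter, sub_eq_add_neg, ← Finset.sum_neg_distrib]
    congr 1
    refine Finset.sum_congr rfl fun i _ => ?_
    have hs := Real.mul_self_sqrt (hcL.pos i).le
    have hs0 : √(L i) ≠ 0 := (Real.sqrt_pos.2 (hcL.pos i)).ne'
    split_ifs with hi
    · have hne : L i - τ ^ 2 ≠ 0 := (sub_pos.2 (hcL.lt_of_lt hi)).ne'
      have hL0 := (hcL.pos i).ne'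
      rw [mul_assoc, div_mul_div_comm, hs]
      field_simp
      ring
    · rw [hcL.map_eq_zero_of_le (not_lt.1 hi)]
      simp
  rw [h2] at h1
  refine h1.congr fun p => ?_
  simp only [ridge, inner_add_left, sum_inner, real_inner_smul_left]

/-- For the basis vector `b j`, `D` contributes `q j` and the correction removes exactly `q j`. This
cancellation is why the ridge parameter has to tend to `-τ²`. -/
theorem tendsto_inner_ridge_basis (j : Fin m) :
    Tendsto (fun p => inner ℝ (ridge (m := m) (α p) (u p) (ell p) (D p)) (b p j)) U (𝓝 0) := by
  have := h.tendsto_inner_ridge (v := fun p => b p j) (w := EuclideanSpace.single j 1)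
    (fun a => by rw [inner_single_basis]; exact h.basis a j) (h.diff_basis j)
  simpa [EuclideanSpace.inner_single_right] using this

/-- The sum over `i < m` is rewritten as the minimal squared norm of a preimage of `q`, which
involves only `K`, `A` and `q`. So the limit does not depend on the ultrafilter, although the
limiting eigenvectors may. -/
theorem tendsto_norm_ridge_sq :
    Tendsto (fun p => ‖ridge (m := m) (α p) (u p) (ell p) (D p)‖ ^ 2) U
      (𝓝 (s + τ ^ 2 * sInf ((fun v => ‖v‖ ^ 2) '' {v | v ∈ K ∧ A v = q}))) := by
  obtain ⟨c, L, hcL, hL, hc⟩ := h.exists_limit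
  rw [(hcL.isLeast_preimage q).csInf_eq]
  have h1 := h.norm_diff.add (tendsto_finsetSum Finset.univ fun (i : Fin r) _ =>
    (((h.tendsto_coef hcL hL i).pow 2).sub_const 1).mul
      ((h.tendsto_inner_eigvec hcL hL hc h.diff i).pow 2))
  have h2 : ‖q‖ ^ 2 + s + ∑ i : Fin r, ((if i.val < m then -τ ^ 2 / (L i - τ ^ 2) else 0) ^ 2 - 1) *
      (inner ℝ (A (c i)) q / √(L i)) ^ 2 = s + τ ^ 2 *
        ∑ i with i.val < m, (inner ℝ (A (c i)) q / (L i - τ ^ 2)) ^ 2 := by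
    rw [← real_inner_self_eq_norm_sq, ← hcL.sum_inner_mul_inner q q, Finset.sum_filter,
      Finset.sum_filter, add_comm _ s, add_assoc, ← Finset.sum_add_distrib, Finset.mul_sum]
    congr 1
    refine Finset.sum_congr rfl fun i _ => ?_
    have hs := Real.sq_sqrt (hcL.pos i).le
    split_ifs with hi
    · have hne : L i - τ ^ 2 ≠ 0 := (sub_pos.2 (hcL.lt_of_lt hi)).ne'
      have hL0 := (hcL.pos i).ne'
      rw [div_pow _ (√(L i)), hs]
      field_simp
      ring
    · rw [hcL.map_eq_zero_of_le (not_lt.1 hi)]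
      simp
  rw [h2] at h1
  refine h1.congr' ?_
  filter_upwards [h.orthonormal] with p ho
  simp only [ridge]
  rw [norm_add_sq_real, inner_sum, add_assoc, ← real_inner_self_eq_norm_sq (∑ i, _),
    ho.inner_sum, Finset.mul_sum, ← Finset.sum_add_distrib]
  congr 1
  refine Finset.sum_congr rfl fun i _ => ?_
  rw [real_inner_smul_right, real_inner_comm]
  simp only [conj_trivial]
  ring

omit h [DecidableEq ι] in
theorem sInf_preimage_nonneg (K : Submodule ℝ (EuclideanSpace ℝ ι))
    (A : EuclideanSpace ℝ ι →ₗ[ℝ] EuclideanSpace ℝ (Fin m)) (q : EuclideanSpace ℝ (Fin m)) :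
    0 ≤ sInf ((fun v => ‖v‖ ^ 2) '' {v | v ∈ K ∧ A v = q}) := by
  refine Real.sInf_nonneg ?_
  rintro _ ⟨v, -, rfl⟩
  positivity

end IsSampleLimit

end DataPiling

/-! ### Approximation of second data piling directions by the piling space -/

namespace DataPiling

theorem eq_sum_inner_of_mem_span {p r : ℕ} {u : Fin r → E p} (hu : Orthonormal ℝ u) {a : E p}
    (ha : a ∈ Submodule.span ℝ (Set.range u)) : ∑ i, inner ℝ (u i) a • u i = a := by
  refine Submodule.span_induction (p := fun a _ => ∑ i, inner ℝ (u i) a • u i = a) ?_ ?_ ?_ ?_ ha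
  · rintro _ ⟨j, rfl⟩
    simp [orthonormal_iff_ite.1 hu]
  · simp
  · intro x y _ _ hx hy
    simp_rw [inner_add_right, add_smul]
    rw [Finset.sum_add_distrib, hx, hy]
  · intro t x _ hx
    simp_rw [real_inner_smul_right, mul_smul]
    rw [← Finset.smul_sum, hx]

theorem inner_sub_sum_inner {p r : ℕ} {u : Fin r → E p} (hu : Orthonormal ℝ u) (a : E p)
    (i : Fin r) : inner ℝ (u i) (a - ∑ i, inner ℝ (u i) a • u i) = 0 := by
  rw [inner_sub_right, hu.inner_right_fintype, sub_self]

/-- One Gram–Schmidt step: the residual of `D` completes `u` to an orthogonal basis of the space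
containing `w`. -/
theorem eq_sum_add_smul_of_mem {p r : ℕ} {u : Fin r → E p} (hu : Orthonormal ℝ u) {D w : E p}
    (hw : w ∈ Submodule.span ℝ (Set.range u) ⊔ Submodule.span ℝ {D})
    (hf : D - ∑ i, inner ℝ (u i) D • u i ≠ 0) :
    w = ∑ i, inner ℝ (u i) w • u i +
      (inner ℝ (D - ∑ i, inner ℝ (u i) D • u i) w / ‖D - ∑ i, inner ℝ (u i) D • u i‖ ^ 2) •
        (D - ∑ i, inner ℝ (u i) D • u i) := by
  set f := D - ∑ i, inner ℝ (u i) D • u i with hfdef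
  obtain ⟨a, ha, y, hy, rfl⟩ := Submodule.mem_sup.1 hw
  obtain ⟨t, rfl⟩ := Submodule.mem_span_singleton.1 hy
  have ha' := eq_sum_inner_of_mem_span hu ha
  have h1 : a + t • D = ∑ i, inner ℝ (u i) (a + t • D) • u i + t • f := by
    simp_rw [inner_add_right, real_inner_smul_right, add_smul, mul_smul]
    rw [Finset.sum_add_distrib, ha', ← Finset.smul_sum, hfdef, smul_sub]
    abel
  have horth : ∀ i, inner ℝ f (u i) = 0 := fun i => by
    rw [real_inner_comm, hfdef, inner_sub_sum_inner hu]
  have h2 : inner ℝ f (a + t • D) = t * ‖f‖ ^ 2 := by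
    rw [h1, inner_add_right, inner_sum, real_inner_smul_right, real_inner_self_eq_norm_sq]
    simp [real_inner_smul_right, horth]
  rw [h2, mul_div_cancel_right₀ _ (by simpa using hf)]
  exact h1

/-- Projection onto the span of a vector has the smallest distance. -/
theorem norm_sub_inner_smul_le {p : ℕ} {w v : E p} (hv : ‖v‖ = 1) (t : ℝ) :
    ‖w - inner ℝ v w • v‖ ≤ ‖w - t • v‖ := by
  have h1 : w - t • v = (w - inner ℝ v w • v) + (inner ℝ v w - t) • v := by
    rw [sub_smul]; abel
  have h2 : inner ℝ (w - inner ℝ v w • v) ((inner ℝ v w - t) • v) = 0 := by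
    rw [real_inner_smul_right, inner_sub_left, real_inner_smul_left, real_inner_self_eq_norm_sq, hv,
      real_inner_comm]
    ring
  have h3 : ‖w - t • v‖ ^ 2 = ‖w - inner ℝ v w • v‖ ^ 2 + ‖(inner ℝ v w - t) • v‖ ^ 2 := by
    rw [h1, norm_add_sq_real, h2]; ring
  exact abs_le_of_sq_le_sq' (by nlinarith [sq_nonneg ‖(inner ℝ v w - t) • v‖]) (norm_nonneg _) |>.2

namespace IsSampleLimit

variable {ι : Type*} [Fintype ι] [DecidableEq ι] {m r : ℕ} {U : Ultrafilter ℕ}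
    {τ s : ℝ} {K : Submodule ℝ (EuclideanSpace ℝ ι)}
    {A : EuclideanSpace ℝ ι →ₗ[ℝ] EuclideanSpace ℝ (Fin m)} {q : EuclideanSpace ℝ (Fin m)}
    {x : ∀ p, ι → E p} {D : ∀ p, E p} {b : ∀ p, Fin m → E p} {α : ℕ → ℝ}
    {u : ∀ p, Fin r → E p} {ell : ℕ → Fin r → ℝ}
    (h : IsSampleLimit U τ s K A q x D b α u ell)

include h

theorem tendsto_eigval_of_le {i : Fin r} (hi : m ≤ (i : ℕ)) :
    Tendsto (fun p => ell p i) U (𝓝 (τ ^ 2)) := by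
  obtain ⟨c, L, hcL, hL, hc⟩ := h.exists_limit
  rw [← hcL.eq_of_le hi]
  exact hL i

theorem tendsto_inner_eigvec_of_le {i : Fin r} (hi : m ≤ (i : ℕ))
    {v : ∀ p, E p} {w : EuclideanSpace ℝ (Fin m)}
    (hv : ∀ a, Tendsto (fun p => inner ℝ (x p a) (v p)) U
      (𝓝 (inner ℝ (A (EuclideanSpace.single a 1)) w))) :
    Tendsto (fun p => inner ℝ (u p i) (v p)) U (𝓝 0) := by
  obtain ⟨c, L, hcL, hL, hc⟩ := h.exists_limit
  have := h.tendsto_inner_eigvec hcL hL hc hv i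
  rwa [hcL.map_eq_zero_of_le hi, inner_zero_left, zero_div] at this

theorem norm_ridge_limit_pos :
    0 < s + τ ^ 2 * sInf ((fun v => ‖v‖ ^ 2) '' {v | v ∈ K ∧ A v = q}) := by
  have := sInf_preimage_nonneg K A q
  have := h.s_pos
  positivity

theorem tendsto_norm_ridge :
    Tendsto (fun p => ‖ridge (m := m) (α p) (u p) (ell p) (D p)‖) U
      (𝓝 √(s + τ ^ 2 * sInf ((fun v => ‖v‖ ^ 2) '' {v | v ∈ K ∧ A v = q}))) := by
  refine h.tendsto_norm_ridge_sq.sqrt.congr fun p => ?_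
  rw [Real.sqrt_sq (norm_nonneg _)]

theorem eventually_ridge_ne_zero :
    ∀ᶠ p in U, ridge (m := m) (α p) (u p) (ell p) (D p) ≠ 0 := by
  filter_upwards [h.tendsto_norm_ridge.eventually
    (lt_mem_nhds (Real.sqrt_pos.2 h.norm_ridge_limit_pos))] with p hp
  exact norm_pos_iff.1 hp

/-- The limit of `‖D - ∑ ⟪u i, D⟫ u i‖` is positive. -/
theorem eventually_sub_sum_norm_sq : ∀ᶠ p in U,
    s / 2 < ‖D p - ∑ i, inner ℝ (u p i) (D p) • u p i‖ ^ 2 := by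
  obtain ⟨c, L, hcL, hL, hc⟩ := h.exists_limit
  have h1 := h.norm_diff.sub (tendsto_finsetSum Finset.univ fun (i : Fin r) _ =>
      (h.tendsto_inner_eigvec hcL hL hc h.diff i).pow 2)
  have h2 : s ≤ ‖q‖ ^ 2 + s - ∑ i : Fin r, (inner ℝ (A (c i)) q / √(L i)) ^ 2 := by
    -- The sample eigenvectors give weights `1 / L i`, smaller than the Parseval weights `1 / (L i -
    -- τ²)` of `‖q‖²`.
    have h3 : ∑ i : Fin r, (inner ℝ (A (c i)) q / √(L i)) ^ 2 ≤ ‖q‖ ^ 2 := by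
      rw [← real_inner_self_eq_norm_sq, ← hcL.sum_inner_mul_inner q q, Finset.sum_filter]
      refine Finset.sum_le_sum fun i _ => ?_
      rw [div_pow, Real.sq_sqrt (hcL.pos i).le, ← pow_two]
      split_ifs with hi
      · have hlt := hcL.lt_of_lt hi
        have : 0 < L i - τ ^ 2 := sub_pos.2 hlt
        refine div_le_div_of_nonneg_left (sq_nonneg _) this ?_
        nlinarith [sq_nonneg τ]
      · rw [hcL.map_eq_zero_of_le (not_lt.1 hi)]
        simp
    linarith
  have hs := h.s_pos
  have h4 := h1.eventually (lt_mem_nhds (show s / 2 < _ by linarith))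
  filter_upwards [h4, h.orthonormal] with p hp ho
  refine hp.trans_le (le_of_eq ?_)
  rw [norm_sub_sq_real, inner_sum, ← real_inner_self_eq_norm_sq (∑ i, _), ho.inner_sum]
  simp_rw [real_inner_smul_right, real_inner_comm (u p _) (D p), conj_trivial, ← pow_two]
  ring

/-- A unit vector of the sample space that is asymptotically orthogonal to the leading space is
asymptotically in the span of the ridged discriminant direction and the tail eigenvectors. -/
theorem tendsto_residual {w : ∀ p, E p}
    (hw : ∀ᶠ p in U, w p ∈ Submodule.span ℝ (Set.range (u p)) ⊔ Submodule.span ℝ {D p})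
    (hw1 : ∀ᶠ p in U, ‖w p‖ = 1)
    (hwb : ∀ j, Tendsto (fun p => inner ℝ (w p) (b p j)) U (𝓝 0))
    {v : ∀ p, E p} (hv : ∀ᶠ p in U, v p = ‖ridge (m := m) (α p) (u p) (ell p) (D p)‖⁻¹ •
      ridge (m := m) (α p) (u p) (ell p) (D p)) :
    Tendsto (fun p => ‖w p - (inner ℝ (v p) (w p) • v p +
      ∑ i with m ≤ i.val, inner ℝ (u p i) (w p) • u p i)‖) U (𝓝 0) := by
  obtain ⟨c, L, hcL, hL, hc⟩ := h.exists_limit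
  set f : ∀ p, E p := fun p => D p - ∑ i, inner ℝ (u p i) (D p) • u p i with hf
  set θ : ℕ → ℝ := fun p => inner ℝ (f p) (w p) / ‖f p‖ ^ 2 with hθ
  have hs := h.s_pos
  have hf0 : ∀ᶠ p in U, f p ≠ 0 := by
    filter_upwards [h.eventually_sub_sum_norm_sq] with p hp hp0
    rw [show D p - ∑ i, inner ℝ (u p i) (D p) • u p i = f p from rfl, hp0] at hp
    norm_num at hp
    linarith
  have hdec : ∀ᶠ p in U, w p = ∑ i, inner ℝ (u p i) (w p) • u p i + θ p • f p := by
    filter_upwards [hw, h.orthonormal, hf0] with p hwp ho hfp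
    exact eq_sum_add_smul_of_mem ho hwp hfp
  have hωb : ∀ i, ∃ y, Tendsto (fun p => inner ℝ (u p i) (w p)) U (𝓝 y) := fun i => by
    refine exists_tendsto_of_abs_le U (C := 1) ?_
    filter_upwards [hw1, h.orthonormal] with p hp ho
    have := abs_real_inner_le_norm (u p i) (w p)
    rwa [ho.1 i, hp, one_mul] at this
  choose ω hω using hωb
  obtain ⟨t, ht⟩ : ∃ t, Tendsto θ U (𝓝 t) := by
    -- By Cauchy–Schwarz `|θ| ≤ 1 / ‖f‖ ≤ 1 + 1 / ‖f‖²`, and `‖f‖² > s / 2`.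
    refine exists_tendsto_of_abs_le U (C := 1 + 2 / s) ?_
    filter_upwards [hw1, h.eventually_sub_sum_norm_sq] with p hp hfp
    change s / 2 < ‖f p‖ ^ 2 at hfp
    have h0 : 0 < ‖f p‖ ^ 2 := by linarith [half_pos hs]
    have h1 := abs_real_inner_le_norm (f p) (w p)
    rw [hp, mul_one] at h1
    rw [hθ]
    simp only
    rw [abs_div, abs_of_pos h0, div_le_iff₀ h0]
    have h2 : 1 ≤ 2 / s * ‖f p‖ ^ 2 := by
      rw [div_mul_eq_mul_div, le_div_iff₀ hs]; linarith
    nlinarith [sq_nonneg (‖f p‖ - 1)]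
  set B : Fin r → ℝ := fun i => if i.val < m then -τ ^ 2 / (L i - τ ^ 2) else 0 with hB
  have hlimeq : ∀ i, i.val < m → ω i - t * (B i * (inner ℝ (A (c i)) q / √(L i))) = 0 := by
    -- This is the limit of `⟪w, b j⟫ = 0` for all `j`, written as one equation in `ℝ^m`.
    have hvec : ∑ i, (ω i / √(L i)) • A (c i) +
        t • (q - ∑ i, (inner ℝ (A (c i)) q / L i) • A (c i)) = 0 := by
      ext j
      have hub : ∀ i, Tendsto (fun p => inner ℝ (u p i) (b p j)) U (𝓝 (A (c i) j / √(L i))) := by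
        intro i
        have := h.tendsto_inner_eigvec hcL hL hc (v := fun p => b p j)
          (w := EuclideanSpace.single j 1)
          (fun a => by rw [inner_single_basis]; exact h.basis a j) i
        simpa [EuclideanSpace.inner_single_right] using this
      have h1 := (tendsto_finsetSum Finset.univ fun (i : Fin r) _ => (hω i).mul (hub i)).add
        (ht.mul ((h.diff_basis j).sub (tendsto_finsetSum Finset.univ fun (i : Fin r) _ =>
          (h.tendsto_inner_eigvec hcL hL hc h.diff i).mul (hub i))))
      have h2 := tendsto_nhds_unique (h1.congr' (by
        filter_upwards [hdec] with p hp
        conv_rhs => rw [hp]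
        simp only [hf, inner_add_left, sum_inner, real_inner_smul_left, inner_sub_left])) (hwb j)
      rw [PiLp.add_apply, PiLp.smul_apply, PiLp.sub_apply]
      simp only [WithLp.ofLp_sum, Finset.sum_apply, PiLp.smul_apply, smul_eq_mul, PiLp.zero_apply]
      rw [← h2]
      congr 2
      · ext i; ring
      · congr 1
        refine Finset.sum_congr rfl fun i _ => ?_
        rw [div_mul_div_comm, Real.mul_self_sqrt (hcL.pos i).le]
        ring
    intro k hk
    -- Pairing with `A (c k)` isolates the coefficient of `u k`, because the `A (c i)` are
    -- orthogonal. The solution is `t` times the coefficient of `u k` in the limiting ridge vector,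
    -- so `w` minus `θ` times the ridge vector has only tail components in the limit.
    have h3 := congrArg (fun y => inner ℝ (A (c k)) y) hvec
    simp only [inner_add_right, inner_sum, real_inner_smul_right, inner_sub_right, hcL.inner_map,
      inner_zero_right, mul_ite, mul_zero, Finset.sum_ite_eq, Finset.mem_univ, if_true] at h3
    have hLk := hcL.pos k
    have hsq := Real.sq_sqrt hLk.le
    have hsp : 0 < √(L k) := Real.sqrt_pos.2 hLk
    have hne : L k - τ ^ 2 ≠ 0 := (sub_pos.2 (hcL.lt_of_lt hk)).ne'
    simp only [hB, if_pos hk]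
    generalize √(L k) = y at *
    rw [← hsq] at h3 hne ⊢
    field_simp at h3 ⊢
    linear_combination h3
  set R : ∀ p, E p := fun p => w p - θ p • ridge (m := m) (α p) (u p) (ell p) (D p) -
    ∑ i with m ≤ i.val, inner ℝ (u p i) (w p) • u p i with hR
  have hRlim : Tendsto (fun p => ‖R p‖ ^ 2) U (𝓝 0) := by
    have h1 := tendsto_finsetSum (Finset.univ.filter fun i : Fin r => i.val < m) fun i _ =>
      ((hω i).sub (ht.mul ((h.tendsto_coef hcL hL i).mul
        (h.tendsto_inner_eigvec hcL hL hc h.diff i)))).pow 2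
    have h2 : ∑ i : Fin r with i.val < m,
        (ω i - t * (B i * (inner ℝ (A (c i)) q / √(L i)))) ^ 2 = 0 := by
      refine Finset.sum_eq_zero fun i hi => ?_
      rw [hlimeq i (by simpa using hi)]
      norm_num
    rw [h2] at h1
    refine h1.congr' ?_
    filter_upwards [hdec, h.orthonormal] with p hp ho
    have hRp : R p = ∑ i with i.val < m, (inner ℝ (u p i) (w p) - θ p *
        ((if i.val < m then α p / (ell p i + α p) else 0) * inner ℝ (u p i) (D p))) • u p i := by
      have hr : ridge (m := m) (α p) (u p) (ell p) (D p) = f p + ∑ i with i.val < m,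
          ((if i.val < m then α p / (ell p i + α p) else 0) * inner ℝ (u p i) (D p)) • u p i := by
        rw [ridge, hf]
        simp only
        rw [sub_add, sub_eq_add_neg, Finset.sum_filter, ← Finset.sum_sub_distrib,
          ← Finset.sum_neg_distrib]
        congr 1
        refine Finset.sum_congr rfl fun i _ => ?_
        split_ifs
        · rw [← sub_smul, ← neg_smul]; congr 1; ring
        · rw [sub_zero, ← neg_smul]; congr 1; ring
      rw [hR]
      simp only
      conv_lhs => lhs; lhs; rw [hp]
      rw [hr, ← Finset.sum_filter_add_sum_filter_not Finset.univ (fun i : Fin r => i.val < m)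
        (fun i => inner ℝ (u p i) (w p) • u p i)]
      simp only [not_lt, sub_smul, Finset.sum_sub_distrib, smul_add, Finset.smul_sum, smul_smul]
      abel
    rw [hRp, ← real_inner_self_eq_norm_sq, ho.inner_sum]
    exact Finset.sum_congr rfl fun i _ => by simp [pow_two]
  have hRn : Tendsto (fun p => ‖R p‖) U (𝓝 0) := by
    have := hRlim.sqrt
    rw [Real.sqrt_zero] at this
    exact this.congr fun p => Real.sqrt_sq (norm_nonneg _)
  refine squeeze_zero' (.of_forall fun p => norm_nonneg _) ?_ hRn
  filter_upwards [hv, h.eventually_ridge_ne_zero, h.orthonormal] with p hvp hrp ho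
  have hv1 : ‖v p‖ = 1 := by
    rw [hvp, norm_smul, norm_inv, norm_norm, inv_mul_cancel₀ (norm_ne_zero_iff.2 hrp)]
  -- For `i ≥ m` the ridge vector has the factor `-1`, which removes the component of `D` along `u
  -- i` exactly.
  have hvu : ∀ i : Fin r, m ≤ i.val → inner ℝ (v p) (u p i) = 0 := by
    intro i hi
    rw [hvp, real_inner_smul_left, ridge, inner_add_left, ho.inner_left_fintype,
      if_neg (not_lt.2 hi), conj_trivial, real_inner_comm]
    ring
  set T := ∑ i with m ≤ i.val, inner ℝ (u p i) (w p) • u p i with hT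
  have hvT : inner ℝ (v p) T = 0 := by
    rw [hT, inner_sum]
    refine Finset.sum_eq_zero fun i hi => ?_
    rw [real_inner_smul_right, hvu i (by simpa using hi), mul_zero]
  -- The multiple `θ` of the ridge vector is only a competitor. The orthogonal projection onto `v`
  -- is at least as close and has an explicit, measurable coefficient.
  have h5 := norm_sub_inner_smul_le (w := w p - T) hv1
    (θ p * ‖ridge (m := m) (α p) (u p) (ell p) (D p)‖)
  rw [inner_sub_right, hvT, sub_zero] at h5
  have h6 : (θ p * ‖ridge (m := m) (α p) (u p) (ell p) (D p)‖) • v p =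
      θ p • ridge (m := m) (α p) (u p) (ell p) (D p) := by
    rw [hvp, smul_smul, mul_assoc, mul_inv_cancel₀ (norm_ne_zero_iff.2 hrp), mul_one]
  rw [h6] at h5
  calc ‖w p - (inner ℝ (v p) (w p) • v p + T)‖ = ‖w p - T - inner ℝ (v p) (w p) • v p‖ := by
        congr 1; abel
    _ ≤ ‖w p - T - θ p • ridge (m := m) (α p) (u p) (ell p) (D p)‖ := h5
    _ = ‖R p‖ := by rw [hR]; congr 1; simp only [hT]; abel

end IsSampleLimit

end DataPiling

namespace DataPiling

/-! ### The eigen-decomposition of the within-class scatter matrix in a fixed dimension -/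

/-- The first `r` entries of a finite sequence (extended by zero). -/
def head {V : Type*} [Zero V] {p : ℕ} (r : ℕ) (u : Fin p → V) (i : Fin r) : V :=
  if h : (i : ℕ) < p then u ⟨i, h⟩ else 0

theorem head_apply {V : Type*} [Zero V] {p r : ℕ} (hr : r ≤ p) (u : Fin p → V) (i : Fin r) :
    head r u i = u (Fin.castLE hr i) := by
  rw [head, dif_pos (lt_of_lt_of_le i.2 hr)]
  rfl

theorem sum_filter_lt_eq_sum_head {V : Type*} [AddCommMonoid V] {p r : ℕ} (hr : r ≤ p)
    (G : Fin p → V) : ∑ i with i.val < r, G i = ∑ i : Fin r, G (Fin.castLE hr i) := by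
  symm
  refine Finset.sum_bij' (fun i _ => Fin.castLE hr i)
    (fun i hi => (⟨i, by simpa using hi⟩ : Fin r)) ?_ ?_ ?_ ?_ ?_
  · intro i _; simp
  · intro i _; simp
  · intro i _; rfl
  · intro i _; rfl
  · intro i _; rfl

namespace TwoClassModel

/-- Labels of the training observations. -/
abbrev TrainIndex (M : TwoClassModel) : Type := Σ k : Fin 2, Fin (M.n k)

variable (M : TwoClassModel)

/-- The class-wise sums of a coefficient vector. -/
def classSum : EuclideanSpace ℝ M.TrainIndex →ₗ[ℝ] (Fin 2 → ℝ) where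
  toFun c k := ∑ j, c ⟨k, j⟩
  map_add' c c' := by ext k; simp [Finset.sum_add_distrib]
  map_smul' t c := by ext k; simp [Finset.mul_sum]

/-- The coefficient vectors that are centred in each class. -/
def centred : Submodule ℝ (EuclideanSpace ℝ M.TrainIndex) := LinearMap.ker M.classSum

variable {M}

theorem mem_centred {c : EuclideanSpace ℝ M.TrainIndex} :
    c ∈ M.centred ↔ ∀ k, ∑ j, c ⟨k, j⟩ = 0 := by
  rw [centred, LinearMap.mem_ker, funext_iff]
  rfl

theorem card_trainIndex : Fintype.card M.TrainIndex = M.N := by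
  simp [TrainIndex, N, Fintype.card_sigma]

theorem finrank_centred (hn : ∀ k, 0 < M.n k) : Module.finrank ℝ M.centred = M.N - 2 := by
  have hsurj : LinearMap.range M.classSum = ⊤ := by
    rw [LinearMap.range_eq_top]
    intro y
    refine ⟨WithLp.toLp 2 fun a => if a.2.val = 0 then y a.1 else 0, ?_⟩
    ext k
    change ∑ j : Fin (M.n k), (if j.val = 0 then y k else 0) = y k
    rw [Finset.sum_eq_single ⟨0, hn k⟩]
    · simp
    · intro j _ hj
      rw [if_neg]
      exact fun h => hj (Fin.ext h)
    · simp
  have := LinearMap.finrank_range_add_finrank_ker M.classSum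
  rw [hsurj, finrank_top, finrank_euclideanSpace, card_trainIndex] at this
  simp only [Module.finrank_fintype_fun_eq_card, Fintype.card_fin] at this
  change 2 + Module.finrank ℝ M.centred = M.N at this
  omega

end TwoClassModel

variable {M : TwoClassModel} {p : ℕ}

/-- The training observations centred at their class means. -/
def centredObs (x : M.Sample p) (a : M.TrainIndex) : E p := x a.1 a.2 - classMean x a.1

theorem withinScatter_eq (x : M.Sample p) (v : E p) :
    withinScatter x v = ∑ a, inner ℝ (centredObs x a) v • centredObs x a := by
  rw [withinScatter, Fintype.sum_sigma]
  rfl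

theorem sum_centredObs (hn : ∀ k, 0 < M.n k) (x : M.Sample p) (k : Fin 2) :
    ∑ j, centredObs x ⟨k, j⟩ = 0 := by
  have hk : (M.n k : ℝ) ≠ 0 := by exact_mod_cast (hn k).ne'
  change ∑ j, (x k j - classMean x k) = 0
  rw [Finset.sum_sub_distrib, Finset.sum_const, Finset.card_univ, Fintype.card_fin, classMean,
    ← Nat.cast_smul_eq_nsmul ℝ, smul_smul, mul_inv_cancel₀ hk, one_smul, sub_self]

theorem inner_centredObs_mem (hn : ∀ k, 0 < M.n k) (x : M.Sample p) (v : E p) :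
    WithLp.toLp 2 (fun a => inner ℝ (centredObs x a) v) ∈ M.centred := by
  rw [TwoClassModel.mem_centred]
  intro k
  change ∑ j, inner ℝ (centredObs x ⟨k, j⟩) v = 0
  rw [← sum_inner, sum_centredObs hn, inner_zero_left]

theorem sum_smul_centredObs {c : EuclideanSpace ℝ M.TrainIndex} (hc : c ∈ M.centred)
    (x : M.Sample p) : ∑ a, c a • centredObs x a = ∑ a, c a • x a.1 a.2 := by
  rw [TwoClassModel.mem_centred] at hc
  simp only [centredObs, smul_sub, Finset.sum_sub_distrib]
  rw [sub_eq_self, Fintype.sum_sigma]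
  refine Finset.sum_eq_zero fun k _ => ?_
  simp only
  rw [← Finset.sum_smul, hc k, zero_smul]

/-- The observations are in general position. -/
abbrev IsGeneric (x : M.Sample p) : Prop :=
  AffineIndependent ℝ fun a : M.TrainIndex => x a.1 a.2

theorem IsGeneric.eq_zero {x : M.Sample p} (hx : IsGeneric x) {c : M.TrainIndex → ℝ}
    (hsum : ∑ a, c a = 0) (h0 : ∑ a, c a • x a.1 a.2 = 0) : c = 0 := by
  ext a
  refine hx Finset.univ c hsum ?_ a (Finset.mem_univ a)
  rwa [Finset.weightedVSub_eq_linear_combination _ hsum]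

/-- The span of the centred observations. -/
def withinSpace (x : M.Sample p) : Submodule ℝ (E p) :=
  Submodule.span ℝ (Set.range (centredObs x))

/-- Linear combinations of the centred observations. -/
def combination (x : M.Sample p) : EuclideanSpace ℝ M.TrainIndex →ₗ[ℝ] E p where
  toFun c := ∑ a, c a • centredObs x a
  map_add' c c' := by simp [add_smul, Finset.sum_add_distrib]
  map_smul' t c := by simp [Finset.smul_sum, smul_smul]

/-- The centred observations sum to zero in each class, so centred coefficients already give every
combination. Dimensions can then be counted in `M.centred`. -/
theorem map_combination_centred (hn : ∀ k, 0 < M.n k) (x : M.Sample p) :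
    M.centred.map (combination x) = withinSpace x := by
  apply le_antisymm
  · rintro _ ⟨c, -, rfl⟩
    have hmem : ∀ a, centredObs x a ∈ withinSpace x := fun a => Submodule.subset_span ⟨a, rfl⟩
    change ∑ a, c a • centredObs x a ∈ withinSpace x
    exact Submodule.sum_mem _ fun a _ => Submodule.smul_mem _ (c a) (hmem a)
  · rw [withinSpace, Submodule.span_le]
    rintro _ ⟨⟨k, j⟩, rfl⟩
    -- The indicator of the observation `(k, j)`, centred within class `k`.
    refine ⟨WithLp.toLp 2 fun a => if a.1 = k then
      (if (a.2 : ℕ) = j then 1 else 0) - (M.n k : ℝ)⁻¹ else 0, ?_, ?_⟩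
    · rw [SetLike.mem_coe, TwoClassModel.mem_centred]
      intro k'
      change ∑ j' : Fin (M.n k'), (if k' = k then
        (if (j' : ℕ) = j then 1 else 0) - (M.n k : ℝ)⁻¹ else 0) = 0
      split_ifs with hk
      · subst hk
        have hk : (M.n k' : ℝ) ≠ 0 := by exact_mod_cast (hn k').ne'
        simp only [Fin.val_inj, Finset.sum_sub_distrib, Finset.sum_ite_eq', Finset.mem_univ,
          if_true, Finset.sum_const, Finset.card_univ, Fintype.card_fin, nsmul_eq_mul]
        rw [mul_inv_cancel₀ hk, sub_self]
      · simp
    · change ∑ a : M.TrainIndex, (if a.1 = k then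
        (if (a.2 : ℕ) = j then 1 else 0) - (M.n k : ℝ)⁻¹ else 0) • centredObs x a = _
      rw [Fintype.sum_sigma, Finset.sum_eq_single k]
      · simp only [if_true, sub_smul, Finset.sum_sub_distrib]
        rw [← Finset.smul_sum, sum_centredObs hn, smul_zero, sub_zero]
        simp [Fin.val_inj]
      · intro k' _ hk
        simp [hk]
      · simp

/-- Centred coefficients have total sum zero, so affine independence of the observations makes the
combination map injective on them. -/
theorem IsGeneric.finrank_withinSpace (hn : ∀ k, 0 < M.n k) {x : M.Sample p} (hx : IsGeneric x) :
    Module.finrank ℝ (withinSpace x) = M.N - 2 := by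
  rw [← map_combination_centred hn, ← TwoClassModel.finrank_centred hn]
  have hinj : Function.Injective ((combination x).domRestrict M.centred) := by
    rw [← LinearMap.ker_eq_bot, LinearMap.ker_eq_bot']
    rintro ⟨c, hc⟩ h0
    have h1 : ∑ a, c a • centredObs x a = 0 := h0
    rw [sum_smul_centredObs hc] at h1
    have hsum : ∑ a, c a = 0 := by
      rw [Fintype.sum_sigma]
      exact Finset.sum_eq_zero fun k _ => (TwoClassModel.mem_centred.1 hc) k
    have := hx.eq_zero hsum h1
    ext a
    exact congrFun this a
  rw [← LinearMap.finrank_range_of_inj hinj, LinearMap.range_domRestrict]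

/-- The mean difference is not in the span of the centred observations. -/
theorem IsGeneric.meanDiff_notMem (hn : ∀ k, 0 < M.n k) {x : M.Sample p} (hx : IsGeneric x) :
    meanDiff x ∉ withinSpace x := by
  rw [← map_combination_centred hn]
  rintro ⟨c, hc, h⟩
  have h1 : ∑ a, c a • centredObs x a = meanDiff x := h
  rw [sum_smul_centredObs hc] at h1
  set e : Fin 2 → ℝ := fun k => if k = 0 then (M.n 0 : ℝ)⁻¹ else -(M.n 1 : ℝ)⁻¹ with he
  have hd : meanDiff x = ∑ a : M.TrainIndex, e a.1 • x a.1 a.2 := by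
    rw [Fintype.sum_sigma, Fin.sum_univ_two]
    simp only [he, meanDiff, classMean, if_true, one_ne_zero, if_false]
    rw [← Finset.smul_sum, ← Finset.smul_sum, neg_smul, sub_eq_add_neg]
  have hcs := TwoClassModel.mem_centred.1 hc
  have hne : ∀ k, (M.n k : ℝ) ≠ 0 := fun k => by exact_mod_cast (hn k).ne'
  have hes : ∑ j : Fin (M.n 0), e 0 = 1 := by simp [he, hne 0]
  have hes1 : ∑ j : Fin (M.n 1), e 1 = -1 := by simp [he, hne 1]
  -- The difference of two representations of `meanDiff x` has total coefficient `0 - (1 - 1) = 0`,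
  -- so affine independence makes it vanish. But its sum over the first class is `0 - 1`.
  have h0 := hx.eq_zero (c := fun a => c a - e a.1) (by
    rw [Fintype.sum_sigma, Fin.sum_univ_two]
    simp only [Finset.sum_sub_distrib]
    rw [hcs 0, hcs 1, hes, hes1]
    norm_num) (by
    simp only [sub_smul, Finset.sum_sub_distrib]
    rw [h1, hd, sub_self])
  have h2 : ∑ j : Fin (M.n 0), (c ⟨0, j⟩ - e 0) = 0 :=
    Finset.sum_eq_zero fun j _ => congrFun h0 ⟨0, j⟩
  rw [Finset.sum_sub_distrib, hcs 0, hes] at h2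
  norm_num at h2

namespace IsEigenDecomp

variable {x : M.Sample p} {u : Fin p → E p} {lam : Fin p → ℝ} (h : IsEigenDecomp x u lam)

include h

theorem lam_eq (i : Fin p) : lam i = ∑ a, inner ℝ (centredObs x a) (u i) ^ 2 := by
  have h1 := congrArg (fun v => inner ℝ v (u i)) (h.eigen i)
  simp only [withinScatter_eq, sum_inner, real_inner_smul_left, real_inner_self_eq_norm_sq,
    h.orthonormal.1 i] at h1
  rw [one_pow, mul_one] at h1
  rw [← h1]
  exact Finset.sum_congr rfl fun a _ => (pow_two _).symm

theorem lam_nonneg (i : Fin p) : 0 ≤ lam i := by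
  rw [h.lam_eq]
  exact Finset.sum_nonneg fun a _ => sq_nonneg _

theorem mem_withinSpace {i : Fin p} (hi : lam i ≠ 0) : u i ∈ withinSpace x := by
  have h1 : u i = (lam i)⁻¹ • withinScatter x (u i) := by
    rw [h.eigen, smul_smul, inv_mul_cancel₀ hi, one_smul]
  rw [h1, withinScatter_eq]
  exact Submodule.smul_mem _ _ <| Submodule.sum_mem _ fun a _ =>
    Submodule.smul_mem _ _ (Submodule.subset_span ⟨a, rfl⟩)

theorem mem_orthogonal {i : Fin p} (hi : lam i = 0) : u i ∈ (withinSpace x)ᗮ := by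
  rw [withinSpace, Submodule.mem_orthogonal]
  intro v hv
  rw [h.lam_eq, Finset.sum_eq_zero_iff_of_nonneg fun a _ => sq_nonneg _] at hi
  refine Submodule.span_induction (p := fun v _ => inner ℝ v (u i) = 0) ?_ ?_ ?_ ?_ hv
  · rintro _ ⟨a, rfl⟩
    simpa using hi a (Finset.mem_univ a)
  · simp
  · intro a b _ _ ha hb
    rw [inner_add_left, ha, hb, add_zero]
  · intro t a _ ha
    rw [real_inner_smul_left, ha, mul_zero]

omit h in
theorem card_le_finrank {u : Fin p → E p} (hu : Orthonormal ℝ u) (s : Finset (Fin p))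
    {S : Submodule ℝ (E p)} (hs : ∀ i ∈ s, u i ∈ S) : s.card ≤ Module.finrank ℝ S := by
  have h1 : LinearIndependent ℝ fun i : s => (⟨u i, hs i i.2⟩ : S) := by
    refine LinearIndependent.of_comp S.subtype ?_
    exact hu.linearIndependent.comp (fun i : s => (i : Fin p)) Subtype.val_injective
  simpa using h1.fintype_card_le_finrank

/-- Eigenvectors with nonzero eigenvalue lie in the span of the centred observations, of dimension
`N - 2`; those with eigenvalue zero lie in its orthogonal complement. Since there are `p` in all,
both dimension bounds are attained, and descending order puts the nonzero eigenvalues first. -/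
theorem lam_ne_zero_iff (hn : ∀ k, 0 < M.n k) (hx : IsGeneric x) (i : Fin p) :
    lam i ≠ 0 ↔ (i : ℕ) < M.N - 2 := by
  set s := Finset.univ.filter fun i => lam i ≠ 0 with hs
  have h1 : s.card ≤ M.N - 2 := by
    rw [← hx.finrank_withinSpace hn]
    exact card_le_finrank h.orthonormal s fun i hi => h.mem_withinSpace (by simpa [hs] using hi)
  have h2 : (Finset.univ.filter fun i => ¬ lam i ≠ 0).card ≤
      Module.finrank ℝ (withinSpace x)ᗮ :=
    card_le_finrank h.orthonormal _ fun i hi => h.mem_orthogonal (by simpa using hi)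
  have h3 := Submodule.finrank_add_finrank_orthogonal (withinSpace x)
  have h4 : s.card + _ = _ := Finset.card_filter_add_card_filter_not (s := (Finset.univ : Finset (Fin p)))
    fun i => lam i ≠ 0
  rw [hx.finrank_withinSpace hn, finrank_euclideanSpace_fin] at h3
  rw [Finset.card_univ, Fintype.card_fin] at h4
  have h5 : s.card = M.N - 2 := by omega
  have hlow := mem_iff_lt_card_of_lower (s := s) (by
    intro i hi j hji
    simp only [hs, Finset.mem_filter, Finset.mem_univ, true_and] at hi ⊢
    have h6 := h.descending hji
    have h7 := lt_of_le_of_ne (h.lam_nonneg i) (Ne.symm hi)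
    exact (h7.trans_le h6).ne') i
  rw [h5] at hlow
  simpa [hs] using hlow

theorem lam_pos (hn : ∀ k, 0 < M.n k) (hx : IsGeneric x) {i : Fin p} (hi : (i : ℕ) < M.N - 2) :
    0 < lam i :=
  lt_of_le_of_ne (h.lam_nonneg i) (Ne.symm ((h.lam_ne_zero_iff hn hx i).2 hi))

theorem orthonormal_head {r : ℕ} (hr : r ≤ p) : Orthonormal ℝ (head r u) := by
  have := h.orthonormal.comp (Fin.castLE hr) (Fin.castLE_injective hr)
  convert this using 1
  ext1 i
  exact head_apply hr u i

theorem span_head (hn : ∀ k, 0 < M.n k) (hx : IsGeneric x) (hp : M.N < p) :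
    Submodule.span ℝ (Set.range (head (M.N - 2) u)) = withinSpace x := by
  have hr : M.N - 2 ≤ p := by omega
  refine Submodule.eq_of_le_of_finrank_eq (Submodule.span_le.2 ?_) ?_
  · rintro _ ⟨i, rfl⟩
    rw [head_apply hr]
    exact h.mem_withinSpace ((h.lam_ne_zero_iff hn hx _).2 i.2)
  · rw [finrank_span_eq_card (h.orthonormal_head hr).linearIndependent, Fintype.card_fin,
      hx.finrank_withinSpace hn]

/-- Completeness of the eigenbasis trades a sum over a growing number of eigenvectors for one over
`N - 2` of them, so that limits can be taken termwise. -/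
theorem sum_tail_eq (hp : M.N < p) (d : E p) :
    ∑ i with M.N - 2 ≤ i.val, inner ℝ (u i) d • u i =
      d - ∑ i : Fin (M.N - 2), inner ℝ (head (M.N - 2) u i) d • head (M.N - 2) u i := by
  have hr : M.N - 2 ≤ p := by omega
  have hspan : ⊤ ≤ Submodule.span ℝ (Set.range u) := by
    refine ge_of_eq (Submodule.eq_top_of_finrank_eq ?_)
    rw [finrank_span_eq_card h.orthonormal.linearIndependent, Fintype.card_fin,
      finrank_euclideanSpace_fin]
  have h1 := (OrthonormalBasis.mk h.orthonormal hspan).sum_repr' d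
  rw [OrthonormalBasis.coe_mk] at h1
  rw [← Finset.sum_filter_add_sum_filter_not Finset.univ (fun i : Fin p => i.val < M.N - 2),
    sum_filter_lt_eq_sum_head hr] at h1
  simp only [head_apply hr]
  rw [eq_sub_iff_add_eq']
  simpa only [not_lt] using h1

theorem ridgeVec_eq {m : ℕ} (hm : m ≤ M.N - 2) (hp : M.N < p) (α : ℝ) :
    ridgeVec m α u lam x = ridge (m := m) α (head (M.N - 2) u)
      (fun i => head (M.N - 2) lam i / p) (meanDiff x) := by
  have hr : M.N - 2 ≤ p := by omega
  have hp0 : (p : ℝ) ≠ 0 := by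
    have : p ≠ 0 := by omega
    exact_mod_cast this
  rw [ridgeVec, h.sum_tail_eq hp, ridge, add_sub, add_comm, add_sub_assoc]
  congr 1
  have h1 : ∑ i : Fin p with i.val < m,
      (α * p / (lam i + α * p) * inner ℝ (u i) (meanDiff x)) • u i =
      ∑ i : Fin (M.N - 2) with i.val < m, (α / (head (M.N - 2) lam i / p + α) *
        inner ℝ (head (M.N - 2) u i) (meanDiff x)) • head (M.N - 2) u i := by
    rw [sum_filter_lt_eq_sum_head (hm.trans hr), sum_filter_lt_eq_sum_head hm]
    refine Finset.sum_congr rfl fun i _ => ?_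
    simp only [head_apply hr]
    have hc : Fin.castLE hr (Fin.castLE hm i) = Fin.castLE (hm.trans hr) i := rfl
    rw [hc]
    congr 2
    rw [div_add' _ _ _ hp0, div_div_eq_mul_div]
  rw [h1, Finset.sum_filter, ← Finset.sum_sub_distrib]
  refine Finset.sum_congr rfl fun i _ => ?_
  split_ifs
  · rw [← sub_smul]; congr 1; ring
  · rw [zero_sub, ← neg_smul]; congr 1; ring

/-- Each class mean differs from the total mean by a multiple of `d`, so centring at the total mean
adds just that direction to the within-class span. -/
theorem sampleSpace_eq (hn : ∀ k, 0 < M.n k) (hx : IsGeneric x) (hp : M.N < p) :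
    sampleSpace x = Submodule.span ℝ (Set.range (head (M.N - 2) u)) ⊔
      Submodule.span ℝ {meanDiff x} := by
  rw [h.span_head hn hx hp]
  have hne : ∀ k, (M.n k : ℝ) ≠ 0 := fun k => by exact_mod_cast (hn k).ne'
  have hN : (M.n 0 : ℝ) + M.n 1 ≠ 0 := by
    have h0 : (0 : ℝ) < M.n 0 := by exact_mod_cast hn 0
    have h1 : (0 : ℝ) < M.n 1 := by exact_mod_cast hn 1
    positivity
  have hsum : ∀ k, ∑ j, x k j = (M.n k : ℝ) • classMean x k := fun k => by
    rw [classMean, smul_smul, mul_inv_cancel₀ (hne k), one_smul]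
  have htot : totalMean x = ((M.n 0 : ℝ) + M.n 1)⁻¹ •
      ((M.n 0 : ℝ) • classMean x 0 + (M.n 1 : ℝ) • classMean x 1) := by
    rw [totalMean, Fin.sum_univ_two, hsum, hsum, TwoClassModel.N, Nat.cast_add]
  have h0 : classMean x 0 - totalMean x = ((M.n 1 : ℝ) / (M.n 0 + M.n 1)) • meanDiff x := by
    rw [htot, meanDiff]
    match_scalars <;> (field_simp; try ring)
  have h1 : classMean x 1 - totalMean x = (-(M.n 0 : ℝ) / (M.n 0 + M.n 1)) • meanDiff x := by
    rw [htot, meanDiff]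
    match_scalars <;> (field_simp; try ring)
  apply le_antisymm
  · rw [sampleSpace, Submodule.span_le]
    rintro _ ⟨k, j, rfl⟩
    have hk : classMean x k - totalMean x ∈ Submodule.span ℝ {meanDiff x} := by
      fin_cases k
      · change classMean x 0 - totalMean x ∈ _
        rw [h0]; exact Submodule.smul_mem _ _ (Submodule.mem_span_singleton_self _)
      · change classMean x 1 - totalMean x ∈ _
        rw [h1]; exact Submodule.smul_mem _ _ (Submodule.mem_span_singleton_self _)
    have hc : centredObs x ⟨k, j⟩ ∈ withinSpace x := Submodule.subset_span ⟨_, rfl⟩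
    have := Submodule.add_mem_sup hc hk
    rwa [centredObs, sub_add_sub_cancel] at this
  · have hobs : ∀ k j, x k j - totalMean x ∈ sampleSpace x := fun k j =>
      Submodule.subset_span ⟨k, j, rfl⟩
    have hmean : ∀ k, classMean x k - totalMean x ∈ sampleSpace x := by
      intro k
      have : classMean x k - totalMean x = (M.n k : ℝ)⁻¹ • ∑ j, (x k j - totalMean x) := by
        rw [Finset.sum_sub_distrib, Finset.sum_const, Finset.card_univ, Fintype.card_fin,
          ← Nat.cast_smul_eq_nsmul ℝ, smul_sub, smul_smul, inv_mul_cancel₀ (hne k), one_smul]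
        rfl
      rw [this]
      exact Submodule.smul_mem _ _ (Submodule.sum_mem _ fun j _ => hobs k j)
    refine sup_le ?_ ?_
    · rw [withinSpace, Submodule.span_le]
      rintro _ ⟨⟨k, j⟩, rfl⟩
      have := Submodule.sub_mem _ (hobs k j) (hmean k)
      rwa [sub_sub_sub_cancel_right] at this
    · rw [Submodule.span_le, Set.singleton_subset_iff]
      have := Submodule.sub_mem _ (hmean 0) (hmean 1)
      rwa [sub_sub_sub_cancel_right] at this

/-- Otherwise `d` would be a combination of the eigenvectors in the within-class span, against
general position. The argument works for every `α`, even if a denominator vanishes. -/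
theorem ridgeVec_ne_zero {m : ℕ} (hm : m ≤ M.N - 2) (hn : ∀ k, 0 < M.n k) (hx : IsGeneric x)
    (hp : M.N < p) (α : ℝ) : ridgeVec m α u lam x ≠ 0 := by
  rw [h.ridgeVec_eq hm hp]
  intro h0
  refine hx.meanDiff_notMem hn ?_
  rw [← h.span_head hn hx hp]
  rw [ridge, add_eq_zero_iff_eq_neg] at h0
  rw [h0]
  exact Submodule.neg_mem _ <| Submodule.sum_mem _ fun i _ =>
    Submodule.smul_mem _ _ (Submodule.subset_span ⟨i, rfl⟩)

theorem ridgeVec_mem {m : ℕ} (hm : m ≤ M.N - 2) (hn : ∀ k, 0 < M.n k) (hx : IsGeneric x)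
    (hp : M.N < p) (α : ℝ) : ridgeVec m α u lam x ∈ sampleSpace x := by
  rw [h.ridgeVec_eq hm hp, h.sampleSpace_eq hn hx hp, ridge, add_comm]
  exact Submodule.add_mem_sup (Submodule.sum_mem _ fun i _ =>
    Submodule.smul_mem _ _ (Submodule.subset_span ⟨i, rfl⟩)) (Submodule.mem_span_singleton_self _)

theorem norm_ridgeDir {m : ℕ} (hm : m ≤ M.N - 2) (hn : ∀ k, 0 < M.n k) (hx : IsGeneric x)
    (hp : M.N < p) (α : ℝ) : ‖ridgeDir m α u lam x‖ = 1 := by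
  rw [ridgeDir, norm_smul, norm_inv, norm_norm,
    inv_mul_cancel₀ (norm_ne_zero_iff.2 (h.ridgeVec_ne_zero hm hn hx hp α))]

theorem ridgeDir_mem {m : ℕ} (hm : m ≤ M.N - 2) (hn : ∀ k, 0 < M.n k) (hx : IsGeneric x)
    (hp : M.N < p) (α : ℝ) : ridgeDir m α u lam x ∈ sampleSpace x :=
  Submodule.smul_mem _ _ (h.ridgeVec_mem hm hn hx hp α)

omit h in
theorem ridge_smul {m r : ℕ} (α t : ℝ) (v : Fin r → E p) (ell : Fin r → ℝ) (D : E p) :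
    ridge (m := m) α v ell (t • D) = t • ridge (m := m) α v ell D := by
  simp only [ridge, smul_add, Finset.smul_sum, real_inner_smul_right, smul_smul]
  congr 1
  exact Finset.sum_congr rfl fun i _ => by congr 1; ring

theorem ridgeDir_eq {m : ℕ} (hm : m ≤ M.N - 2) (hp : M.N < p) (α : ℝ) :
    ridgeDir m α u lam x = ‖ridge (m := m) α (head (M.N - 2) u)
      (fun i => head (M.N - 2) lam i / p) ((√(p : ℝ))⁻¹ • meanDiff x)‖⁻¹ •
      ridge (m := m) α (head (M.N - 2) u)
      (fun i => head (M.N - 2) lam i / p) ((√(p : ℝ))⁻¹ • meanDiff x) := by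
  have hp0 : (0 : ℝ) < √(p : ℝ) := Real.sqrt_pos.2 (by
    have : 0 < p := by omega
    exact_mod_cast this)
  rw [ridge_smul, ← h.ridgeVec_eq hm hp, ridgeDir, norm_smul, smul_smul, norm_inv,
    Real.norm_eq_abs, abs_of_pos hp0]
  congr 1
  field_simp

end IsEigenDecomp

end DataPiling

namespace DataPiling

/-! ### Limits of the inner products of the sample -/

section Gram

variable {ι : Type*} [Fintype ι] [DecidableEq ι] {m : ℕ}

/-- Linear combinations of the vectors `g a`. -/
def signal (g : ι → EuclideanSpace ℝ (Fin m)) :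
    EuclideanSpace ℝ ι →ₗ[ℝ] EuclideanSpace ℝ (Fin m) where
  toFun c := ∑ a, c a • g a
  map_add' c c' := by simp [add_smul, Finset.sum_add_distrib]
  map_smul' t c := by simp [Finset.smul_sum, smul_smul]

omit [DecidableEq ι] in
theorem signal_apply (g : ι → EuclideanSpace ℝ (Fin m)) (c : EuclideanSpace ℝ ι) :
    signal g c = ∑ a, c a • g a := rfl

/-- Convergence of the inner products of the components of the observations: the scaled mean
difference `T`, the leading parts `G` and the noise parts `e`. -/
structure IsComponentLimit (U : Ultrafilter ℕ) (τ δ : ℝ) (μ : EuclideanSpace ℝ (Fin m))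
    (g : ι → EuclideanSpace ℝ (Fin m)) (T : ∀ p, E p) (G e : ∀ p, ι → E p)
    (b : ∀ p, Fin m → E p) : Prop where
  orthonormal : ∀ᶠ p in U, Orthonormal ℝ (b p)
  norm_mean : Tendsto (fun p => ‖T p‖) U (𝓝 δ)
  mean_basis : ∀ j, Tendsto (fun p => inner ℝ (b p j) (T p)) U (𝓝 (μ j))
  mem_span : ∀ᶠ p in U, ∀ a, G p a ∈ Submodule.span ℝ (Set.range (b p))
  lead_basis : ∀ a j, Tendsto (fun p => inner ℝ (b p j) (G p a)) U (𝓝 (g a j))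
  noise_noise : ∀ a a', Tendsto (fun p => inner ℝ (e p a) (e p a')) U
    (𝓝 (if a = a' then τ ^ 2 else 0))
  noise_basis : ∀ a j, Tendsto (fun p => inner ℝ (e p a) (b p j)) U (𝓝 0)
  noise_mean : ∀ a, Tendsto (fun p => inner ℝ (e p a) (T p)) U (𝓝 0)

namespace IsComponentLimit

variable {U : Ultrafilter ℕ} {τ δ : ℝ} {μ : EuclideanSpace ℝ (Fin m)}
  {g : ι → EuclideanSpace ℝ (Fin m)} {T : ∀ p, E p} {G e : ∀ p, ι → E p}
  {b : ∀ p, Fin m → E p} (h : IsComponentLimit U τ δ μ g T G e b)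

include h

omit [Fintype ι] in
theorem tendsto_inner_lead (a : ι) {v : ∀ p, E p} {w : EuclideanSpace ℝ (Fin m)}
    (hv : ∀ j, Tendsto (fun p => inner ℝ (b p j) (v p)) U (𝓝 (w j))) :
    Tendsto (fun p => inner ℝ (G p a) (v p)) U (𝓝 (inner ℝ (g a) w)) := by
  have h1 : Tendsto (fun p => ∑ j, inner ℝ (b p j) (G p a) * inner ℝ (b p j) (v p)) U
      (𝓝 (∑ j, g a j * w j)) :=
    tendsto_finsetSum _ fun j _ => (h.lead_basis a j).mul (hv j)
  have h2 : ∑ j, g a j * w j = inner ℝ (g a) w := by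
    simp [PiLp.inner_apply, mul_comm]
  rw [h2] at h1
  refine h1.congr' ?_
  filter_upwards [h.orthonormal, h.mem_span] with p ho hm
  conv_rhs => rw [← eq_sum_inner_of_mem_span ho (hm a), sum_inner]
  exact Finset.sum_congr rfl fun j _ => (real_inner_smul_left _ _ _).symm

omit [Fintype ι] in
theorem tendsto_basis (a : ι) (j : Fin m) :
    Tendsto (fun p => inner ℝ (b p j) (G p a + e p a)) U (𝓝 (g a j)) := by
  have := (h.lead_basis a j).add (h.noise_basis a j)
  rw [add_zero] at this
  refine this.congr fun p => ?_
  rw [inner_add_right, real_inner_comm (e p a)]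

omit [Fintype ι] in
theorem tendsto_mean (a : ι) :
    Tendsto (fun p => inner ℝ (G p a + e p a) (T p)) U (𝓝 (inner ℝ (g a) μ)) := by
  have := (h.tendsto_inner_lead a h.mean_basis).add (h.noise_mean a)
  rw [add_zero] at this
  exact this.congr fun p => by rw [inner_add_left]

omit [Fintype ι] in
theorem tendsto_obs (a a' : ι) :
    Tendsto (fun p => inner ℝ (G p a + e p a) (G p a' + e p a')) U
      (𝓝 (inner ℝ (g a) (g a') + if a = a' then τ ^ 2 else 0)) := by
  have h0 : ∀ j, Tendsto (fun p => inner ℝ (b p j) (e p a)) U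
      (𝓝 ((0 : EuclideanSpace ℝ (Fin m)) j)) := fun j =>
    (h.noise_basis a j).congr fun p => real_inner_comm _ _
  have h1 := (h.tendsto_inner_lead a (h.tendsto_basis a')).add
    ((h.tendsto_inner_lead a' h0).add (h.noise_noise a a'))
  rw [inner_zero_right, zero_add] at h1
  refine h1.congr fun p => ?_
  rw [inner_add_left, inner_add_right (e p a), real_inner_comm (e p a)]

omit [DecidableEq ι] h in
/-- A combination of the scaled mean difference and of the observations. -/
def comb (T : ∀ p, E p) (G e : ∀ p, ι → E p) (κ : ℝ) (c : EuclideanSpace ℝ ι) (p : ℕ) : E p :=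
  κ • T p + ∑ a, c a • (G p a + e p a)

theorem tendsto_comb_basis (κ : ℝ) (c : EuclideanSpace ℝ ι) (j : Fin m) :
    Tendsto (fun p => inner ℝ (comb T G e κ c p) (b p j)) U (𝓝 ((κ • μ + signal g c) j)) := by
  have h1 := ((h.mean_basis j).const_mul κ).add
    (tendsto_finsetSum Finset.univ fun a _ => (h.tendsto_basis a j).const_mul (c a))
  have h2 : κ * μ j + ∑ a, c a * g a j = (κ • μ + signal g c) j := by
    simp [signal_apply, Finset.sum_apply]
  rw [h2] at h1
  refine h1.congr fun p => ?_
  rw [comb, inner_add_left, sum_inner, real_inner_smul_left, real_inner_comm (b p j)]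
  simp_rw [real_inner_smul_left, real_inner_comm (b p j)]

theorem tendsto_comb_mean (κ : ℝ) (c : EuclideanSpace ℝ ι) :
    Tendsto (fun p => inner ℝ (comb T G e κ c p) (T p)) U
      (𝓝 (κ * δ ^ 2 + inner ℝ (signal g c) μ)) := by
  have h1 := ((h.norm_mean.pow 2).const_mul κ).add
    (tendsto_finsetSum Finset.univ fun a _ => (h.tendsto_mean a).const_mul (c a))
  have h2 : ∑ a, c a * inner ℝ (g a) μ = inner ℝ (signal g c) μ := by
    simp [signal_apply, sum_inner, real_inner_smul_left]
  rw [h2] at h1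
  refine h1.congr fun p => ?_
  rw [comb, inner_add_left, sum_inner, real_inner_smul_left, real_inner_self_eq_norm_sq]
  simp_rw [real_inner_smul_left]

/-- The three terms are the leading coordinates, the part of the mean difference outside the leading
space, and the noise, which acts as `τ²` times the identity on coefficients. All inner products of
the centred data and of `d` are special cases. -/
theorem tendsto_comb_comb (κ κ' : ℝ) (c c' : EuclideanSpace ℝ ι) :
    Tendsto (fun p => inner ℝ (comb T G e κ c p) (comb T G e κ' c' p)) U
      (𝓝 (inner ℝ (κ • μ + signal g c) (κ' • μ + signal g c') + κ * κ' * (δ ^ 2 - ‖μ‖ ^ 2) +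
        τ ^ 2 * inner ℝ c c')) := by
  have h1 := ((h.tendsto_comb_mean κ c).const_mul κ').add
    (((tendsto_finsetSum Finset.univ fun a _ => (h.tendsto_mean a).const_mul (c' a)).const_mul
      κ).add (tendsto_finsetSum Finset.univ fun a _ => tendsto_finsetSum Finset.univ fun a' _ =>
        (h.tendsto_obs a a').const_mul (c a * c' a')))
  have h2 : κ' * (κ * δ ^ 2 + inner ℝ (signal g c) μ) + (κ * ∑ a, c' a * inner ℝ (g a) μ +
      ∑ a, ∑ a', c a * c' a' * (inner ℝ (g a) (g a') + if a = a' then τ ^ 2 else 0)) =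
      inner ℝ (κ • μ + signal g c) (κ' • μ + signal g c') + κ * κ' * (δ ^ 2 - ‖μ‖ ^ 2) +
        τ ^ 2 * inner ℝ c c' := by
    have e1 : ∑ a, c' a * inner ℝ (g a) μ = inner ℝ μ (signal g c') := by
      rw [real_inner_comm]
      simp [signal_apply, sum_inner, real_inner_smul_left]
    have e2 : ∑ a, ∑ a', c a * c' a' * inner ℝ (g a) (g a') =
        inner ℝ (signal g c) (signal g c') := by
      rw [signal_apply, signal_apply, sum_inner]
      refine Finset.sum_congr rfl fun a _ => ?_
      rw [inner_sum]
      refine Finset.sum_congr rfl fun a' _ => ?_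
      rw [real_inner_smul_left, real_inner_smul_right, mul_assoc]
    have e3 : ∑ a, ∑ a', c a * c' a' * (if a = a' then τ ^ 2 else 0) = τ ^ 2 * inner ℝ c c' := by
      simp only [mul_ite, mul_zero, Finset.sum_ite_eq, Finset.mem_univ, if_true, PiLp.inner_apply,
        Finset.mul_sum]
      exact Finset.sum_congr rfl fun a _ => by simp; ring
    simp only [mul_add, Finset.sum_add_distrib]
    rw [e1, e2, e3, inner_add_left, inner_add_right, inner_add_right, real_inner_smul_left,
      real_inner_smul_left, real_inner_smul_right, real_inner_smul_right,
      real_inner_self_eq_norm_sq]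
    ring
  rw [h2] at h1
  refine h1.congr fun p => ?_
  conv_rhs => rw [comb.eq_1 T G e κ' c' p, inner_add_right, real_inner_smul_right]
  congr 1
  rw [comb, inner_add_left, real_inner_smul_left, inner_sum, sum_inner]
  congr 1
  · congr 1
    exact Finset.sum_congr rfl fun a _ => by rw [real_inner_smul_right, real_inner_comm]
  · refine Finset.sum_congr rfl fun a _ => ?_
    rw [inner_sum]
    refine Finset.sum_congr rfl fun a' _ => ?_
    rw [real_inner_smul_left, real_inner_smul_right]
    ring

/-- Removing the leading coordinates of `T p` cancels what the observations contribute, so the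
residual only detects the coefficient `κ` of the mean difference. -/
theorem tendsto_comb_residual (κ : ℝ) (c : EuclideanSpace ℝ ι) :
    Tendsto (fun p => inner ℝ (comb T G e κ c p) (T p - ∑ j, inner ℝ (b p j) (T p) • b p j)) U
      (𝓝 (κ * (δ ^ 2 - ‖μ‖ ^ 2))) := by
  have h1 := (h.tendsto_comb_mean κ c).sub (tendsto_finsetSum Finset.univ fun j _ =>
    (h.mean_basis j).mul (h.tendsto_comb_basis κ c j))
  have h2 : κ * δ ^ 2 + inner ℝ (signal g c) μ - ∑ j, μ j * (κ • μ + signal g c) j =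
      κ * (δ ^ 2 - ‖μ‖ ^ 2) := by
    have : ∑ j, μ j * (κ • μ + signal g c) j = inner ℝ (κ • μ + signal g c) μ := by
      rw [PiLp.inner_apply]
      rfl
    rw [this, inner_add_left, real_inner_smul_left, real_inner_self_eq_norm_sq]
    ring
  rw [h2] at h1
  refine h1.congr fun p => ?_
  rw [inner_sub_right, inner_sum]
  simp_rw [real_inner_smul_right]

end IsComponentLimit

end Gram

/-! ### The scaled sample as combinations of mean difference, leading parts and noise -/

namespace TwoClassModel

variable {M : TwoClassModel}

/-- Class-wise centring of a coefficient vector. -/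
def centring (M : TwoClassModel) :
    EuclideanSpace ℝ M.TrainIndex →ₗ[ℝ] EuclideanSpace ℝ M.TrainIndex where
  toFun c := WithLp.toLp 2 fun a => c a - (M.n a.1 : ℝ)⁻¹ * M.classSum c a.1
  map_add' c c' := by ext a; simp [map_add]; ring
  map_smul' t c := by ext a; simp [map_smul]; ring

theorem centring_apply (c : EuclideanSpace ℝ M.TrainIndex) (a : M.TrainIndex) :
    M.centring c a = c a - (M.n a.1 : ℝ)⁻¹ * ∑ j, c ⟨a.1, j⟩ := rfl

theorem centring_of_mem {c : EuclideanSpace ℝ M.TrainIndex} (hc : c ∈ M.centred) :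
    M.centring c = c := by
  ext a
  rw [centring_apply, mem_centred.1 hc, mul_zero, sub_zero]

/-- The coefficients of the sample mean difference. -/
def diffCoef (M : TwoClassModel) : EuclideanSpace ℝ M.TrainIndex :=
  WithLp.toLp 2 fun a => if a.1 = 0 then (M.n 0 : ℝ)⁻¹ else -(M.n 1 : ℝ)⁻¹

theorem diffCoef_apply (a : M.TrainIndex) :
    M.diffCoef a = if a.1 = 0 then (M.n 0 : ℝ)⁻¹ else -(M.n 1 : ℝ)⁻¹ := rfl

/-- `diffCoef` is constant on each class and a centred vector sums to zero there. Hence noise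
contributes nothing to the limiting inner products of centred observations with `d`. -/
theorem inner_centring_diffCoef (hn : ∀ k, 0 < M.n k) (c : EuclideanSpace ℝ M.TrainIndex) :
    inner ℝ (M.centring c) M.diffCoef = 0 := by
  have hne : ∀ k, (M.n k : ℝ) ≠ 0 := fun k => by exact_mod_cast (hn k).ne'
  have hsum : ∀ k, ∑ j, M.centring c ⟨k, j⟩ = 0 := fun k => by
    change ∑ j, (c ⟨k, j⟩ - (M.n k : ℝ)⁻¹ * ∑ j, c ⟨k, j⟩) = 0
    rw [Finset.sum_sub_distrib, Finset.sum_const, Finset.card_univ, Fintype.card_fin, nsmul_eq_mul,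
      mul_inv_cancel_left₀ (hne k), sub_self]
  rw [PiLp.inner_apply, Fintype.sum_sigma]
  refine Finset.sum_eq_zero fun k _ => ?_
  have : ∀ j : Fin (M.n k), inner ℝ (M.centring c ⟨k, j⟩) (M.diffCoef ⟨k, j⟩) =
      (if k = 0 then (M.n 0 : ℝ)⁻¹ else -(M.n 1 : ℝ)⁻¹) * M.centring c ⟨k, j⟩ := fun j => rfl
  simp only [this]
  rw [← Finset.mul_sum, hsum, mul_zero]

theorem diffCoef_ne_zero (hn : ∀ k, 0 < M.n k) : M.diffCoef ≠ 0 := by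
  intro h
  have h1 := congrArg (fun c : EuclideanSpace ℝ M.TrainIndex => c ⟨0, ⟨0, hn 0⟩⟩) h
  simp only [diffCoef_apply, if_true, PiLp.zero_apply, inv_eq_zero, Nat.cast_eq_zero] at h1
  exact (hn 0).ne' h1

/-- The training sample with given scores. -/
def sample (M : TwoClassModel) (z : M.TrainIndex → ℕ → ℝ) (p : ℕ) : M.Sample p :=
  fun k j => M.obs k p (z ⟨k, j⟩)

/-- The scaled mean difference of the populations. -/
def scaledMean (M : TwoClassModel) (p : ℕ) : E p := (√(p : ℝ))⁻¹ • M.mu p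

/-- The scaled leading part of an observation. -/
def leadPart (M : TwoClassModel) (k : Fin 2) (z : ℕ → ℝ) (p : ℕ) : E p :=
  ∑ i : Fin (M.m k), (M.spikeCoef k p i * z i) • M.lead k p i

/-- The limit of the coordinates of the leading part of an observation. -/
def leadLimit {m : ℕ} (R : ∀ k : Fin 2, Matrix (Fin m) (Fin (M.m k)) ℝ) (k : Fin 2)
    (z : ℕ → ℝ) : EuclideanSpace ℝ (Fin m) :=
  WithLp.toLp 2 fun j => ∑ i : Fin (M.m k), √(M.spikeVar k i) * z i * R k j i

theorem tendsto_leadPart {m : ℕ} {R : ∀ k : Fin 2, Matrix (Fin m) (Fin (M.m k)) ℝ}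
    {b : ∀ p, Fin m → E p}
    (hR : ∀ k j i, Tendsto (fun p => inner ℝ (b p j) (M.lead k p i)) atTop (𝓝 (R k j i)))
    (k : Fin 2) (z : ℕ → ℝ) (j : Fin m) :
    Tendsto (fun p => inner ℝ (b p j) (M.leadPart k z p)) atTop (𝓝 (leadLimit R k z j)) := by
  have h1 := tendsto_finsetSum Finset.univ fun (i : Fin (M.m k)) _ =>
    ((M.tendsto_spikeCoef k i.2).mul_const (z i)).mul (hR k j i)
  refine h1.congr fun p => ?_
  rw [leadPart, inner_sum]
  simp_rw [real_inner_smul_right]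

section Sample

variable (z : M.TrainIndex → ℕ → ℝ) {p : ℕ}

theorem smul_classMean (hp : ∀ k, M.m k ≤ p) (hn : ∀ k, 0 < M.n k) (k : Fin 2) :
    (√(p : ℝ))⁻¹ • classMean (M.sample z p) k = (√(p : ℝ))⁻¹ • M.mean k p +
      (M.n k : ℝ)⁻¹ • ∑ j, (M.leadPart k (z ⟨k, j⟩) p + M.noise k p (z ⟨k, j⟩)) := by
  have hne : (M.n k : ℝ) ≠ 0 := by exact_mod_cast (hn k).ne'
  have h1 : ∀ j, (√(p : ℝ))⁻¹ • M.sample z p k j = (√(p : ℝ))⁻¹ • M.mean k p +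
      (M.leadPart k (z ⟨k, j⟩) p + M.noise k p (z ⟨k, j⟩)) := fun j => by
    rw [sample, smul_obs M (hp k), leadPart, add_assoc]
  rw [classMean, smul_comm, Finset.smul_sum]
  simp_rw [h1]
  rw [Finset.sum_add_distrib, smul_add, Finset.sum_const, Finset.card_univ, Fintype.card_fin,
    ← Nat.cast_smul_eq_nsmul ℝ, smul_smul _ (M.n k : ℝ), inv_mul_cancel₀ hne, one_smul]

theorem smul_centredObs (hp : ∀ k, M.m k ≤ p) (hn : ∀ k, 0 < M.n k) (a : M.TrainIndex) :
    (√(p : ℝ))⁻¹ • centredObs (M.sample z p) a =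
      IsComponentLimit.comb M.scaledMean (fun p a => M.leadPart a.1 (z a) p)
        (fun p a => M.noise a.1 p (z a)) 0 (M.centring (EuclideanSpace.single a 1)) p := by
  obtain ⟨k, j⟩ := a
  rw [centredObs, smul_sub, smul_classMean z hp hn, sample, smul_obs M (hp k),
    IsComponentLimit.comb, zero_smul, zero_add]
  have h1 : ∀ a : M.TrainIndex, M.centring (EuclideanSpace.single ⟨k, j⟩ 1) a =
      (if a = ⟨k, j⟩ then 1 else 0) - if a.1 = k then (M.n k : ℝ)⁻¹ else 0 := by
    intro a
    rw [centring_apply]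
    congr 1
    · simp
    · split_ifs with hk
      · obtain ⟨k', j'⟩ := a
        simp only at hk
        subst hk
        simp [Sigma.mk.injEq]
      · rw [Finset.sum_eq_zero, mul_zero]
        intro j' _
        rw [PiLp.single_apply, if_neg]
        intro h
        exact hk (congrArg Sigma.fst h)
  simp_rw [h1, sub_smul, Finset.sum_sub_distrib, ite_smul, one_smul, zero_smul]
  rw [Finset.sum_ite_eq' Finset.univ]
  rw [Fintype.sum_sigma, Finset.sum_eq_single k]
  · simp only [Finset.mem_univ, if_true, leadPart]
    rw [← Finset.smul_sum]
    abel
  · intro k' _ hk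
    simp [hk]
  · simp

theorem smul_meanDiff (hp : ∀ k, M.m k ≤ p) (hn : ∀ k, 0 < M.n k) :
    (√(p : ℝ))⁻¹ • meanDiff (M.sample z p) =
      IsComponentLimit.comb M.scaledMean (fun p a => M.leadPart a.1 (z a) p)
        (fun p a => M.noise a.1 p (z a)) 1 M.diffCoef p := by
  rw [meanDiff, smul_sub, smul_classMean z hp hn, smul_classMean z hp hn, IsComponentLimit.comb,
    one_smul, scaledMean, mu, Fintype.sum_sigma, Fin.sum_univ_two, smul_sub]
  simp only [diffCoef_apply, if_true, one_ne_zero, if_false, neg_smul, Finset.sum_neg_distrib,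
    ← Finset.smul_sum]
  abel

end Sample

end TwoClassModel

end DataPiling

namespace DataPiling

namespace TwoClassModel

variable {M : TwoClassModel}

/-! ### The common leading eigenspace -/

/-- The basis vectors, angles and coordinate matrices of `CommonBasis`. -/
structure IsCommonBasis (M : TwoClassModel) {m : ℕ} (b : ∀ p, Fin m → E p) (θ : Fin m → ℝ)
    (R : ∀ k : Fin 2, Matrix (Fin m) (Fin (M.m k)) ℝ) : Prop where
  basis : ∀ᶠ p in atTop, Orthonormal ℝ (b p) ∧
      Submodule.span ℝ (Set.range (b p)) = M.commonLead p
  angle : ∀ j, Tendsto (fun p => InnerProductGeometry.angle (b p j) (M.mu p)) atTop (𝓝 (θ j))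
  coord : ∀ k j i, Tendsto (fun p => inner ℝ (b p j) (M.lead k p i)) atTop (𝓝 (R k j i))
  rank_eq : (Matrix.fromCols (R 0) (R 1)).rank = m

theorem CommonBasis.exists_isCommonBasis {m : ℕ} (h : M.CommonBasis m) :
    ∃ (b : ∀ p, Fin m → E p) (θ : Fin m → ℝ) (R : ∀ k : Fin 2, Matrix (Fin m) (Fin (M.m k)) ℝ),
      M.IsCommonBasis b θ R := by
  obtain ⟨b, θ, R, h1, h2, h3, -, h5⟩ := h
  exact ⟨b, θ, R, h1, fun j => (h2 j).2, h3, h5⟩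

/-- The limits of the coordinates of the scaled mean difference in the common basis. -/
def meanLimit {m : ℕ} (δ : ℝ) (θ : Fin m → ℝ) : EuclideanSpace ℝ (Fin m) :=
  WithLp.toLp 2 fun j => δ * Real.cos (θ j)

theorem norm_scaledMean (p : ℕ) : ‖M.scaledMean p‖ = (√(p : ℝ))⁻¹ * ‖M.mu p‖ := by
  rw [scaledMean, norm_smul, norm_inv, Real.norm_eq_abs, abs_of_nonneg (Real.sqrt_nonneg _)]

theorem lead_mem_commonLead (k : Fin 2) (p : ℕ) (i : Fin (M.m k)) :
    M.lead k p i ∈ M.commonLead p :=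
  Submodule.subset_span (Set.mem_iUnion.2 ⟨k, i, rfl⟩)

theorem leadPart_mem (k : Fin 2) (z : ℕ → ℝ) (p : ℕ) : M.leadPart k z p ∈ M.commonLead p :=
  Submodule.sum_mem _ fun i _ => Submodule.smul_mem _ _ (lead_mem_commonLead k p i)

theorem norm_lead_le (k : Fin 2) (p : ℕ) (i : Fin (M.m k)) : ‖M.lead k p i‖ ≤ 1 := by
  rw [lead]
  split_ifs with h
  · rw [(M.eigvec k p).norm_eq_one]
  · simp

theorem _root_.DataPiling.eq_zero_of_vecMul_eq_zero {m : ℕ} {κ : Type*} [Fintype κ]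
    {A : Matrix (Fin m) κ ℝ} (hA : A.rank = m) {v : Fin m → ℝ} (hv : Matrix.vecMul v A = 0) :
    v = 0 := by
  have h1 : LinearIndependent ℝ A.row := by
    rw [linearIndependent_iff_card_eq_finrank_span, Fintype.card_fin, Set.finrank,
      ← Matrix.rank_eq_finrank_span_row, hA]
  exact Matrix.vecMul_injective_iff.2 h1 (hv.trans (Matrix.zero_vecMul A).symm)

namespace IsCommonBasis

variable {m : ℕ} {b : ∀ p, Fin m → E p} {θ : Fin m → ℝ}
  {R : ∀ k : Fin 2, Matrix (Fin m) (Fin (M.m k)) ℝ} (h : M.IsCommonBasis b θ R)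

include h

/-- The matrix `[R 0 R 1]` has full row rank, so no nonzero limit vector is orthogonal to all
limiting leading eigenvectors. -/
theorem eq_zero {v : Fin m → ℝ} (hv : ∀ k i, ∑ j, R k j i * v j = 0) : v = 0 := by
  refine eq_zero_of_vecMul_eq_zero h.rank_eq ?_
  ext (i | i)
  · refine Eq.trans ?_ (hv 0 i)
    simp [Matrix.vecMul, dotProduct, mul_comm]
  · refine Eq.trans ?_ (hv 1 i)
    simp [Matrix.vecMul, dotProduct, mul_comm]

/-- The rank is at most the number of columns `m 0 + m 1`, and each `m k ≤ n k - 1`. -/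
theorem le_sub_two (hn : ∀ k, M.m k < M.n k) : m ≤ M.N - 2 := by
  have h1 := Matrix.rank_le_card_width (Matrix.fromCols (R 0) (R 1))
  rw [h.rank_eq, Fintype.card_sum, Fintype.card_fin, Fintype.card_fin] at h1
  have := hn 0
  have := hn 1
  rw [N]
  omega

theorem tendsto_inner_scaledMean {δ : ℝ} (hmean : M.MeanDifference δ) (j : Fin m) :
    Tendsto (fun p => inner ℝ (b p j) (M.scaledMean p)) atTop (𝓝 (meanLimit δ θ j)) := by
  have h1 := hmean.2.mul ((Real.continuous_cos.tendsto _).comp (h.angle j))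
  refine h1.congr' ?_
  filter_upwards [h.basis] with p hp
  rw [scaledMean, real_inner_smul_right,
    ← InnerProductGeometry.cos_angle_mul_norm_mul_norm (b p j) (M.mu p), hp.1.1 j]
  simp only [Function.comp]
  ring

theorem norm_meanLimit_sq_le {δ : ℝ} (hmean : M.MeanDifference δ) :
    ‖meanLimit δ θ‖ ^ 2 ≤ δ ^ 2 := by
  have h1 := tendsto_finsetSum Finset.univ fun (j : Fin m) _ =>
    (h.tendsto_inner_scaledMean hmean j).pow 2
  have h2 := hmean.2.pow 2
  have h3 : ‖meanLimit δ θ‖ ^ 2 = ∑ j, meanLimit δ θ j ^ 2 := by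
    rw [EuclideanSpace.norm_sq_eq]
    simp
  rw [h3]
  refine le_of_tendsto_of_tendsto h1 h2 ?_
  filter_upwards [h.basis] with p hp
  have := hp.1.sum_inner_products_le (M.scaledMean p) (s := Finset.univ)
  rw [norm_scaledMean] at this
  simpa using this

theorem isComponentLimit {δ τ : ℝ} (hmean : M.MeanDifference δ) {U : Ultrafilter ℕ}
    (hU : (U : Filter ℕ) ≤ atTop) {z : M.TrainIndex → ℕ → ℝ}
    (hee : ∀ a a' : M.TrainIndex, Tendsto
      (fun p => inner ℝ (M.noise a.1 p (z a)) (M.noise a'.1 p (z a'))) U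
      (𝓝 (if a = a' then τ ^ 2 else 0)))
    (heb : ∀ (a : M.TrainIndex) j, Tendsto (fun p => inner ℝ (M.noise a.1 p (z a)) (b p j)) U (𝓝 0))
    (het : ∀ a : M.TrainIndex,
      Tendsto (fun p => inner ℝ (M.noise a.1 p (z a)) (M.scaledMean p)) U (𝓝 0)) :
    IsComponentLimit U τ δ (meanLimit δ θ) (fun a : M.TrainIndex => leadLimit R a.1 (z a))
      M.scaledMean (fun p a => M.leadPart a.1 (z a) p) (fun p a => M.noise a.1 p (z a)) b where
  orthonormal := (h.basis.filter_mono hU).mono fun p hp => hp.1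
  norm_mean := (hmean.2.congr fun p => (norm_scaledMean p).symm).mono_left hU
  mean_basis j := (h.tendsto_inner_scaledMean hmean j).mono_left hU
  mem_span := (h.basis.filter_mono hU).mono fun p hp a => by
    rw [hp.2]
    exact leadPart_mem a.1 (z a) p
  lead_basis a j := (tendsto_leadPart h.coord a.1 (z a) j).mono_left hU
  noise_noise := hee
  noise_basis := heb
  noise_mean := het

/-- The limits of the leading parts span if the scores are in general position. -/
theorem map_signal_eq_top (hn : ∀ k, M.m k < M.n k)
    (hspike : ∀ k i, i < M.m k → 0 < M.spikeVar k i) {z : M.TrainIndex → ℕ → ℝ}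
    (hz : ∀ k, AffineIndependent ℝ fun (j : Fin (M.m k + 1)) (i : Fin (M.m k)) =>
      z ⟨k, Fin.castLE (hn k) j⟩ i) :
    M.centred.map (signal (fun a : M.TrainIndex => leadLimit R a.1 (z a)) ∘ₗ M.centring) = ⊤ := by
  rw [← Submodule.orthogonal_eq_bot_iff, Submodule.eq_bot_iff]
  intro v hv
  rw [Submodule.mem_orthogonal] at hv
  have hη : ∀ k i, ∑ j, R k j i * v j = 0 := by
    intro k
    set η : Fin (M.m k) → ℝ := fun i => √(M.spikeVar k i) * ∑ j, R k j i * v j with hηdef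
    have hlin : ∀ y : ℕ → ℝ, inner ℝ (leadLimit R k y) v = ∑ i : Fin (M.m k), η i * y i := by
      intro y
      simp only [PiLp.inner_apply, leadLimit, hηdef, RCLike.inner_apply, conj_trivial,
        Finset.mul_sum, Finset.sum_mul]
      rw [Finset.sum_comm]
      exact Finset.sum_congr rfl fun i _ => Finset.sum_congr rfl fun j _ => by ring
    -- The difference of two unit coefficient vectors of one class is centred, so orthogonality of
    -- `v` to its image annihilates the difference of the two score vectors.
    have hconst : ∀ j j' : Fin (M.n k), ∑ i : Fin (M.m k), η i * (z ⟨k, j⟩ i - z ⟨k, j'⟩ i) = 0 := by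
      intro j j'
      set c : EuclideanSpace ℝ M.TrainIndex :=
        EuclideanSpace.single ⟨k, j⟩ 1 - EuclideanSpace.single ⟨k, j'⟩ 1 with hc
      have hcK : c ∈ M.centred := by
        rw [mem_centred]
        intro k'
        by_cases hk : k' = k
        · subst hk
          simp [hc, Sigma.mk.injEq]
        · refine Finset.sum_eq_zero fun i _ => ?_
          have h1 : ∀ j, (⟨k', i⟩ : M.TrainIndex) ≠ ⟨k, j⟩ := fun j hh =>
            hk (congrArg Sigma.fst hh)
          simp [hc, h1]
      have h1 := hv _ ⟨c, hcK, rfl⟩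
      rw [LinearMap.comp_apply, centring_of_mem hcK, hc, map_sub] at h1
      have h2 : ∀ a : M.TrainIndex, signal (fun a : M.TrainIndex => leadLimit R a.1 (z a))
          (EuclideanSpace.single a 1) = leadLimit R a.1 (z a) := by
        intro a
        rw [signal_apply, Finset.sum_eq_single a]
        · simp
        · intro a' _ ha
          simp [ha]
        · simp
      rw [h2, h2, inner_sub_left, hlin, hlin, ← Finset.sum_sub_distrib] at h1
      rw [← h1]
      exact Finset.sum_congr rfl fun i _ => by ring
    -- Since `m k < n k`, the class supplies `m k + 1` affinely independent points of `ℝ^(m k)`,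
    -- whose differences span the space.
    have htop : vectorSpan ℝ (Set.range fun (j : Fin (M.m k + 1)) (i : Fin (M.m k)) =>
        z ⟨k, Fin.castLE (hn k) j⟩ i) = ⊤ :=
      (hz k).vectorSpan_eq_top_of_card_eq_finrank_add_one (by simp)
    have hmem : η ∈ vectorSpan ℝ (Set.range fun (j : Fin (M.m k + 1)) (i : Fin (M.m k)) =>
        z ⟨k, Fin.castLE (hn k) j⟩ i) := by
      rw [htop]; trivial
    rw [vectorSpan_range_eq_span_range_vsub_right ℝ _ (0 : Fin (M.m k + 1))] at hmem
    have hself : ∑ i, η i * η i = 0 := by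
      refine Submodule.span_induction (p := fun y _ => ∑ i, η i * y i = 0) ?_ ?_ ?_ ?_ hmem
      · rintro _ ⟨j, rfl⟩
        exact hconst _ _
      · simp
      · intro y y' _ _ hy hy'
        simp only [Pi.add_apply, mul_add, Finset.sum_add_distrib, hy, hy', add_zero]
      · intro t y _ hy
        simp only [Pi.smul_apply, smul_eq_mul, mul_left_comm _ t, ← Finset.mul_sum, hy, mul_zero]
    rw [Finset.sum_eq_zero_iff_of_nonneg fun i _ => mul_self_nonneg _] at hself
    intro i
    have h3 := mul_self_eq_zero.1 (hself i (Finset.mem_univ i))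
    exact (mul_eq_zero.1 h3).resolve_left (Real.sqrt_pos.2 (hspike k i i.2)).ne'
  ext j
  exact congrFun (h.eq_zero hη) j

end IsCommonBasis

end TwoClassModel

open TwoClassModel in
/-- Convergence of the components of the sample implies convergence of its Gram matrix. -/
theorem IsComponentLimit.isSampleLimit {M : TwoClassModel} (hn : ∀ k, 0 < M.n k) {m : ℕ}
    {U : Ultrafilter ℕ} (hU : (U : Filter ℕ) ≤ atTop) {τ δ : ℝ} (hτ : 0 < τ)
    {μ : EuclideanSpace ℝ (Fin m)} (hμ : ‖μ‖ ^ 2 ≤ δ ^ 2)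
    {g : M.TrainIndex → EuclideanSpace ℝ (Fin m)} {b : ∀ p, Fin m → E p}
    {z : M.TrainIndex → ℕ → ℝ}
    (h : IsComponentLimit U τ δ μ g M.scaledMean (fun p a => M.leadPart a.1 (z a) p)
      (fun p a => M.noise a.1 p (z a)) b)
    (hsurj : M.centred.map (signal g ∘ₗ M.centring) = ⊤)
    {α : ℕ → ℝ} (hα : Tendsto α U (𝓝 (-τ ^ 2)))
    {u : ∀ p, Fin p → E p} {lam : ∀ p, Fin p → ℝ}
    (hdec : ∀ p, IsEigenDecomp (M.sample z p) (u p) (lam p))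
    (hgen : ∀ p, M.N < p → IsGeneric (M.sample z p)) :
    IsSampleLimit U τ (δ ^ 2 - ‖μ‖ ^ 2 + τ ^ 2 * ‖M.diffCoef‖ ^ 2) M.centred
      (signal g ∘ₗ M.centring) (μ + signal g M.diffCoef)
      (fun p a => (√(p : ℝ))⁻¹ • centredObs (M.sample z p) a)
      (fun p => (√(p : ℝ))⁻¹ • meanDiff (M.sample z p)) b α
      (fun p => head (M.N - 2) (u p)) (fun p i => head (M.N - 2) (lam p) i / p) := by
  have hlarge : ∀ᶠ p in U, (∀ k, M.m k ≤ p) ∧ M.N < p := by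
    refine Filter.Eventually.filter_mono hU ?_
    filter_upwards [eventually_ge_atTop (M.m 0), eventually_ge_atTop (M.m 1),
      eventually_gt_atTop M.N] with p h0 h1 h2
    exact ⟨fun k => by fin_cases k <;> assumption, h2⟩
  have hx : ∀ᶠ p : ℕ in U, ∀ a, (√(p : ℝ))⁻¹ • centredObs (M.sample z p) a =
      comb M.scaledMean (fun p a => M.leadPart a.1 (z a) p)
        (fun p a => M.noise a.1 p (z a)) 0 (M.centring (EuclideanSpace.single a 1)) p :=
    hlarge.mono fun p hp a => smul_centredObs z hp.1 hn a
  have hD : ∀ᶠ p : ℕ in U, (√(p : ℝ))⁻¹ • meanDiff (M.sample z p) =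
      comb M.scaledMean (fun p a => M.leadPart a.1 (z a) p)
        (fun p a => M.noise a.1 p (z a)) 1 M.diffCoef p :=
    hlarge.mono fun p hp => smul_meanDiff z hp.1 hn
  refine ⟨hτ, ?_, finrank_centred hn, hsurj,
    ⟨fun a a' => inner ℝ ((signal g ∘ₗ M.centring) (EuclideanSpace.single a 1))
      ((signal g ∘ₗ M.centring) (EuclideanSpace.single a' 1)) + τ ^ 2 *
      inner ℝ (M.centring (EuclideanSpace.single a 1)) (M.centring (EuclideanSpace.single a' 1)),
      fun a a' => ?_, ?_⟩, fun a j => ?_, fun a => ?_,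
    fun j => ?_, ?_, hα, ?_, ?_, ?_, ?_, ?_⟩
  -- The noise left in the class means keeps `s` positive even if the mean difference is
  -- asymptotically in the leading space, so this step does not require `φ > 0`.
  · have : 0 < ‖M.diffCoef‖ := norm_pos_iff.2 (diffCoef_ne_zero hn)
    have h2 : 0 < τ ^ 2 * ‖M.diffCoef‖ ^ 2 := by positivity
    linarith
  · have := h.tendsto_comb_comb 0 0 (M.centring (EuclideanSpace.single a 1))
      (M.centring (EuclideanSpace.single a' 1))
    simp only [zero_smul, zero_add, zero_mul, add_zero] at this
    refine this.congr' ?_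
    filter_upwards [hx] with p hp
    rw [hp, hp]
  · intro c hc c' hc'
    -- The unit coefficient vectors are not centred, but a centred vector is reproduced by their
    -- centred versions with unchanged coefficients.
    have hexp : ∀ c ∈ M.centred, ∑ a, c a • M.centring (EuclideanSpace.single a 1) = c := by
      intro c hc
      have h1 : ∑ a, c a • EuclideanSpace.single a (1 : ℝ) = c := by
        ext a
        simp [Finset.sum_apply, Pi.single_apply]
      conv_rhs => rw [← centring_of_mem hc, ← h1, map_sum]
      simp
    have hexp' : ∀ c ∈ M.centred,
        ∑ a, c a • (signal g ∘ₗ M.centring) (EuclideanSpace.single a 1) =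
        (signal g ∘ₗ M.centring) c := by
      intro c hc
      conv_rhs => rw [LinearMap.comp_apply, centring_of_mem hc, ← hexp c hc, map_sum]
      exact Finset.sum_congr rfl fun a _ => by rw [map_smul, LinearMap.comp_apply]
    conv_rhs => rw [← hexp' c hc, ← hexp' c' hc']
    conv_rhs => rhs; rhs; rw [← hexp c hc, ← hexp c' hc']
    simp only [mul_add, Finset.sum_add_distrib, sum_inner, inner_sum, real_inner_smul_left,
      real_inner_smul_right, Finset.mul_sum]
    congr 1
    · rw [Finset.sum_comm]
      exact Finset.sum_congr rfl fun a _ => Finset.sum_congr rfl fun a' _ => by ring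
    · rw [Finset.sum_comm]
      exact Finset.sum_congr rfl fun a _ => Finset.sum_congr rfl fun a' _ => by ring
  · have := h.tendsto_comb_basis 0 (M.centring (EuclideanSpace.single a 1)) j
    rw [zero_smul, zero_add] at this
    refine this.congr' ?_
    filter_upwards [hx] with p hp
    rw [hp]
  · have := h.tendsto_comb_comb 0 1 (M.centring (EuclideanSpace.single a 1)) M.diffCoef
    rw [inner_centring_diffCoef hn] at this
    simp only [zero_smul, zero_add, zero_mul, add_zero, one_smul, mul_zero] at this
    refine this.congr' ?_
    filter_upwards [hx, hD] with p hp hp'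
    rw [hp, hp']
  · have := h.tendsto_comb_basis 1 M.diffCoef j
    rw [one_smul] at this
    refine this.congr' ?_
    filter_upwards [hD] with p hp
    rw [hp]
  · have := h.tendsto_comb_comb 1 1 M.diffCoef M.diffCoef
    simp only [one_smul, one_mul, real_inner_self_eq_norm_sq] at this
    rw [← add_assoc]
    refine this.congr' ?_
    filter_upwards [hD] with p hp
    rw [hp]
  · filter_upwards [hlarge] with p hp
    exact (hdec p).orthonormal_head (by omega)
  · filter_upwards [hlarge] with p hp i
    have hr : M.N - 2 ≤ p := by omega
    have h1 := (hdec p).eigen (Fin.castLE hr i)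
    rw [withinScatter_eq] at h1
    simp only [head_apply hr]
    have hp0 : (0 : ℝ) < p := by
      have : 0 < p := by omega
      exact_mod_cast this
    have hs : (√(p : ℝ))⁻¹ * (√(p : ℝ))⁻¹ = (p : ℝ)⁻¹ := by
      rw [← mul_inv, Real.mul_self_sqrt hp0.le]
    rw [div_eq_inv_mul, mul_smul, ← h1, Finset.smul_sum]
    refine Finset.sum_congr rfl fun a _ => ?_
    rw [real_inner_smul_left, smul_smul, smul_smul, ← hs]
    congr 1
    ring
  · filter_upwards [hlarge] with p hp i
    have hr : M.N - 2 ≤ p := by omega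
    have hp0 : (0 : ℝ) < p := by
      have : 0 < p := by omega
      exact_mod_cast this
    rw [head_apply hr]
    exact div_pos ((hdec p).lam_pos hn (hgen p hp.2) i.2) hp0
  · filter_upwards [hlarge] with p hp i j hij
    have hr : M.N - 2 ≤ p := by omega
    simp only [head_apply hr]
    exact div_le_div_of_nonneg_right ((hdec p).descending hij) (Nat.cast_nonneg p)
  · filter_upwards with p i
    have := M.centred.smul_mem (√(p : ℝ))⁻¹
      (inner_centredObs_mem hn (M.sample z p) (head (M.N - 2) (u p) i))
    convert this using 1
    ext a
    simp [real_inner_smul_left]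

end DataPiling

namespace DataPiling

namespace TwoClassModel

variable {M : TwoClassModel}

/-! ### Training and test data in general position -/

theorem eigval_pos (ht : ∀ k i, 0 < M.tailVar k i) (hs : ∀ k i, i < M.m k → 0 < M.spikeVar k i)
    (k : Fin 2) (p i : ℕ) : 0 < M.eigval k p i := by
  rw [eigval]
  split_ifs with hi
  · have := ht k i
    have := hs k i hi
    positivity
  · simpa using ht k i

/-- The linear map sending the scores to the centred observation. -/
def scoreMap (M : TwoClassModel) (k : Fin 2) (p : ℕ) : (Fin p → ℝ) →ₗ[ℝ] E p where
  toFun y := ∑ i : Fin p, (√(M.eigval k p i) * y i) • M.eigvec k p i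
  map_add' y y' := by simp [mul_add, add_smul, Finset.sum_add_distrib]
  map_smul' t y := by simp [Finset.smul_sum, smul_smul, mul_left_comm]

theorem scoreMap_injective (ht : ∀ k i, 0 < M.tailVar k i)
    (hs : ∀ k i, i < M.m k → 0 < M.spikeVar k i) (k : Fin 2) (p : ℕ) :
    Function.Injective (M.scoreMap k p) := by
  rw [← LinearMap.ker_eq_bot, LinearMap.ker_eq_bot']
  intro y hy
  ext i
  have h1 : inner ℝ (M.eigvec k p i) (M.scoreMap k p y) = √(M.eigval k p i) * y i :=
    (M.eigvec k p).orthonormal.inner_right_fintype _ i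
  rw [hy, inner_zero_right] at h1
  exact (mul_eq_zero.1 h1.symm).resolve_left (Real.sqrt_pos.2 (eigval_pos ht hs k p i)).ne'

/-- All eigenvalues are positive, so an observation is an invertible affine image of its first `p`
scores. -/
theorem map_obs_absolutelyContinuous (ht : ∀ k i, 0 < M.tailVar k i)
    (hs : ∀ k i, i < M.m k → 0 < M.spikeVar k i) {k : Fin 2} {ν : Measure (ℕ → ℝ)}
    (hν : IsScoreLaw ν) (p : ℕ) : ν.map (M.obs k p) ≪ volume := by
  set e : (Fin p → ℝ) ≃ₗ[ℝ] E p := LinearEquiv.ofInjectiveOfFinrankEq (M.scoreMap k p)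
    (scoreMap_injective ht hs k p) (by simp) with he
  set L := e.toContinuousLinearEquiv with hL
  have hLm : Measurable L := L.continuous.measurable
  have h1 : (volume : Measure (Fin p → ℝ)).map L ≪ volume := by
    have : ((volume : Measure (Fin p → ℝ)).map L).IsAddHaarMeasure := L.isAddHaarMeasure_map _
    exact Measure.absolutelyContinuous_isAddHaarMeasure _ _
  have h2 : (ν.map (fun (z : ℕ → ℝ) (i : Fin p) => z i)).map L ≪ volume :=
    ((hν.absCont p).map hLm).trans h1
  have h3 : ((ν.map (fun (z : ℕ → ℝ) (i : Fin p) => z i)).map L).map (M.mean k p + ·) ≪ volume := by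
    have := h2.map (measurable_const_add (M.mean k p))
    rwa [(measurePreserving_add_left volume (M.mean k p)).map_eq] at this
  rw [Measure.map_map hLm (by fun_prop), Measure.map_map (by fun_prop) (by fun_prop)] at h3
  exact h3

variable {Ω : Type*} [MeasurableSpace Ω]

/-- The scores of all observations are independent, with one law for each class. -/
structure IsScoreArray (P : Measure Ω) (M : TwoClassModel) (ν : Fin 2 → Measure (ℕ → ℝ))
    (Z : M.Index → Ω → ℕ → ℝ) : Prop where
  score_law : ∀ k, IsScoreLaw (ν k)
  hasLaw : ∀ a, HasLaw (Z a) (ν (M.label a)) P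
  indep : iIndepFun Z P

/-- The scores of the training observations. -/
def trainScores (Z : M.Index → Ω → ℕ → ℝ) (ω : Ω) (a : M.TrainIndex) : ℕ → ℝ := Z (Sum.inl a) ω

theorem measurable_sample (p : ℕ) : Measurable fun z => M.sample z p := by
  refine measurable_pi_lambda _ fun k => measurable_pi_lambda _ fun j => ?_
  exact (M.measurable_obs k p).comp (measurable_pi_apply _)

namespace IsScoreArray

variable {P : Measure Ω} [IsProbabilityMeasure P] {ν : Fin 2 → Measure (ℕ → ℝ)}
  {Z : M.Index → Ω → ℕ → ℝ} (h : IsScoreArray P M ν Z)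

include h

theorem isProbabilityMeasure (k : Fin 2) : IsProbabilityMeasure (ν k) :=
  (h.hasLaw (Sum.inr (k, 0))).isProbabilityMeasure_iff.1 inferInstance

omit [IsProbabilityMeasure P] in
theorem aemeasurable (a : M.Index) : AEMeasurable (Z a) P := (h.hasLaw a).aemeasurable

omit [IsProbabilityMeasure P] in
theorem aemeasurable_trainScores : AEMeasurable (trainScores Z) P :=
  aemeasurable_pi_lambda _ fun a => h.aemeasurable (Sum.inl a)

omit [IsProbabilityMeasure P] in
theorem aemeasurable_train (p : ℕ) : AEMeasurable (M.train Z p) P := by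
  have hm : Measurable fun z => M.sample z p := measurable_sample p
  have := hm.comp_aemeasurable h.aemeasurable_trainScores
  exact this

omit [IsProbabilityMeasure P] in
theorem aemeasurable_test (k : Fin 2) (l p : ℕ) : AEMeasurable (M.test Z k l p) P :=
  (M.measurable_obs k p).comp_aemeasurable (h.aemeasurable _)

omit [IsProbabilityMeasure P] in
theorem indepFun_train_test (b b' : Fin 2 × ℕ) :
    IndepFun (trainScores Z) (fun ω => (Z (Sum.inr b) ω, Z (Sum.inr b') ω)) P := by
  classical
  set S : Finset M.Index := Finset.univ.image Sum.inl with hS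
  set T : Finset M.Index := {Sum.inr b, Sum.inr b'} with hT
  have hST : Disjoint S T := by
    rw [Finset.disjoint_left]
    intro a ha ha'
    simp only [hS, hT, Finset.mem_image, Finset.mem_univ, true_and, Finset.mem_insert,
      Finset.mem_singleton] at ha ha'
    obtain ⟨x, rfl⟩ := ha
    simp at ha'
  have h1 := h.indep.indepFun_finset₀ S T hST h.aemeasurable
  exact h1.comp (φ := fun (y : S → ℕ → ℝ) (a : M.TrainIndex) => y ⟨Sum.inl a, by simp [hS]⟩)
    (ψ := fun (y : T → ℕ → ℝ) => (y ⟨Sum.inr b, by simp [hT]⟩, y ⟨Sum.inr b', by simp [hT]⟩))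
    (by fun_prop) (by fun_prop)

theorem ae_isGeneric (ht : ∀ k i, 0 < M.tailVar k i)
    (hs : ∀ k i, i < M.m k → 0 < M.spikeVar k i) :
    ∀ᵐ ω ∂P, ∀ p, M.N < p → IsGeneric (M.train Z p ω) := by
  rw [ae_all_iff]
  intro p
  by_cases hp : M.N < p
  · have hcard : Fintype.card M.TrainIndex ≤ Module.finrank ℝ (E p) + 1 := by
      rw [card_trainIndex, finrank_euclideanSpace_fin]
      omega
    have := ae_affineIndependent (P := P) (volume : Measure (E p)) hcard
      (Y := fun a : M.TrainIndex => M.obs a.1 p ∘ Z (Sum.inl a))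
      (fun a => (M.measurable_obs a.1 p).comp_aemeasurable (h.aemeasurable _))
      (fun a => by
        rw [← AEMeasurable.map_map_of_aemeasurable (M.measurable_obs a.1 p).aemeasurable
          (h.aemeasurable _), (h.hasLaw _).map_eq]
        exact map_obs_absolutelyContinuous ht hs (h.score_law _) p)
      ((h.indep.precomp Sum.inl_injective).comp _ fun a => M.measurable_obs a.1 p)
    filter_upwards [this] with ω hω _
    exact hω
  · exact .of_forall fun ω hp' => absurd hp' hp

/-- The first `m k` scores have a density on `ℝ^(m k)`, so `m k + 1` independent copies are in
general position. This makes the limiting signal map surjective. -/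
theorem ae_affineIndependent_scores (hn : ∀ k, M.m k < M.n k) :
    ∀ᵐ ω ∂P, ∀ k, AffineIndependent ℝ fun (j : Fin (M.m k + 1)) (i : Fin (M.m k)) =>
      trainScores Z ω ⟨k, Fin.castLE (hn k) j⟩ i := by
  rw [ae_all_iff]
  intro k
  have hinj : Function.Injective fun j : Fin (M.m k + 1) =>
      (Sum.inl ⟨k, Fin.castLE (hn k) j⟩ : M.Index) := by
    intro j j' hjj
    simpa using hjj
  have hm : Measurable fun (z : ℕ → ℝ) (i : Fin (M.m k)) => z i := by fun_prop
  have := ae_affineIndependent (P := P) (volume : Measure (Fin (M.m k) → ℝ)) (by simp)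
    (Y := fun j : Fin (M.m k + 1) => (fun (z : ℕ → ℝ) (i : Fin (M.m k)) => z i) ∘
      Z (Sum.inl ⟨k, Fin.castLE (hn k) j⟩))
    (fun a => hm.comp_aemeasurable (h.aemeasurable _))
    (fun a => by
      rw [← AEMeasurable.map_map_of_aemeasurable hm.aemeasurable (h.aemeasurable _),
        (h.hasLaw _).map_eq]
      exact (h.score_law _).absCont _)
    ((h.indep.precomp hinj).comp _ fun a => hm)
  exact this

/-! ### Limits of the noise -/

/-- For distinct observations, one noise vector is an independent vector of bounded second moment
for the other; the diagonal case is the law of large numbers. -/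
theorem asymp_noise_noise {τ : ℝ} (htail : M.EqualTail τ) (a a' : M.TrainIndex) :
    AsympAE P fun U ω => Tendsto (fun p => inner ℝ (M.noise a.1 p (trainScores Z ω a))
      (M.noise a'.1 p (trainScores Z ω a'))) U (𝓝 (if a = a' then τ ^ 2 else 0)) := by
  have := h.isProbabilityMeasure
  split_ifs with haa
  · subst haa
    simp_rw [real_inner_self_eq_norm_sq]
    exact AsympAE.of_tendstoInMeasure
      (tendstoInMeasure_norm_noise_sq htail (h.score_law a.1) (h.hasLaw (Sum.inl a)))
  · obtain ⟨C, hC⟩ := htail.tail_bdd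
    refine AsympAE.of_tendstoInMeasure (tendstoInMeasure_inner_noise (h.score_law a.1)
      htail.tail_pos hC (h.hasLaw (Sum.inl a))
      (W := fun p ω => M.noise a'.1 p (trainScores Z ω a')) (B := C)
      (.of_forall fun p => ⟨?_, ?_, ?_⟩))
    · exact (M.measurable_noise _ p).comp_aemeasurable (h.aemeasurable (Sum.inl a'))
    · have hne : (Sum.inl a' : M.Index) ≠ Sum.inl a := fun hh => haa (Sum.inl_injective hh).symm
      exact (h.indep.indepFun hne).comp (M.measurable_noise _ p) measurable_id
    · exact lintegral_norm_noise_sq_le (h.score_law a'.1) htail.tail_pos hC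
        (h.hasLaw (Sum.inl a')) p

theorem tendstoInMeasure_noise_const {τ : ℝ} (htail : M.EqualTail τ) (a : M.Index) {v : ∀ p, E p}
    {B : ℝ} (hv : ∀ᶠ p in atTop, ‖v p‖ ≤ B) :
    TendstoInMeasure P (fun p ω => inner ℝ (M.noise (M.label a) p (Z a ω)) (v p)) atTop
      (fun _ => 0) := by
  have := h.isProbabilityMeasure
  obtain ⟨C, hC⟩ := htail.tail_bdd
  refine tendstoInMeasure_inner_noise (h.score_law _) htail.tail_pos hC (h.hasLaw a)
    (W := fun p _ => v p) (B := B ^ 2) ?_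
  filter_upwards [hv] with p hp
  refine ⟨aemeasurable_const, indepFun_const_left _ _, ?_⟩
  rw [lintegral_const, measure_univ, mul_one]
  gcongr

theorem tendstoInMeasure_noise_train {τ : ℝ} (htail : M.EqualTail τ) (c : Fin 2 × ℕ)
    {w : ∀ p, M.Sample p → E p} (hw : IsDirSeq P Z w) :
    TendstoInMeasure P (fun p ω => inner ℝ (M.noise c.1 p (Z (Sum.inr c) ω))
      (w p (M.train Z p ω))) atTop (fun _ => 0) := by
  have := h.isProbabilityMeasure
  obtain ⟨C, hC⟩ := htail.tail_bdd
  refine tendstoInMeasure_inner_noise (h.score_law c.1) htail.tail_pos hC (h.hasLaw (Sum.inr c))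
    (W := fun p ω => w p (M.train Z p ω)) (B := 1) ?_
  filter_upwards [eventually_gt_atTop M.N] with p hp
  obtain ⟨hwm, hwa⟩ := hw p hp
  refine ⟨hwm.comp_aemeasurable (h.aemeasurable_train p), ?_, ?_⟩
  · exact (h.indepFun_train_test c c).comp (hwm.comp (measurable_sample p)) measurable_fst
  · rw [lintegral_congr_ae (g := fun _ => ENNReal.ofReal 1)]
    · simp
    · filter_upwards [hwa] with ω hω
      rw [hω.2, one_pow]

/-- The components of the training sample converge. -/
theorem asymp_isComponentLimit {τ δ : ℝ} (htail : M.EqualTail τ) (hmean : M.MeanDifference δ)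
    {m : ℕ} {b : ∀ p, Fin m → E p} {θ : Fin m → ℝ}
    {R : ∀ k : Fin 2, Matrix (Fin m) (Fin (M.m k)) ℝ} (hb : M.IsCommonBasis b θ R) :
    AsympAE P fun U ω => IsComponentLimit U τ δ (meanLimit δ θ)
      (fun a : M.TrainIndex => leadLimit R a.1 (trainScores Z ω a))
      M.scaledMean (fun p a => M.leadPart a.1 (trainScores Z ω a) p)
      (fun p a => M.noise a.1 p (trainScores Z ω a)) b := by
  have h1 := AsympAE.forall fun a => AsympAE.forall fun a' => h.asymp_noise_noise htail a a'
  have h2 := AsympAE.forall fun a : M.TrainIndex => AsympAE.forall fun j : Fin m =>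
    AsympAE.of_tendstoInMeasure (h.tendstoInMeasure_noise_const htail (Sum.inl a)
      (v := fun p => b p j) (B := 1) (hb.basis.mono fun p hp => (hp.1.1 j).le))
  have h3 := AsympAE.forall fun a : M.TrainIndex =>
    AsympAE.of_tendstoInMeasure (h.tendstoInMeasure_noise_const htail (Sum.inl a)
      (v := M.scaledMean) (B := δ + 1) ((hmean.2.eventually (gt_mem_nhds (lt_add_one δ))).mono
        fun p hp => by rw [norm_scaledMean]; exact le_of_lt hp))
  refine (h1.and (h2.and h3)).mono (.of_forall fun ω U hU hω => ?_)
  exact hb.isComponentLimit hmean hU hω.1 hω.2.1 hω.2.2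

end IsScoreArray

end TwoClassModel

end DataPiling

/-! ### Orthogonality of second data piling directions to the leading eigenvectors -/

namespace DataPiling

section RandomCoefficients

variable {Ω : Type*} [MeasurableSpace Ω] {P : Measure Ω} [IsProbabilityMeasure P]

/-- Independence factors each term of the expanded square, and the cross terms vanish by
uncorrelatedness. The constant `2` is the variance of a difference of two independent scores. -/
theorem integral_sq_sum_mul_of_indepFun {r : ℕ} {C : ℝ} {a ξ : Ω → Fin r → ℝ}
    (ham : AEMeasurable a P) (haC : ∀ᵐ ω ∂P, ∀ i, |a ω i| ≤ C) (hind : IndepFun a ξ P)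
    (hξ : ∀ i, MemLp (fun ω => ξ ω i) 2 P)
    (hξξ : ∀ i j, ∫ ω, ξ ω i * ξ ω j ∂P = if i = j then 2 else 0) :
    ∫ ω, (∑ i, a ω i * ξ ω i) ^ 2 ∂P = 2 * ∑ i, ∫ ω, a ω i ^ 2 ∂P := by
  have ham' : ∀ i, AEMeasurable (fun ω => a ω i) P := fun i => aemeasurable_pi_iff.1 ham i
  have haa : ∀ i j, Integrable (fun ω => a ω i * a ω j) P := by
    intro i j
    refine Integrable.of_bound ((ham' i).mul (ham' j)).aestronglyMeasurable (C * C) ?_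
    filter_upwards [haC] with ω hω
    rw [norm_mul, Real.norm_eq_abs, Real.norm_eq_abs]
    exact mul_le_mul (hω i) (hω j) (abs_nonneg _) ((abs_nonneg _).trans (hω i))
  have hξi : ∀ i j, Integrable (fun ω => ξ ω i * ξ ω j) P := fun i j =>
    (hξ i).integrable_mul (hξ j)
  have hij : ∀ i j, IndepFun (fun ω => a ω i * a ω j) (fun ω => ξ ω i * ξ ω j) P := fun i j =>
    hind.comp (φ := fun y : Fin r → ℝ => y i * y j) (ψ := fun y : Fin r → ℝ => y i * y j)
      (by fun_prop) (by fun_prop)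
  have hint : ∀ i j, Integrable (fun ω => (a ω i * a ω j) * (ξ ω i * ξ ω j)) P := fun i j =>
    (hij i j).integrable_mul (haa i j) (hξi i j)
  have hexp : ∀ ω, (∑ i, a ω i * ξ ω i) ^ 2 =
      ∑ i, ∑ j, (a ω i * a ω j) * (ξ ω i * ξ ω j) := by
    intro ω
    rw [pow_two, Finset.sum_mul_sum]
    exact Finset.sum_congr rfl fun i _ => Finset.sum_congr rfl fun j _ => by ring
  simp_rw [hexp]
  rw [integral_finsetSum _ fun i _ => integrable_finsetSum _ fun j _ => hint i j, Finset.mul_sum]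
  refine Finset.sum_congr rfl fun i _ => ?_
  rw [integral_finsetSum _ fun j _ => hint i j]
  have : ∀ j, ∫ ω, (a ω i * a ω j) * (ξ ω i * ξ ω j) ∂P =
      if i = j then 2 * ∫ ω, a ω i ^ 2 ∂P else 0 := by
    intro j
    have h1 := (hij i j).integral_mul_eq_mul_integral (haa i j).aestronglyMeasurable
      (hξi i j).aestronglyMeasurable
    refine h1.trans ?_
    rw [hξξ]
    split_ifs with h
    · subst h
      simp_rw [← pow_two]
      ring
    · simp
  simp_rw [this]
  simp

/-- If a linear form in uncorrelated variables with independent random coefficients vanishes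
asymptotically, then so do the coefficients. -/
theorem tendstoInMeasure_coef_of_sum {r : ℕ} {C : ℝ} {a : ℕ → Ω → Fin r → ℝ} {ξ : Ω → Fin r → ℝ}
    (ha : ∀ᶠ p in atTop, AEMeasurable (a p) P ∧ (∀ᵐ ω ∂P, ∀ i, |a p ω i| ≤ C) ∧
      IndepFun (a p) ξ P)
    (hξ : ∀ i, MemLp (fun ω => ξ ω i) 2 P)
    (hξξ : ∀ i j, ∫ ω, ξ ω i * ξ ω j ∂P = if i = j then 2 else 0)
    (hS : TendstoInMeasure P (fun p ω => ∑ i, a p ω i * ξ ω i) atTop (fun _ => 0)) (i : Fin r) :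
    TendstoInMeasure P (fun p ω => a p ω i) atTop (fun _ => 0) := by
  -- Bounded coefficients make the squared sums dominated by an integrable variable, which upgrades
  -- convergence in probability to convergence in mean square.
  set G : Ω → ℝ := fun ω => (∑ i, C * |ξ ω i|) ^ 2 with hG
  have hGi : Integrable G P := MemLp.integrable_sq
    (memLp_finsetSum (f := fun i ω => C * |ξ ω i|) Finset.univ fun i _ => (hξ i).abs.const_mul C)
  have hlim : Tendsto (fun p => ∫ ω, (∑ i, a p ω i * ξ ω i) ^ 2 ∂P) atTop (𝓝 0) := by
    refine tendsto_of_subseq_tendsto fun ns hns => ?_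
    obtain ⟨ms, hms, hae⟩ := (hS.comp hns).exists_seq_tendsto_ae
    refine ⟨ms, ?_⟩
    have hnm := hns.comp hms.tendsto_atTop
    have := tendsto_integral_filter_of_dominated_convergence (l := atTop) (μ := P)
      (F := fun i ω => (∑ j, a (ns (ms i)) ω j * ξ ω j) ^ 2) (f := fun _ => 0) G ?_ ?_ hGi ?_
    · simpa using this
    · filter_upwards [hnm.eventually ha] with p hp
      have h1 : ∀ j, AEMeasurable (fun ω => a (ns (ms p)) ω j) P := fun j =>
        aemeasurable_pi_iff.1 hp.1 j
      have h2 : ∀ j, AEMeasurable (fun ω => ξ ω j) P := fun j => (hξ j).aemeasurable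
      exact ((Finset.aemeasurable_fun_sum _ fun j _ => (h1 j).mul (h2 j)).pow_const 2).aestronglyMeasurable
    · filter_upwards [hnm.eventually ha] with p hp
      filter_upwards [hp.2.1] with ω hω
      rw [norm_pow, Real.norm_eq_abs]
      refine pow_le_pow_left₀ (abs_nonneg _) ((Finset.abs_sum_le_sum_abs _ _).trans ?_) 2
      refine Finset.sum_le_sum fun j _ => ?_
      rw [abs_mul]
      exact mul_le_mul_of_nonneg_right (hω j) (abs_nonneg _)
    · filter_upwards [hae] with ω hω
      simpa using hω.pow 2
  refine tendstoInMeasure_zero_of_lintegral_sq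
    (B := fun p => ENNReal.ofReal (∫ ω, (∑ i, a p ω i * ξ ω i) ^ 2 ∂P)) ?_ ?_ ?_
  · exact ha.mono fun p hp => aemeasurable_pi_iff.1 hp.1 i
  · simpa using ENNReal.tendsto_ofReal hlim
  · filter_upwards [ha] with p hp
    obtain ⟨ham, haC, hind⟩ := hp
    have ham' : ∀ i, AEMeasurable (fun ω => a p ω i) P := fun i => aemeasurable_pi_iff.1 ham i
    have haa : Integrable (fun ω => a p ω i ^ 2) P := by
      refine Integrable.of_bound ((ham' i).pow_const 2).aestronglyMeasurable (C ^ 2) ?_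
      filter_upwards [haC] with ω hω
      rw [norm_pow, Real.norm_eq_abs]
      exact pow_le_pow_left₀ (abs_nonneg _) (hω i) 2
    rw [← ofReal_integral_eq_lintegral_ofReal haa (.of_forall fun _ => sq_nonneg _)]
    refine ENNReal.ofReal_le_ofReal ?_
    rw [integral_sq_sum_mul_of_indepFun ham haC hind hξ hξξ]
    have h0 : ∀ j, 0 ≤ ∫ ω, a p ω j ^ 2 ∂P := fun j => integral_nonneg fun _ => sq_nonneg _
    have := Finset.single_le_sum (fun j _ => h0 j) (Finset.mem_univ i)
    have := h0 i
    linarith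

end RandomCoefficients

namespace TwoClassModel

variable {M : TwoClassModel} {Ω : Type*} [MeasurableSpace Ω]

theorem smul_inner_obs_sub_obs {c c' : Fin 2} {p : ℕ} (hc : M.m c ≤ p) (hc' : M.m c' ≤ p)
    (z z' : ℕ → ℝ) (w : E p) :
    (√(p : ℝ))⁻¹ * inner ℝ w (M.obs c p z - M.obs c' p z') =
      inner ℝ w ((√(p : ℝ))⁻¹ • (M.mean c p - M.mean c' p)) +
      (∑ i : Fin (M.m c), M.spikeCoef c p i * inner ℝ w (M.lead c p i) * z i -
        ∑ i : Fin (M.m c'), M.spikeCoef c' p i * inner ℝ w (M.lead c' p i) * z' i) +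
      (inner ℝ (M.noise c p z) w - inner ℝ (M.noise c' p z') w) := by
  rw [← real_inner_smul_right, smul_sub, smul_sub, M.smul_obs hc, M.smul_obs hc']
  simp only [inner_sub_right, inner_add_right, inner_sum, real_inner_smul_right]
  rw [real_inner_comm w (M.noise c p z), real_inner_comm w (M.noise c' p z')]
  have h1 : ∀ (c : Fin 2) (z : ℕ → ℝ), ∑ i : Fin (M.m c),
      M.spikeCoef c p i * z i * inner ℝ w (M.lead c p i) = ∑ i : Fin (M.m c),
      M.spikeCoef c p i * inner ℝ w (M.lead c p i) * z i := fun c z =>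
    Finset.sum_congr rfl fun i _ => by ring
  rw [h1, h1]
  ring

namespace IsScoreArray

variable {P : Measure Ω} [IsProbabilityMeasure P] {ν : Fin 2 → Measure (ℕ → ℝ)}
  {Z : M.Index → Ω → ℕ → ℝ} (h : IsScoreArray P M ν Z)

include h

theorem memLp_score (a : M.Index) (i : ℕ) : MemLp (fun ω => Z a ω i) 2 P := by
  have := h.isProbabilityMeasure
  have h1 := (h.score_law (M.label a)).memLp_two i
  rw [← (h.hasLaw a).map_eq] at h1
  exact h1.comp_of_map (h.aemeasurable a)

omit [IsProbabilityMeasure P] in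
theorem integral_score (a : M.Index) (i : ℕ) : ∫ ω, Z a ω i ∂P = 0 :=
  ((h.hasLaw a).integral_comp (f := fun z : ℕ → ℝ => z i)
    (measurable_pi_apply i).aestronglyMeasurable).trans ((h.score_law _).mean_zero i)

theorem integral_score_mul (a : M.Index) (i j : ℕ) :
    ∫ ω, Z a ω i * Z a ω j ∂P = if i = j then 1 else 0 := by
  have := h.isProbabilityMeasure
  exact ((h.hasLaw a).integral_comp (f := fun z : ℕ → ℝ => z i * z j)
    (by fun_prop : Measurable _).aestronglyMeasurable).trans ((h.score_law _).integral_mul i j)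

theorem integral_score_mul_of_ne {a a' : M.Index} (haa : a ≠ a') (i j : ℕ) :
    ∫ ω, Z a ω i * Z a' ω j ∂P = 0 := by
  have h1 : IndepFun (fun ω => Z a ω i) (fun ω => Z a' ω j) P :=
    (h.indep.indepFun haa).comp (measurable_pi_apply i) (measurable_pi_apply j)
  refine (h1.integral_mul_eq_mul_integral (h.memLp_score a i).aestronglyMeasurable
    (h.memLp_score a' j).aestronglyMeasurable).trans ?_
  rw [h.integral_score, zero_mul]

theorem integral_score_sub_mul {a a' : M.Index} (haa : a ≠ a') (i j : ℕ) :
    ∫ ω, (Z a ω i - Z a' ω i) * (Z a ω j - Z a' ω j) ∂P = if i = j then 2 else 0 := by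
  have hi : ∀ a a' : M.Index, Integrable (fun ω => Z a ω i * Z a' ω j) P := fun a a' =>
    (h.memLp_score a i).integrable_mul (h.memLp_score a' j)
  have hadd : ∀ a b c d : M.Index,
      Integrable (fun ω => Z a ω i * Z b ω j + Z c ω i * Z d ω j) P := fun a b c d =>
    (hi a b).add (hi c d)
  have h1 : ∀ ω, (Z a ω i - Z a' ω i) * (Z a ω j - Z a' ω j) =
      (Z a ω i * Z a ω j + Z a' ω i * Z a' ω j) -
        (Z a ω i * Z a' ω j + Z a' ω i * Z a ω j) := fun ω => by ring
  simp_rw [h1]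
  rw [integral_sub (hadd _ _ _ _) (hadd _ _ _ _), integral_add (hi _ _) (hi _ _),
    integral_add (hi _ _) (hi _ _), h.integral_score_mul, h.integral_score_mul,
    h.integral_score_mul_of_ne haa, h.integral_score_mul_of_ne haa.symm]
  split_ifs <;> norm_num

/-- Second data piling directions are asymptotically orthogonal to the leading eigenvectors. -/
theorem tendstoInMeasure_inner_lead {τ : ℝ} (htail : M.EqualTail τ)
    {w : ∀ p, M.Sample p → E p} (hw : IsSecondPiling P Z w) (k : Fin 2) (i : Fin (M.m k)) :
    TendstoInMeasure P (fun p ω => inner ℝ (w p (M.train Z p ω)) (M.lead k p i)) atTop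
      (fun _ => 0) := by
  obtain ⟨hw1, hw2⟩ := hw
  -- Two test observations of class `k`: their difference eliminates the class mean and leaves a
  -- linear form in the score differences, with coefficients depending on the training data only.
  have hb0 : (Sum.inr (k, 0) : M.Index) ≠ Sum.inr (k, 1) := by simp
  set a : ℕ → Ω → Fin (M.m k) → ℝ := fun p ω i =>
    M.spikeCoef k p i * inner ℝ (w p (M.train Z p ω)) (M.lead k p i) with ha
  set ξ : Ω → Fin (M.m k) → ℝ := fun ω i => Z (Sum.inr (k, 0)) ω i - Z (Sum.inr (k, 1)) ω i
    with hξ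
  have hlim : ∀ i : Fin (M.m k), Tendsto (fun p => M.spikeCoef k p i) atTop
    (𝓝 √(M.spikeVar k i)) := fun i => M.tendsto_spikeCoef k i.2
  have hmw : ∀ p, M.N < p → AEMeasurable (fun ω => w p (M.train Z p ω)) P := fun p hp =>
    (hw1 p hp).1.comp_aemeasurable (h.aemeasurable_train p)
  set C : ℝ := ∑ i : Fin (M.m k), (√(M.spikeVar k i) + 1) with hC
  have hbound : ∀ᶠ p in atTop, ∀ i : Fin (M.m k), |M.spikeCoef k p i| ≤ C := by
    rw [eventually_all]
    intro i
    have h1 := (hlim i).abs.eventually (gt_mem_nhds (lt_add_one _))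
    filter_upwards [h1] with p hp
    rw [abs_of_nonneg (Real.sqrt_nonneg _)] at hp
    refine hp.le.trans ?_
    exact Finset.single_le_sum (f := fun i : Fin (M.m k) => √(M.spikeVar k i) + 1)
      (fun j _ => by positivity) (Finset.mem_univ i)
  have hA : TendstoInMeasure P (fun p ω => a p ω i) atTop (fun _ => 0) := by
    refine tendstoInMeasure_coef_of_sum (C := C) (ξ := ξ) ?_ ?_ ?_ ?_ i
    · filter_upwards [hbound, eventually_gt_atTop M.N] with p hp hpN
      refine ⟨?_, ?_, ?_⟩
      · exact aemeasurable_pi_lambda _ fun i =>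
          ((hmw p hpN).inner aemeasurable_const).const_mul _
      · filter_upwards [(hw1 p hpN).2] with ω hω i
        rw [ha, abs_mul]
        calc _ ≤ C * 1 := by
              refine mul_le_mul (hp i) ?_ (abs_nonneg _) ((abs_nonneg _).trans (hp i))
              refine (abs_real_inner_le_norm _ _).trans ?_
              rw [hω.2, one_mul]
              exact norm_lead_le k p i
          _ = C := mul_one C
      · have h1 := h.indepFun_train_test (k, 0) (k, 1)
        have hm1 : Measurable fun (z : M.TrainIndex → ℕ → ℝ) (i : Fin (M.m k)) =>
            M.spikeCoef k p i * inner ℝ (w p (M.sample z p)) (M.lead k p i) := by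
          have hwz : Measurable fun z : M.TrainIndex → ℕ → ℝ => w p (M.sample z p) :=
            (hw1 p hpN).1.comp (measurable_sample p)
          exact measurable_pi_lambda _ fun i => (hwz.inner measurable_const).const_mul _
        have hm2 : Measurable fun (z : (ℕ → ℝ) × (ℕ → ℝ)) (i : Fin (M.m k)) => z.1 i - z.2 i := by
          fun_prop
        exact h1.comp hm1 hm2
    · exact fun i => (h.memLp_score _ i).sub (h.memLp_score _ i)
    · intro i j
      refine (h.integral_score_sub_mul hb0 i j).trans ?_
      simp [Fin.ext_iff]
    · refine AsympAE.tendstoInMeasure ?_ (((AsympAE.of_tendstoInMeasure (hw2 k 0 1)).and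
        ((AsympAE.of_tendstoInMeasure (h.tendstoInMeasure_noise_train htail (k, 0) hw1)).and
        (AsympAE.of_tendstoInMeasure (h.tendstoInMeasure_noise_train htail (k, 1) hw1)))).mono
        (.of_forall fun ω U hU hω => ?_))
      · filter_upwards [eventually_gt_atTop M.N] with p hpN
        have h1 : ∀ i, AEMeasurable (fun ω => a p ω i) P := fun i =>
          ((hmw p hpN).inner aemeasurable_const).const_mul _
        have h2 : ∀ i, AEMeasurable (fun ω => ξ ω i) P := fun i =>
          ((h.memLp_score _ i).sub (h.memLp_score _ i)).aemeasurable
        exact Finset.aemeasurable_fun_sum _ fun j _ => (h1 j).mul (h2 j)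
      · obtain ⟨h1, h2, h3⟩ := hω
        have h4 := h1.sub (h2.sub h3)
        simp only [sub_zero] at h4
        refine h4.congr' ?_
        filter_upwards [hU (eventually_ge_atTop (M.m k))] with p hp
        rw [test, test, smul_inner_obs_sub_obs hp hp, sub_self, smul_zero, inner_zero_right,
          zero_add, add_sub_cancel_right, ← Finset.sum_sub_distrib]
        exact Finset.sum_congr rfl fun i _ => by simp only [ha, hξ]; ring
  have hpos : 0 < √(M.spikeVar k i) := Real.sqrt_pos.2 (htail.spike_pos k i i.2)
  refine AsympAE.tendstoInMeasure ?_ ((AsympAE.of_tendstoInMeasure hA).mono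
    (.of_forall fun ω U hU hω => ?_))
  · filter_upwards [eventually_gt_atTop M.N] with p hpN
    exact (hmw p hpN).inner aemeasurable_const
  · have h1 := hω.div ((hlim i).mono_left hU) hpos.ne'
    rw [zero_div] at h1
    refine h1.congr' ?_
    filter_upwards [((hlim i).mono_left hU).eventually (lt_mem_nhds hpos)] with p hp
    simp only [Pi.div_apply, ha]
    field_simp

end IsScoreArray

end TwoClassModel

end DataPiling

/-! ### Characterization of second data piling and of the piling distance -/

namespace DataPiling

namespace TwoClassModel

variable {M : TwoClassModel} {Ω : Type*} [MeasurableSpace Ω]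

/-- The component of the scaled mean difference orthogonal to an orthonormal family. -/
def meanResidual (M : TwoClassModel) {m : ℕ} (b : ∀ p, Fin m → E p) (p : ℕ) : E p :=
  M.scaledMean p - ∑ j, inner ℝ (b p j) (M.scaledMean p) • b p j

theorem inner_meanResidual {m : ℕ} (b : ∀ p, Fin m → E p) {p : ℕ} (w : E p) :
    inner ℝ w (M.meanResidual b p) = inner ℝ w (M.scaledMean p) -
      ∑ j, inner ℝ (b p j) (M.scaledMean p) * inner ℝ w (b p j) := by
  rw [meanResidual, inner_sub_right, inner_sum]
  simp_rw [real_inner_smul_right]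

namespace IsCommonBasis

variable {m : ℕ} {b : ∀ p, Fin m → E p} {θ : Fin m → ℝ}
  {R : ∀ k : Fin 2, Matrix (Fin m) (Fin (M.m k)) ℝ} (h : M.IsCommonBasis b θ R)
  {U : Ultrafilter ℕ} (hU : (U : Filter ℕ) ≤ atTop) {w : ∀ p, E p}

include h hU

theorem eventually_inner_lead_eq : ∀ᶠ p in U, ∀ (v : E p) (k : Fin 2) (i : Fin (M.m k)),
    inner ℝ v (M.lead k p i) = ∑ j, inner ℝ (b p j) (M.lead k p i) * inner ℝ v (b p j) := by
  filter_upwards [hU h.basis] with p hp v k i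
  have hmem : M.lead k p i ∈ Submodule.span ℝ (Set.range (b p)) := by
    rw [hp.2]
    exact lead_mem_commonLead k p i
  conv_lhs => rw [← eq_sum_inner_of_mem_span hp.1 hmem, inner_sum]
  simp_rw [real_inner_smul_right]

theorem tendsto_inner_lead_zero (hwb : ∀ j, Tendsto (fun p => inner ℝ (w p) (b p j)) U (𝓝 0))
    (k : Fin 2) (i : Fin (M.m k)) :
    Tendsto (fun p => inner ℝ (w p) (M.lead k p i)) U (𝓝 0) := by
  have h1 := tendsto_finsetSum Finset.univ fun (j : Fin m) _ =>
    ((h.coord k j i).mono_left hU).mul (hwb j)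
  simp only [mul_zero, Finset.sum_const_zero] at h1
  refine h1.congr' ?_
  filter_upwards [h.eventually_inner_lead_eq hU] with p hp
  rw [hp]

/-- Along `U` the coordinates of `w` in the common basis converge to some `β` with `(R k)ᵀ β = 0`
for both classes, and the rank condition forces `β = 0`. -/
theorem tendsto_inner_basis_zero (hw : ∀ᶠ p in U, ‖w p‖ ≤ 1)
    (hwl : ∀ k i, Tendsto (fun p => inner ℝ (w p) (M.lead k p i)) U (𝓝 0)) (j : Fin m) :
    Tendsto (fun p => inner ℝ (w p) (b p j)) U (𝓝 0) := by
  have hlim : ∀ j, ∃ x, Tendsto (fun p => inner ℝ (w p) (b p j)) U (𝓝 x) := fun j => by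
    refine exists_tendsto_of_abs_le U (C := 1) ?_
    filter_upwards [hU h.basis, hw] with p hp hw
    refine (abs_real_inner_le_norm _ _).trans ?_
    rw [hp.1.1 j, mul_one]
    exact hw
  choose β hβ using hlim
  have hβ0 : β = 0 := by
    refine h.eq_zero fun k i => ?_
    have h1 := tendsto_finsetSum Finset.univ fun (j : Fin m) _ =>
      ((h.coord k j i).mono_left hU).mul (hβ j)
    refine tendsto_nhds_unique h1 ((hwl k i).congr' ?_)
    filter_upwards [h.eventually_inner_lead_eq hU] with p hp
    rw [hp]
  simpa [hβ0] using hβ j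

theorem tendsto_inner_meanResidual_sub {δ : ℝ} (hmean : M.MeanDifference δ)
    (hwb : ∀ j, Tendsto (fun p => inner ℝ (w p) (b p j)) U (𝓝 0)) :
    Tendsto (fun p => inner ℝ (w p) (M.scaledMean p) - inner ℝ (w p) (M.meanResidual b p)) U
      (𝓝 0) := by
  have h1 := tendsto_finsetSum Finset.univ fun (j : Fin m) _ =>
    ((h.tendsto_inner_scaledMean hmean j).mono_left hU).mul (hwb j)
  simp only [mul_zero, Finset.sum_const_zero] at h1
  refine h1.congr fun p => ?_
  rw [inner_meanResidual, sub_sub_cancel]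

theorem eventually_norm_meanResidual_le {δ : ℝ} (hmean : M.MeanDifference δ) :
    ∀ᶠ p in U, ‖M.meanResidual b p‖ ≤ δ + 1 := by
  filter_upwards [hU h.basis, hU (hmean.2.eventually (gt_mem_nhds (lt_add_one δ)))] with p hp hp'
  rw [← norm_scaledMean] at hp'
  refine le_trans ?_ hp'.le
  have h1 : inner ℝ (M.meanResidual b p) (M.meanResidual b p) =
      inner ℝ (M.meanResidual b p) (M.scaledMean p) := by
    conv_lhs => rw [inner_meanResidual]
    rw [sub_eq_self]
    refine Finset.sum_eq_zero fun j _ => ?_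
    rw [real_inner_comm (b p j) (M.meanResidual b p), meanResidual, inner_sub_sum_inner hp.1, mul_zero]
  rw [real_inner_self_eq_norm_sq] at h1
  have h2 := real_inner_le_norm (M.meanResidual b p) (M.scaledMean p)
  rw [← h1, pow_two] at h2
  by_contra hlt
  push Not at hlt
  have h3 : 0 < ‖M.meanResidual b p‖ := (norm_nonneg _).trans_lt hlt
  nlinarith

/-- If `w` is asymptotically orthogonal to the leading space and to the noise, only the difference
of the means survives. -/
theorem tendsto_test_diff {c c' : Fin 2} {z z' : ℕ → ℝ}
    (hwb : ∀ j, Tendsto (fun p => inner ℝ (w p) (b p j)) U (𝓝 0))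
    (hz : Tendsto (fun p => inner ℝ (M.noise c p z) (w p)) U (𝓝 0))
    (hz' : Tendsto (fun p => inner ℝ (M.noise c' p z') (w p)) U (𝓝 0)) :
    Tendsto (fun p : ℕ => (√(p : ℝ))⁻¹ * inner ℝ (w p) (M.obs c p z - M.obs c' p z') -
      inner ℝ (w p) ((√(p : ℝ))⁻¹ • (M.mean c p - M.mean c' p))) U (𝓝 0) := by
  have hsum : ∀ (c : Fin 2) (z : ℕ → ℝ), Tendsto (fun p => ∑ i : Fin (M.m c),
      M.spikeCoef c p i * inner ℝ (w p) (M.lead c p i) * z i) U (𝓝 0) := by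
    intro c z
    have h1 := tendsto_finsetSum Finset.univ fun (i : Fin (M.m c)) _ =>
      (((M.tendsto_spikeCoef c i.2).mono_left hU).mul
        (h.tendsto_inner_lead_zero hU hwb c i)).mul_const (z i)
    simpa using h1
  have h2 := ((hsum c z).sub (hsum c' z')).add (hz.sub hz')
  simp only [sub_zero, add_zero] at h2
  refine h2.congr' ?_
  filter_upwards [hU (eventually_ge_atTop (M.m c)), hU (eventually_ge_atTop (M.m c'))] with p hp hp'
  rw [smul_inner_obs_sub_obs hp hp']
  ring

end IsCommonBasis

theorem _root_.DataPiling.IsDirSeq.ae_all {P : Measure Ω} {Z : M.Index → Ω → ℕ → ℝ}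
    {w : ∀ p, M.Sample p → E p} (hw : IsDirSeq P Z w) :
    ∀ᵐ ω ∂P, ∀ p, M.N < p → w p (M.train Z p ω) ∈ sampleSpace (M.train Z p ω) ∧
      ‖w p (M.train Z p ω)‖ = 1 := by
  rw [ae_all_iff]
  intro p
  by_cases hp : M.N < p
  · filter_upwards [(hw p hp).2] with ω hω _
    exact hω
  · exact .of_forall fun ω hp' => absurd hp' hp

namespace IsScoreArray

variable {P : Measure Ω} [IsProbabilityMeasure P] {ν : Fin 2 → Measure (ℕ → ℝ)}
  {Z : M.Index → Ω → ℕ → ℝ} (h : IsScoreArray P M ν Z) {τ : ℝ} (htail : M.EqualTail τ)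
  {m : ℕ} {b : ∀ p, Fin m → E p} {θ : Fin m → ℝ}
  {R : ∀ k : Fin 2, Matrix (Fin m) (Fin (M.m k)) ℝ} (hb : M.IsCommonBasis b θ R)
  {w : ∀ p, M.Sample p → E p}

include h

omit [IsProbabilityMeasure P] in
theorem aemeasurable_dir (hw : IsDirSeq P Z w) {p : ℕ} (hp : M.N < p) :
    AEMeasurable (fun ω => w p (M.train Z p ω)) P :=
  (hw p hp).1.comp_aemeasurable (h.aemeasurable_train p)

include htail hb

/-- Second data piling directions are those asymptotically orthogonal to the common leading
eigenspace. -/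
theorem isSecondPiling_iff (hw : IsDirSeq P Z w) : IsSecondPiling P Z w ↔
    AsympAE P fun U ω => ∀ j, Tendsto (fun p => inner ℝ (w p (M.train Z p ω)) (b p j)) U (𝓝 0) := by
  constructor
  · intro h2
    have h3 := AsympAE.forall fun k => AsympAE.forall fun i =>
      AsympAE.of_tendstoInMeasure (h.tendstoInMeasure_inner_lead htail h2 k i)
    refine h3.mono ?_
    filter_upwards [hw.ae_all] with ω hω U hU hl
    refine hb.tendsto_inner_basis_zero hU ?_ hl
    filter_upwards [hU (eventually_gt_atTop M.N)] with p hp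
    exact (hω p hp).2.le
  · intro h2
    refine ⟨hw, fun k l l' => ?_⟩
    refine AsympAE.tendstoInMeasure ?_ ((h2.and
      ((AsympAE.of_tendstoInMeasure (h.tendstoInMeasure_noise_train htail (k, l) hw)).and
      (AsympAE.of_tendstoInMeasure (h.tendstoInMeasure_noise_train htail (k, l') hw)))).mono
      (.of_forall fun ω U hU hω => ?_))
    · filter_upwards [eventually_gt_atTop M.N] with p hp
      exact ((h.aemeasurable_dir hw hp).inner
        ((h.aemeasurable_test k l p).sub (h.aemeasurable_test k l' p))).const_mul _
    · have := hb.tendsto_test_diff hU hω.1 hω.2.1 hω.2.2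
      simp only [sub_self, smul_zero, inner_zero_right, sub_zero] at this
      exact this

/-- The piling distance is asymptotically determined by the component of the mean difference
orthogonal to the common leading eigenspace. -/
theorem asymp_pilingDistance {δ : ℝ} (hmean : M.MeanDifference δ) (hw : IsSecondPiling P Z w)
    (l l' : ℕ) : AsympAE P fun U ω => Tendsto (fun p : ℕ => (√(p : ℝ))⁻¹ *
      |inner ℝ (w p (M.train Z p ω)) (M.test Z 0 l p ω - M.test Z 1 l' p ω)| -
      |inner ℝ (w p (M.train Z p ω)) (M.meanResidual b p)|) U (𝓝 0) := by
  refine (((h.isSecondPiling_iff htail hb hw.1).1 hw).and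
    ((AsympAE.of_tendstoInMeasure (h.tendstoInMeasure_noise_train htail (0, l) hw.1)).and
    (AsympAE.of_tendstoInMeasure (h.tendstoInMeasure_noise_train htail (1, l') hw.1)))).mono
    (.of_forall fun ω U hU hω => ?_)
  have h1 := (hb.tendsto_test_diff hU hω.1 hω.2.1 hω.2.2).add
    (hb.tendsto_inner_meanResidual_sub hU hmean hω.1)
  rw [add_zero] at h1
  have h2 := h1.abs
  rw [abs_zero] at h2
  refine squeeze_zero_norm (fun p => ?_) h2
  have h3 : ∀ x : ℝ, (√(p : ℝ))⁻¹ * |x| = |(√(p : ℝ))⁻¹ * x| := fun x => by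
    rw [abs_mul, abs_of_nonneg (a := (√(p : ℝ))⁻¹) (by positivity)]
  rw [Real.norm_eq_abs, h3]
  refine (abs_abs_sub_abs_le_abs_sub _ _).trans (le_of_eq ?_)
  congr 1
  rw [scaledMean, mu, test, test]
  ring

end IsScoreArray

end TwoClassModel

end DataPiling

/-! ### Asymptotics of the projected ridged discriminant direction -/

namespace DataPiling

section UnitVectors

variable {p : ℕ} {v w : E p}

theorem abs_abs_inner_sub_le (v w y : E p) :
    |(|inner ℝ w y| - |inner ℝ v y|)| ≤ min ‖w - v‖ ‖w + v‖ * ‖y‖ := by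
  rcases min_cases ‖w - v‖ ‖w + v‖ with ⟨h, -⟩ | ⟨h, -⟩
  · rw [h]
    refine (abs_abs_sub_abs_le_abs_sub _ _).trans ?_
    rw [← inner_sub_left]
    exact abs_real_inner_le_norm _ _
  · rw [h, ← abs_neg (inner ℝ v y)]
    refine (abs_abs_sub_abs_le_abs_sub _ _).trans ?_
    rw [sub_neg_eq_add, ← inner_add_left]
    exact abs_real_inner_le_norm _ _

theorem min_norm_sub_add_le (hv : ‖v‖ = 1) (hw : ‖w‖ = 1) :
    min ‖w - v‖ ‖w + v‖ ≤ √(2 - 2 * |inner ℝ v w|) := by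
  rcases le_total 0 (inner ℝ v w) with h | h
  · refine (min_le_left _ _).trans (Real.le_sqrt_of_sq_le ?_)
    rw [norm_sub_sq_real, hv, hw, abs_of_nonneg h, real_inner_comm v w]
    linarith
  · refine (min_le_right _ _).trans (Real.le_sqrt_of_sq_le ?_)
    rw [norm_add_sq_real, hv, hw, abs_of_nonpos h, real_inner_comm v w]
    linarith

theorem norm_sub_normalize {w r : E p} (hw : ‖w‖ = 1) (hr : r ≠ 0) :
    ‖w - ‖r‖⁻¹ • r‖ ≤ 2 * ‖w - r‖ := by
  have h0 : ‖r‖ ≠ 0 := norm_ne_zero_iff.2 hr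
  have h1 : ‖r - ‖r‖⁻¹ • r‖ = |‖r‖ - 1| := by
    have : r - ‖r‖⁻¹ • r = (‖r‖ - 1) • (‖r‖⁻¹ • r) := by
      rw [smul_smul, sub_mul, mul_inv_cancel₀ h0, one_mul, sub_smul, one_smul]
    rw [this, norm_smul, norm_smul, norm_inv, norm_norm, inv_mul_cancel₀ h0, mul_one,
      Real.norm_eq_abs]
  have h2 : |‖r‖ - 1| ≤ ‖w - r‖ := by
    rw [← hw, norm_sub_rev]
    exact abs_norm_sub_norm_le _ _
  calc ‖w - ‖r‖⁻¹ • r‖ ≤ ‖w - r‖ + ‖r - ‖r‖⁻¹ • r‖ := norm_sub_le_norm_sub_add_norm_sub _ _ _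
    _ ≤ 2 * ‖w - r‖ := by rw [h1]; linarith

end UnitVectors

namespace TwoClassModel

variable {M : TwoClassModel}

/-- The projection of the scaled mean difference onto the leading space has limiting norm `δ cos φ`,
unless it tends to zero, and `φ > 0` makes this smaller than `δ`. -/
theorem IsCommonBasis.norm_meanLimit_sq_lt {m : ℕ} {b : ∀ p, Fin m → E p} {θ : Fin m → ℝ}
    {R : ∀ k : Fin 2, Matrix (Fin m) (Fin (M.m k)) ℝ} (h : M.IsCommonBasis b θ R) {δ φ : ℝ}
    (hmean : M.MeanDifference δ) (hφ : M.LimitAngle φ) (hφ0 : 0 < φ) :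
    ‖meanLimit δ θ‖ ^ 2 < δ ^ 2 := by
  have h1 : Tendsto (fun p => ∑ j, inner ℝ (b p j) (M.scaledMean p) ^ 2) atTop
      (𝓝 (‖meanLimit δ θ‖ ^ 2)) := by
    have h3 : ‖meanLimit δ θ‖ ^ 2 = ∑ j, meanLimit δ θ j ^ 2 := by
      rw [EuclideanSpace.norm_sq_eq]
      simp
    rw [h3]
    exact tendsto_finsetSum Finset.univ fun (j : Fin m) _ =>
      (h.tendsto_inner_scaledMean hmean j).pow 2
  have hT : Tendsto (fun p => ‖M.scaledMean p‖) atTop (𝓝 δ) :=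
    hmean.2.congr fun p => (norm_scaledMean p).symm
  -- A projection `y` of `T` satisfies `‖y‖² = ⟪T, y⟫ = cos (angle T y) ‖T‖ ‖y‖`, which also holds
  -- when `y = 0`, whatever angle is assigned there.
  have h2 := ((Real.continuous_cos.tendsto _).comp hφ).mul (hT.mul h1.sqrt)
  have h4 : ‖meanLimit δ θ‖ ^ 2 = Real.cos φ * (δ * √(‖meanLimit δ θ‖ ^ 2)) := by
    refine tendsto_nhds_unique h1 (h2.congr' ?_)
    filter_upwards [h.basis, eventually_gt_atTop 0] with p hp hp0
    have hproj : (M.commonLead p).starProjection (M.scaledMean p) =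
        ∑ j, inner ℝ (b p j) (M.scaledMean p) • b p j := by
      refine Submodule.eq_starProjection_of_mem_of_inner_eq_zero ?_ ?_
      · rw [← hp.2]
        exact Submodule.sum_mem _ fun j _ => Submodule.smul_mem _ _
          (Submodule.subset_span ⟨j, rfl⟩)
      · intro y hy
        rw [← hp.2] at hy
        rw [← eq_sum_inner_of_mem_span hp.1 hy, inner_sum]
        refine Finset.sum_eq_zero fun j _ => ?_
        rw [real_inner_smul_right, real_inner_comm (b p j) (_ - _), inner_sub_sum_inner hp.1,
          mul_zero]
    have hs : 0 < (√(p : ℝ))⁻¹ := by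
      have : (0 : ℝ) < p := by exact_mod_cast hp0
      positivity
    have hang : InnerProductGeometry.angle (M.mu p) ((M.commonLead p).starProjection (M.mu p)) =
        InnerProductGeometry.angle (M.scaledMean p)
          ((M.commonLead p).starProjection (M.scaledMean p)) := by
      rw [scaledMean, map_smul, InnerProductGeometry.angle_smul_left_of_pos _ _ hs,
        InnerProductGeometry.angle_smul_right_of_pos _ _ hs]
    have hnorm : ‖∑ j, inner ℝ (b p j) (M.scaledMean p) • b p j‖ =
        √(∑ j, inner ℝ (b p j) (M.scaledMean p) ^ 2) := by
      rw [eq_comm, Real.sqrt_eq_iff_eq_sq (Finset.sum_nonneg fun _ _ => sq_nonneg _)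
        (norm_nonneg _), ← real_inner_self_eq_norm_sq, hp.1.inner_sum]
      exact Finset.sum_congr rfl fun j _ => by simp [pow_two]
    rw [Function.comp, hang, hproj, ← hnorm, InnerProductGeometry.cos_angle_mul_norm_mul_norm,
      inner_sum]
    exact Finset.sum_congr rfl fun j _ => by
      rw [real_inner_smul_right, real_inner_comm (b p j), pow_two]
  rw [Real.sqrt_sq (norm_nonneg _)] at h4
  have hδ := hmean.1
  have hφπ : φ ≤ Real.pi := le_of_tendsto hφ (.of_forall fun p => InnerProductGeometry.angle_le_pi _ _)
  have hcos : Real.cos φ < 1 := by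
    have := Real.strictAntiOn_cos (Set.left_mem_Icc.2 Real.pi_pos.le) ⟨hφ0.le, hφπ⟩ hφ0
    rwa [Real.cos_zero] at this
  rcases (norm_nonneg (meanLimit δ θ)).eq_or_lt with h0 | h0
  · rw [← h0, zero_pow two_ne_zero]
    exact pow_pos hδ 2
  · have h5 : ‖meanLimit δ θ‖ = Real.cos φ * δ := by
      refine mul_right_cancel₀ h0.ne' ?_
      rw [← pow_two, h4, mul_assoc]
    have h6 : ‖meanLimit δ θ‖ < δ := by
      rw [h5]
      nlinarith
    gcongr

/-- The asymptotic piling distance of the projected ridged discriminant direction. -/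
def pilingLimit (M : TwoClassModel) {m : ℕ} (τ δ : ℝ) (μ : EuclideanSpace ℝ (Fin m))
    (g : M.TrainIndex → EuclideanSpace ℝ (Fin m)) : ℝ :=
  (δ ^ 2 - ‖μ‖ ^ 2) / √(δ ^ 2 - ‖μ‖ ^ 2 + τ ^ 2 * ‖M.diffCoef‖ ^ 2 + τ ^ 2 *
    sInf ((fun v => ‖v‖ ^ 2) '' {v | v ∈ M.centred ∧ (signal g ∘ₗ M.centring) v =
      μ + signal g M.diffCoef}))

/-- Asymptotic behaviour of the projected ridged discriminant direction and of the sample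
eigenvectors. -/
structure IsDirectionLimit (M : TwoClassModel) {m : ℕ} (U : Ultrafilter ℕ) (τ κ : ℝ)
    (b : ∀ p, Fin m → E p) (x : ∀ p, M.Sample p) (u : ∀ p, Fin p → E p) (lam : ∀ p, Fin p → ℝ)
    (v : ∀ p, E p) : Prop where
  dir_basis : ∀ j, Tendsto (fun p => inner ℝ (v p) (b p j)) U (𝓝 0)
  dir_residual : Tendsto (fun p => inner ℝ (v p) (M.meanResidual b p)) U (𝓝 κ)
  eigvec_residual : ∀ i : Fin (M.N - 2), m ≤ i.val →
    Tendsto (fun p => inner ℝ (head (M.N - 2) (u p) i) (M.meanResidual b p)) U (𝓝 0)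
  eigval : ∀ i : Fin (M.N - 2), m ≤ i.val →
    Tendsto (fun p => head (M.N - 2) (lam p) i / p) U (𝓝 (τ ^ 2))
  norm_dir : ∀ᶠ p in U, ‖v p‖ = 1
  norm_eigvec : ∀ᶠ p in U, ∀ i, ‖head (M.N - 2) (u p) i‖ = 1
  tendsto_projection : ∀ w : ∀ p, E p, (∀ᶠ p in U, w p ∈ sampleSpace (x p)) →
    (∀ᶠ p in U, ‖w p‖ = 1) → (∀ j, Tendsto (fun p => inner ℝ (w p) (b p j)) U (𝓝 0)) →
    Tendsto (fun p => ‖w p - (inner ℝ (v p) (w p) • v p + ∑ i with m ≤ i.val,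
      inner ℝ (head (M.N - 2) (u p) i) (w p) • head (M.N - 2) (u p) i)‖) U (𝓝 0)

/-- This carries the abstract limits over to `ridgeDir`. Its limiting piling distance is `δ² - ‖μ‖²`
divided by the limiting norm of the ridge vector. -/
theorem _root_.DataPiling.IsComponentLimit.isDirectionLimit (hn : ∀ k, 0 < M.n k) {m : ℕ}
    (hm : m ≤ M.N - 2) {U : Ultrafilter ℕ} (hU : (U : Filter ℕ) ≤ atTop) {τ δ : ℝ} (hτ : 0 < τ)
    {μ : EuclideanSpace ℝ (Fin m)} (hμ : ‖μ‖ ^ 2 ≤ δ ^ 2)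
    {g : M.TrainIndex → EuclideanSpace ℝ (Fin m)} {b : ∀ p, Fin m → E p}
    {z : M.TrainIndex → ℕ → ℝ}
    (h : IsComponentLimit U τ δ μ g M.scaledMean (fun p a => M.leadPart a.1 (z a) p)
      (fun p a => M.noise a.1 p (z a)) b)
    (hsurj : M.centred.map (signal g ∘ₗ M.centring) = ⊤)
    {α : ℕ → ℝ} (hα : Tendsto α U (𝓝 (-τ ^ 2)))
    {u : ∀ p, Fin p → E p} {lam : ∀ p, Fin p → ℝ}
    (hdec : ∀ p, IsEigenDecomp (M.sample z p) (u p) (lam p))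
    (hgen : ∀ p, M.N < p → IsGeneric (M.sample z p)) :
    M.IsDirectionLimit U τ (M.pilingLimit τ δ μ g) b (M.sample z) u lam
      (fun p => ridgeDir m (α p) (u p) (lam p) (M.sample z p)) := by
  have hS := h.isSampleLimit hn hU hτ hμ hsurj hα hdec hgen
  have hlarge : ∀ᶠ p in U, (∀ k, M.m k ≤ p) ∧ M.N < p := by
    refine Filter.Eventually.filter_mono hU ?_
    filter_upwards [eventually_ge_atTop (M.m 0), eventually_ge_atTop (M.m 1),
      eventually_gt_atTop M.N] with p h0 h1 h2
    exact ⟨fun k => by fin_cases k <;> assumption, h2⟩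
  have hv := hlarge.mono fun p hp => (hdec p).ridgeDir_eq hm hp.2 (α p)
  -- The mean residual is asymptotically orthogonal to all centred observations, so it enters the
  -- limit formulas with leading coordinates `w = 0`.
  have hx0 : ∀ a, Tendsto (fun p : ℕ => inner ℝ ((√(p : ℝ))⁻¹ • centredObs (M.sample z p) a)
      (M.meanResidual b p)) U
      (𝓝 (inner ℝ ((signal g ∘ₗ M.centring) (EuclideanSpace.single a 1)) 0)) := by
    intro a
    have := h.tendsto_comb_residual 0 (M.centring (EuclideanSpace.single a 1))
    rw [zero_mul] at this
    rw [inner_zero_right]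
    refine this.congr' ?_
    filter_upwards [hlarge] with p hp
    rw [smul_centredObs z hp.1 hn, meanResidual]
  have hd : Tendsto (fun p : ℕ => inner ℝ ((√(p : ℝ))⁻¹ • meanDiff (M.sample z p))
      (M.meanResidual b p)) U (𝓝 (δ ^ 2 - ‖μ‖ ^ 2)) := by
    have := h.tendsto_comb_residual 1 M.diffCoef
    rw [one_mul] at this
    refine this.congr' ?_
    filter_upwards [hlarge] with p hp
    rw [smul_meanDiff z hp.1 hn, meanResidual]
  have hinv := hS.tendsto_norm_ridge.inv₀ (Real.sqrt_pos.2 hS.norm_ridge_limit_pos).ne'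
  refine ⟨fun j => ?_, ?_, fun i hi => hS.tendsto_inner_eigvec_of_le hi hx0,
    fun i hi => hS.tendsto_eigval_of_le hi, ?_, ?_, fun w hw hw1 hwb => ?_⟩
  · have h1 := hinv.mul (hS.tendsto_inner_ridge_basis j)
    rw [mul_zero] at h1
    refine h1.congr' ?_
    filter_upwards [hv] with p hp
    rw [hp, real_inner_smul_left]
  · have h1 := hinv.mul (hS.tendsto_inner_ridge hx0 hd)
    rw [inner_zero_right, sub_zero, ← div_eq_inv_mul] at h1
    refine h1.congr' ?_
    filter_upwards [hv] with p hp
    rw [hp, real_inner_smul_left]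
  · filter_upwards [hlarge] with p hp
    exact (hdec p).norm_ridgeDir hm hn (hgen p hp.2) hp.2 (α p)
  · filter_upwards [hS.orthonormal] with p hp
    exact hp.1
  · refine hS.tendsto_residual ?_ hw1 hwb hv
    filter_upwards [hlarge, hw] with p hp hwp
    rw [(hdec p).sampleSpace_eq hn (hgen p hp.2) hp.2] at hwp
    have hp0 : (√(p : ℝ))⁻¹ ≠ 0 := by
      have h0 : 0 < p := by omega
      have : (0 : ℝ) < p := by exact_mod_cast h0
      positivity
    rwa [Submodule.span_singleton_smul_eq (Ne.isUnit hp0)]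

namespace IsDirectionLimit

variable {m : ℕ} {U : Ultrafilter ℕ} {τ κ : ℝ} {b : ∀ p, Fin m → E p} {x : ∀ p, M.Sample p}
  {u : ∀ p, Fin p → E p} {lam : ∀ p, Fin p → ℝ} {v : ∀ p, E p}
  (h : M.IsDirectionLimit U τ κ b x u lam v)

include h

theorem exists_tendsto_inner_dir {w : ∀ p, E p} (hw1 : ∀ᶠ p in U, ‖w p‖ = 1) :
    ∃ β, |β| ≤ 1 ∧ Tendsto (fun p => inner ℝ (v p) (w p)) U (𝓝 β) := by
  have h1 : ∀ᶠ p in U, |inner ℝ (v p) (w p)| ≤ 1 := by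
    filter_upwards [h.norm_dir, hw1] with p hp hp'
    refine (abs_real_inner_le_norm _ _).trans ?_
    rw [hp, hp', one_mul]
  obtain ⟨β, hβ⟩ := exists_tendsto_of_abs_le U h1
  exact ⟨β, le_of_tendsto hβ.abs h1, hβ⟩

/-- In the approximation of `w` by the piling space, the tail eigenvectors are asymptotically
orthogonal to the mean residual, so only the component along `v` counts. -/
theorem tendsto_inner_residual {w : ∀ p, E p} (hw : ∀ᶠ p in U, w p ∈ sampleSpace (x p))
    (hw1 : ∀ᶠ p in U, ‖w p‖ = 1) (hwb : ∀ j, Tendsto (fun p => inner ℝ (w p) (b p j)) U (𝓝 0))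
    {C : ℝ} (hC : ∀ᶠ p in U, ‖M.meanResidual b p‖ ≤ C) {β : ℝ}
    (hβ : Tendsto (fun p => inner ℝ (v p) (w p)) U (𝓝 β)) :
    Tendsto (fun p => inner ℝ (w p) (M.meanResidual b p)) U (𝓝 (β * κ)) := by
  have h1 : ∀ i : Fin (M.N - 2), ∃ γ, Tendsto
      (fun p => inner ℝ (head (M.N - 2) (u p) i) (w p)) U (𝓝 γ) := fun i => by
    refine exists_tendsto_of_abs_le U (C := 1) ?_
    filter_upwards [h.norm_eigvec, hw1] with p hp hp'
    refine (abs_real_inner_le_norm _ _).trans ?_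
    rw [hp, hp', one_mul]
  choose γ hγ using h1
  have h2 := tendsto_finsetSum (Finset.univ.filter fun i : Fin (M.N - 2) => m ≤ i.val)
    fun i hi => (hγ i).mul (h.eigvec_residual i (Finset.mem_filter.1 hi).2)
  simp only [mul_zero, Finset.sum_const_zero] at h2
  have h3 : Tendsto (fun p => inner ℝ (w p - (inner ℝ (v p) (w p) • v p + ∑ i with m ≤ i.val,
      inner ℝ (head (M.N - 2) (u p) i) (w p) • head (M.N - 2) (u p) i))
      (M.meanResidual b p)) U (𝓝 0) := by
    have h4 := (h.tendsto_projection w hw hw1 hwb).mul_const C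
    rw [zero_mul] at h4
    refine squeeze_zero_norm' ?_ h4
    filter_upwards [hC] with p hp
    exact (abs_real_inner_le_norm _ _).trans (mul_le_mul_of_nonneg_left hp (norm_nonneg _))
  have h5 := h3.add ((hβ.mul h.dir_residual).add h2)
  rw [zero_add, add_zero] at h5
  refine h5.congr fun p => ?_
  rw [inner_sub_left, inner_add_left, sum_inner, real_inner_smul_left]
  simp_rw [real_inner_smul_left]
  ring

theorem tendsto_alphaHat (hU : (U : Filter ℕ) ≤ atTop) (hm : m + 2 < M.N) :
    Tendsto (fun p => alphaHat M m (lam p)) U (𝓝 (-τ ^ 2)) := by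
  have hr : (0 : ℝ) < (M.N : ℝ) - m - 2 := by
    have : (m : ℝ) + 2 < M.N := by exact_mod_cast hm
    linarith
  have h1 := tendsto_finsetSum (Finset.univ.filter fun i : Fin (M.N - 2) => m ≤ i.val)
    fun i hi => h.eigval i (Finset.mem_filter.1 hi).2
  have hcard : ((Finset.univ.filter fun i : Fin (M.N - 2) => m ≤ i.val).card : ℝ) =
      (M.N : ℝ) - m - 2 := by
    have h2 : (Finset.univ.filter fun i : Fin (M.N - 2) => m ≤ i.val).card = M.N - 2 - m := by
      have h3 := Fin.sum_univ_eq_sum_range (fun i => if m ≤ i then 1 else 0) (M.N - 2)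
      rw [Finset.card_filter, h3, ← Finset.card_filter]
      have : (Finset.range (M.N - 2)).filter (fun i => m ≤ i) = Finset.Ico m (M.N - 2) := by
        ext i
        simp [and_comm]
      rw [this, Nat.card_Ico]
    rw [h2, Nat.cast_sub (by omega), Nat.cast_sub (by omega)]
    push_cast
    ring
  rw [Finset.sum_const, nsmul_eq_mul, hcard] at h1
  have h2 := (h1.const_mul ((M.N : ℝ) - m - 2)⁻¹).neg
  rw [inv_mul_cancel_left₀ hr.ne'] at h2
  refine h2.congr' ?_
  filter_upwards [hU (eventually_gt_atTop M.N)] with p hp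
  have hp' : M.N - 2 ≤ p := by omega
  rw [alphaHat]
  congr 2
  have h4 : (Finset.univ.filter fun i : Fin p => m ≤ i.val ∧ i.val < M.N - 2) =
      (Finset.univ.filter fun i : Fin p => i.val < M.N - 2).filter fun i => m ≤ i.val := by
    ext i
    simp [and_comm]
  rw [h4, Finset.sum_filter _ _ (s := Finset.univ.filter fun i : Fin p => i.val < M.N - 2),
    sum_filter_lt_eq_sum_head hp', Finset.sum_filter]
  refine Finset.sum_congr rfl fun i _ => ?_
  rw [head_apply hp']
  rfl

end IsDirectionLimit

end TwoClassModel

end DataPiling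

/-! ### Measurability, consistency of the estimator and the approximation in assertion (i) -/

namespace DataPiling

theorem AsympAE.ae {Ω : Type*} [MeasurableSpace Ω] {P : Measure Ω} {Q : Ω → Prop}
    (h : AsympAE P fun _ ω => Q ω) : ∀ᵐ ω ∂P, Q ω := by
  obtain ⟨ms, -, hae⟩ := h id strictMono_id
  filter_upwards [hae] with ω hω
  exact hω _ (Ultrafilter.of_le _)

namespace TwoClassModel

variable {M : TwoClassModel}

theorem measurable_centredObs {p : ℕ} (a : M.TrainIndex) :
    Measurable fun x : M.Sample p => centredObs x a := by
  unfold centredObs classMean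
  fun_prop

/-- Eigenvalues are sums of squared inner products of eigenvectors with the centred observations, so
their measurability follows from that of the eigenvectors. -/
theorem measurable_eigval {p : ℕ} {u : M.Sample p → Fin p → E p} {lam : M.Sample p → Fin p → ℝ}
    (hu : Measurable u) (heig : ∀ x, IsEigenDecomp x (u x) (lam x)) : Measurable lam := by
  refine measurable_pi_lambda _ fun i => ?_
  simp_rw [fun x => (heig x).lam_eq i]
  have h1 : Measurable fun x => u x i := by fun_prop
  exact Finset.measurable_fun_sum _ fun a _ => ((measurable_centredObs a).inner h1).pow_const 2

theorem measurable_ridgeDir {p : ℕ} (m : ℕ) {α : M.Sample p → ℝ} {u : M.Sample p → Fin p → E p}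
    {lam : M.Sample p → Fin p → ℝ} (hα : Measurable α) (hu : Measurable u) (hlam : Measurable lam) :
    Measurable fun x => ridgeDir m (α x) (u x) (lam x) x := by
  have h1 : ∀ i, Measurable fun x => u x i := fun i => by fun_prop
  have h2 : ∀ i, Measurable fun x => lam x i := fun i => by fun_prop
  have hd : Measurable fun x : M.Sample p => meanDiff x := by
    unfold meanDiff classMean
    fun_prop
  have hr : Measurable fun x => ridgeVec m (α x) (u x) (lam x) x := by
    refine Measurable.add (Finset.measurable_fun_sum _ fun i _ => ?_)
      (Finset.measurable_fun_sum _ fun i _ => ?_)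
    · exact (((hα.mul_const _).div ((h2 i).add (hα.mul_const _))).mul
        (Measurable.inner (𝕜 := ℝ) (h1 i) hd)).smul (h1 i)
    · exact (Measurable.inner (𝕜 := ℝ) (h1 i) hd).smul (h1 i)
  exact hr.norm.inv.smul hr

/-- The part of `w` in the span of `v` and of the vectors `u_i` with `m ≤ i < N - 2`. -/
def pilingProjection {p : ℕ} (M : TwoClassModel) (m : ℕ) (v : E p) (u : Fin p → E p) (w : E p) :
    E p :=
  inner ℝ v w • v + ∑ i with m ≤ i.val,
    inner ℝ (head (M.N - 2) u i) w • head (M.N - 2) u i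

theorem measurable_pilingProjection {p : ℕ} (m : ℕ) (hp : M.N < p) {v w : M.Sample p → E p}
    {u : M.Sample p → Fin p → E p} (hv : Measurable v) (hu : Measurable u) (hw : Measurable w) :
    Measurable fun x => M.pilingProjection m (v x) (u x) (w x) := by
  have hr : M.N - 2 ≤ p := by omega
  have h1 : ∀ i, Measurable fun x => head (M.N - 2) (u x) i := fun i => by
    simp_rw [head_apply hr]
    fun_prop
  exact ((Measurable.inner (𝕜 := ℝ) hv hw).smul hv).add
    (Finset.measurable_fun_sum _ fun i _ => (Measurable.inner (𝕜 := ℝ) (h1 i) hw).smul (h1 i))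

theorem pilingProjection_mem {p : ℕ} (m : ℕ) (hp : M.N < p) (α : ℝ) (u : Fin p → E p)
    (lam : Fin p → ℝ) (x : M.Sample p) (w : E p) :
    M.pilingProjection m (ridgeDir m α u lam x) u w ∈ pilingSpace m α u lam x := by
  have hr : M.N - 2 ≤ p := by omega
  refine Submodule.add_mem _ ?_ (Submodule.sum_mem _ fun i hi => ?_)
  · exact Submodule.smul_mem _ _ (Submodule.mem_sup_left (Submodule.mem_span_singleton_self _))
  · refine Submodule.smul_mem _ _ (Submodule.mem_sup_right (Submodule.subset_span ?_))
    rw [head_apply hr]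
    exact ⟨_, ⟨(Finset.mem_filter.1 hi).2, i.2⟩, rfl⟩

theorem pilingSpace_le {p m : ℕ} (hm : m ≤ M.N - 2) (hn : ∀ k, 0 < M.n k) (hp : M.N < p)
    {u : Fin p → E p} {lam : Fin p → ℝ} {x : M.Sample p} (h : IsEigenDecomp x u lam)
    (hx : IsGeneric x) (α : ℝ) : pilingSpace m α u lam x ≤ sampleSpace x := by
  have hr : M.N - 2 ≤ p := by omega
  refine sup_le ((Submodule.span_singleton_le_iff_mem _ _).2 (h.ridgeDir_mem hm hn hx hp α)) ?_
  rw [h.sampleSpace_eq hn hx hp]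
  refine le_trans (Submodule.span_mono ?_) le_sup_left
  rintro _ ⟨i, hi, rfl⟩
  exact ⟨⟨i, hi.2⟩, head_apply hr u _⟩

variable {Ω : Type*} [MeasurableSpace Ω] {P : Measure Ω} [IsProbabilityMeasure P]
  {ν : Fin 2 → Measure (ℕ → ℝ)} {Z : M.Index → Ω → ℕ → ℝ} {τ δ : ℝ} {m : ℕ}
  {b : ∀ p, Fin m → E p} {θ : Fin m → ℝ} {R : ∀ k : Fin 2, Matrix (Fin m) (Fin (M.m k)) ℝ}
  {u : ∀ p, M.Sample p → Fin p → E p} {lam : ∀ p, M.Sample p → Fin p → ℝ}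
  {α : ∀ p, M.Sample p → ℝ}

namespace IsScoreArray

variable (h : IsScoreArray P M ν Z) (hn : ∀ k, M.m k < M.n k) (htail : M.EqualTail τ)
  (hmean : M.MeanDifference δ) (hb : M.IsCommonBasis b θ R)
  (heig : ∀ p x, IsEigenDecomp x (u p x) (lam p x))

include h hn htail hmean hb heig

theorem asymp_isDirectionLimit
    (hα : TendstoInMeasure P (fun p ω => α p (M.train Z p ω)) atTop (fun _ => -τ ^ 2)) :
    AsympAE P fun U ω => M.IsDirectionLimit U τ (M.pilingLimit τ δ (meanLimit δ θ)
      fun a : M.TrainIndex => leadLimit R a.1 (trainScores Z ω a)) b (fun p => M.train Z p ω)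
      (fun p => u p (M.train Z p ω)) (fun p => lam p (M.train Z p ω))
      (fun p => ridgeDir m (α p (M.train Z p ω)) (u p (M.train Z p ω)) (lam p (M.train Z p ω))
        (M.train Z p ω)) := by
  refine ((h.asymp_isComponentLimit htail hmean hb).and (AsympAE.of_tendstoInMeasure hα)).mono ?_
  filter_upwards [h.ae_isGeneric htail.tail_pos htail.spike_pos, h.ae_affineIndependent_scores hn]
    with ω hgen hind U hU hω
  exact hω.1.isDirectionLimit (fun k => (Nat.zero_le _).trans_lt (hn k)) (hb.le_sub_two hn) hU
    htail.tau_pos (hb.norm_meanLimit_sq_le hmean) (hb.map_signal_eq_top hn htail.spike_pos hind)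
    hω.2 (fun p => heig p _) hgen

omit hmean in
theorem isDirSeq_ridgeDir (hu : ∀ p, Measurable (u p)) (hαm : ∀ p, Measurable (α p)) :
    IsDirSeq P Z fun p x => ridgeDir m (α p x) (u p x) (lam p x) x := by
  intro p hp
  refine ⟨measurable_ridgeDir m (hαm p) (hu p) (measurable_eigval (hu p) (heig p)), ?_⟩
  have hn' : ∀ k, 0 < M.n k := fun k => (Nat.zero_le _).trans_lt (hn k)
  filter_upwards [h.ae_isGeneric htail.tail_pos htail.spike_pos] with ω hgen
  have he := heig p (M.train Z p ω)
  exact ⟨he.ridgeDir_mem (hb.le_sub_two hn) hn' (hgen p hp) hp _,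
    he.norm_ridgeDir (hb.le_sub_two hn) hn' (hgen p hp) hp _⟩

theorem tendstoInMeasure_alphaHat (hu : ∀ p, Measurable (u p)) (hm : m + 2 < M.N) :
    TendstoInMeasure P (fun p ω => alphaHat M m (lam p (M.train Z p ω))) atTop
      (fun _ => -τ ^ 2) := by
  -- The eigenvalue limits do not involve the ridge parameter, so the constant `-τ²` can serve; the
  -- argument is not circular.
  have hα : TendstoInMeasure P (fun (_ : ℕ) (_ : Ω) => -τ ^ 2) atTop (fun _ => -τ ^ 2) :=
    tendstoInMeasure_of_tendsto_ae (fun _ => aestronglyMeasurable_const)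
      (.of_forall fun _ => tendsto_const_nhds)
  have h1 := h.asymp_isDirectionLimit hn htail hmean hb heig (α := fun _ _ => -τ ^ 2) hα
  have h2 : ∀ p, AEMeasurable (fun ω => alphaHat M m (lam p (M.train Z p ω))) P := by
    intro p
    have hl : ∀ i, Measurable fun x => lam p x i := fun i =>
      (measurable_pi_apply i).comp (measurable_eigval (hu p) (heig p))
    have ha : Measurable fun x => alphaHat M m (lam p x) :=
      ((Finset.measurable_fun_sum _ fun i _ => (hl i).div_const _).const_mul _).neg
    exact ha.comp_aemeasurable (h.aemeasurable_train p)
  exact AsympAE.tendstoInMeasure (.of_forall h2)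
    (h1.mono (.of_forall fun ω U hU hω => hω.tendsto_alphaHat hU hm))

/-- Second data piling directions are asymptotically close to the piling space. -/
theorem exists_tendstoInMeasure_sub (hu : ∀ p, Measurable (u p)) (hαm : ∀ p, Measurable (α p))
    (hα : TendstoInMeasure P (fun p ω => α p (M.train Z p ω)) atTop (fun _ => -τ ^ 2))
    {w : ∀ p, M.Sample p → E p} (hw : IsSecondPiling P Z w) :
    ∃ v : ∀ p, M.Sample p → E p, IsDirSeq P Z v ∧
      (∀ p, M.N < p → ∀ᵐ ω ∂P, v p (M.train Z p ω) ∈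
        pilingSpace m (α p (M.train Z p ω)) (u p (M.train Z p ω)) (lam p (M.train Z p ω))
          (M.train Z p ω)) ∧
      TendstoInMeasure P (fun p ω => ‖w p (M.train Z p ω) - v p (M.train Z p ω)‖)
        atTop (fun _ => 0) := by
  classical
  have hn' : ∀ k, 0 < M.n k := fun k => (Nat.zero_le _).trans_lt (hn k)
  have hv := h.isDirSeq_ridgeDir hn htail hb heig hu hαm
  set v : ∀ p, M.Sample p → E p := fun p x => ridgeDir m (α p x) (u p x) (lam p x) x with hvdef
  set y : ∀ p, M.Sample p → E p := fun p x => M.pilingProjection m (v p x) (u p x) (w p x) with hy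
  -- The default `v p x` keeps `t` almost surely a unit vector of the piling space in every
  -- dimension `p > n`, even when the projection vanishes.
  set t : ∀ p, M.Sample p → E p := fun p x => if y p x = 0 then v p x else ‖y p x‖⁻¹ • y p x
    with ht
  have htm : ∀ p x, M.N < p → t p x ∈ pilingSpace m (α p x) (u p x) (lam p x) x := by
    intro p x hp
    simp only [ht]
    split_ifs
    · exact Submodule.mem_sup_left (Submodule.mem_span_singleton_self _)
    · exact Submodule.smul_mem _ _ (pilingProjection_mem m hp _ _ _ _ _)
  have htdir : IsDirSeq P Z t := by
    intro p hp
    have hym : Measurable (y p) :=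
      measurable_pilingProjection m hp (hv p hp).1 (hu p) (hw.1 p hp).1
    refine ⟨Measurable.ite (hym (measurableSet_singleton 0)) (hv p hp).1 (hym.norm.inv.smul hym), ?_⟩
    filter_upwards [h.ae_isGeneric htail.tail_pos htail.spike_pos] with ω hgen
    refine ⟨pilingSpace_le (hb.le_sub_two hn) hn' hp (heig p _) (hgen p hp) _ (htm p _ hp), ?_⟩
    simp only [ht]
    split_ifs with h0
    · exact (heig p _).norm_ridgeDir (hb.le_sub_two hn) hn' (hgen p hp) hp _
    · rw [norm_smul, norm_inv, norm_norm, inv_mul_cancel₀ (norm_ne_zero_iff.2 h0)]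
  refine ⟨t, htdir, fun p hp => .of_forall fun ω => htm p _ hp, ?_⟩
  refine AsympAE.tendstoInMeasure ?_ (((h.asymp_isDirectionLimit hn htail hmean hb heig hα).and
    ((h.isSecondPiling_iff htail hb hw.1).1 hw)).mono ?_)
  · filter_upwards [eventually_gt_atTop M.N] with p hp
    exact ((h.aemeasurable_dir hw.1 hp).sub (h.aemeasurable_dir htdir hp)).norm
  · filter_upwards [hw.1.ae_all] with ω hwω U hU hω
    have hN := hU (eventually_gt_atTop M.N)
    have h1 := hω.1.tendsto_projection (fun p => w p (M.train Z p ω))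
      (Filter.Eventually.mono hN fun p hp => (hwω p hp).1)
      (Filter.Eventually.mono hN fun p hp => (hwω p hp).2) hω.2
    have h2 := h1.const_mul 2
    rw [mul_zero] at h2
    refine squeeze_zero_norm' ?_ h2
    -- A projection at distance less than `1` from the unit vector `w` is nonzero, so eventually the
    -- default is not used.
    filter_upwards [hN, h1.eventually (gt_mem_nhds one_pos)] with p hp hp1
    have h0 : y p (M.train Z p ω) ≠ 0 := by
      intro h0
      have : ‖w p (M.train Z p ω) - y p (M.train Z p ω)‖ < 1 := hp1
      rw [h0, sub_zero, (hwω p hp).2] at this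
      exact lt_irrefl _ this
    rw [norm_norm]
    simp only [ht, if_neg h0]
    exact norm_sub_normalize (hwω p hp).2 h0

end IsScoreArray

end TwoClassModel

end DataPiling

/-! ### Second maximal data piling -/

namespace DataPiling

namespace TwoClassModel

variable {M : TwoClassModel} {Ω : Type*} [MeasurableSpace Ω] {P : Measure Ω}
  [IsProbabilityMeasure P] {ν : Fin 2 → Measure (ℕ → ℝ)} {Z : M.Index → Ω → ℕ → ℝ} {τ δ : ℝ}
  {m : ℕ} {b : ∀ p, Fin m → E p} {θ : Fin m → ℝ} {R : ∀ k : Fin 2, Matrix (Fin m) (Fin (M.m k)) ℝ}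
  {u : ∀ p, M.Sample p → Fin p → E p} {lam : ∀ p, M.Sample p → Fin p → ℝ}
  {v w : ∀ p, M.Sample p → E p} {κ D : Ω → ℝ}

namespace IsScoreArray

variable (h : IsScoreArray P M ν Z) (htail : M.EqualTail τ) (hmean : M.MeanDifference δ)
  (hb : M.IsCommonBasis b θ R)

include h htail hmean hb

theorem hasPilingDistance_of_asymp (hw : IsSecondPiling P Z w)
    (hD : AsympAE P fun U ω => Tendsto
      (fun p => |inner ℝ (w p (M.train Z p ω)) (M.meanResidual b p)|) U (𝓝 (D ω))) :
    HasPilingDistance P Z w D := by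
  intro l l'
  refine AsympAE.tendstoInMeasure ?_ (((h.asymp_pilingDistance htail hb hmean hw l l').and hD).mono
    (.of_forall fun ω U _ hω => ?_))
  · filter_upwards [eventually_gt_atTop M.N] with p hp
    have h1 : AEMeasurable (fun ω => inner ℝ (w p (M.train Z p ω))
        (M.test Z 0 l p ω - M.test Z 1 l' p ω)) P :=
      (h.aemeasurable_dir hw.1 hp).inner
        ((h.aemeasurable_test 0 l p).sub (h.aemeasurable_test 1 l' p))
    exact h1.abs.const_mul _
  · have := hω.1.add hω.2
    rw [zero_add] at this
    exact this.congr fun p => sub_add_cancel _ _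

theorem asymp_of_hasPilingDistance (hw : IsSecondPiling P Z w) (hD : HasPilingDistance P Z w D) :
    AsympAE P fun U ω => Tendsto
      (fun p => |inner ℝ (w p (M.train Z p ω)) (M.meanResidual b p)|) U (𝓝 (D ω)) := by
  refine ((h.asymp_pilingDistance htail hb hmean hw 0 0).and
    (AsympAE.of_tendstoInMeasure (hD 0 0))).mono (.of_forall fun ω U _ hω => ?_)
  have := hω.2.sub hω.1
  rw [sub_zero] at this
  exact this.congr fun p => sub_sub_cancel _ _

variable (hv : IsDirSeq P Z v) (hκ : ∀ ω, 0 < κ ω)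
  (hlim : AsympAE P fun U ω => M.IsDirectionLimit U τ (κ ω) b (fun p => M.train Z p ω)
    (fun p => u p (M.train Z p ω)) (fun p => lam p (M.train Z p ω)) (fun p => v p (M.train Z p ω)))

include hlim in
/-- The inner products of a second data piling direction with the mean difference are determined
by those with the limiting direction. -/
theorem asymp_exists_tendsto_inner (hw : IsSecondPiling P Z w) :
    AsympAE P fun U ω => ∃ β, |β| ≤ 1 ∧
      Tendsto (fun p => inner ℝ (v p (M.train Z p ω)) (w p (M.train Z p ω))) U (𝓝 β) ∧
      Tendsto (fun p => inner ℝ (w p (M.train Z p ω)) (M.meanResidual b p)) U (𝓝 (β * κ ω)) := by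
  refine (((h.isSecondPiling_iff htail hb hw.1).1 hw).and hlim).mono ?_
  filter_upwards [hw.1.ae_all] with ω hwω U hU hω
  have hN := hU (eventually_gt_atTop M.N)
  have hw1 : ∀ᶠ p in U, ‖w p (M.train Z p ω)‖ = 1 :=
    Filter.Eventually.mono hN fun p hp => (hwω p hp).2
  obtain ⟨β, hβ1, hβ⟩ := hω.2.exists_tendsto_inner_dir hw1
  exact ⟨β, hβ1, hβ, hω.2.tendsto_inner_residual
    (Filter.Eventually.mono hN fun p hp => (hwω p hp).1) hw1 hω.1
    (hb.eventually_norm_meanResidual_le hU hmean) hβ⟩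

include hκ hlim in
-- Closeness to `± v` transfers orthogonality to the leading space and the distance `κ` to `w`. Any
-- competitor has distance `|β| κ` with `|β| ≤ 1`.
theorem isSecondMaximal_of_tendsto (hw : IsDirSeq P Z w)
    (hwv : AsympAE P fun U ω => Tendsto (fun p => min ‖w p (M.train Z p ω) - v p (M.train Z p ω)‖
      ‖w p (M.train Z p ω) + v p (M.train Z p ω)‖) U (𝓝 0)) :
    IsSecondMaximal P Z w ∧ HasPilingDistance P Z w κ := by
  have hw2 : IsSecondPiling P Z w := by
    refine (h.isSecondPiling_iff htail hb hw).2
      ((hwv.and hlim).mono (.of_forall fun ω U hU hω j => ?_))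
    have h1 := hω.1.add (hω.2.dir_basis j).abs
    rw [abs_zero, add_zero] at h1
    refine squeeze_zero_norm' ?_ h1
    filter_upwards [hU hb.basis] with p hp
    have := abs_abs_inner_sub_le (v p (M.train Z p ω)) (w p (M.train Z p ω)) (b p j)
    rw [hp.1.1 j, mul_one] at this
    rw [Real.norm_eq_abs]
    linarith [(abs_le.1 this).2]
  have hdist : HasPilingDistance P Z w κ := by
    refine h.hasPilingDistance_of_asymp htail hmean hb hw2
      ((hwv.and hlim).mono (.of_forall fun ω U hU hω => ?_))
    have h1 := hω.1.mul_const (δ + 1)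
    rw [zero_mul] at h1
    have h2 : Tendsto (fun p => |inner ℝ (w p (M.train Z p ω)) (M.meanResidual b p)| -
        |inner ℝ (v p (M.train Z p ω)) (M.meanResidual b p)|) U (𝓝 0) := by
      refine squeeze_zero_norm' ?_ h1
      filter_upwards [hb.eventually_norm_meanResidual_le hU hmean] with p hp
      exact (abs_abs_inner_sub_le _ _ _).trans
        (mul_le_mul_of_nonneg_left hp (le_min (norm_nonneg _) (norm_nonneg _)))
    have h3 := h2.add hω.2.dir_residual.abs
    rw [zero_add, abs_of_pos (hκ ω)] at h3
    exact h3.congr fun p => sub_add_cancel _ _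
  refine ⟨⟨hw2, κ, hdist, fun w' D' hw' hD' => ?_⟩, hdist⟩
  refine AsympAE.ae (((h.asymp_exists_tendsto_inner htail hmean hb hlim hw').and
    (h.asymp_of_hasPilingDistance htail hmean hb hw' hD')).mono
    (.of_forall fun ω U _ hω => ?_))
  obtain ⟨⟨β, hβ1, -, hβ⟩, hD⟩ := hω
  rw [tendsto_nhds_unique hD hβ.abs, abs_mul, abs_of_pos (hκ ω)]
  exact mul_le_of_le_one_left (hκ ω).le hβ1

include hv hκ hlim in
/-- A sequence of directions is second maximal if and only if it converges to the limiting
direction up to sign. -/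
theorem isSecondMaximal_iff (hw : IsDirSeq P Z w) : IsSecondMaximal P Z w ↔
    TendstoInMeasure P (fun p ω => min ‖w p (M.train Z p ω) - v p (M.train Z p ω)‖
      ‖w p (M.train Z p ω) + v p (M.train Z p ω)‖) atTop (fun _ => 0) := by
  constructor
  · rintro ⟨hw2, D, hD, hmax⟩
    obtain ⟨⟨hv2, -⟩, hvκ⟩ := h.isSecondMaximal_of_tendsto htail hmean hb hκ hlim hv
      (AsympAE.of_ae (.of_forall fun ω U _ => by simp))
    -- Comparison with `v` itself gives `κ ≤ D = |β| κ`, hence `|β| = 1`; unit vectors with inner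
    -- product near `± 1` are close up to sign.
    have hκD := hmax v κ hv2 hvκ
    refine AsympAE.tendstoInMeasure ?_ (((h.asymp_exists_tendsto_inner htail hmean hb hlim
      hw2).and (h.asymp_of_hasPilingDistance htail hmean hb hw2 hD)).mono ?_)
    · filter_upwards [eventually_gt_atTop M.N] with p hp
      exact ((h.aemeasurable_dir hw hp).sub (h.aemeasurable_dir hv hp)).norm.min
        ((h.aemeasurable_dir hw hp).add (h.aemeasurable_dir hv hp)).norm
    · filter_upwards [hκD, hw.ae_all, hv.ae_all] with ω hκω hwω hvω U hU hω
      obtain ⟨⟨β, hβ1, hβv, hβ⟩, hDω⟩ := hω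
      have h1 := tendsto_nhds_unique hDω hβ.abs
      rw [abs_mul, abs_of_pos (hκ ω)] at h1
      have h2 : |β| = 1 := by
        refine le_antisymm hβ1 ?_
        rw [h1] at hκω
        exact le_of_mul_le_mul_right (by rwa [one_mul]) (hκ ω)
      have h3 := ((hβv.abs.const_mul 2).const_sub 2).sqrt
      rw [h2, mul_one, sub_self, Real.sqrt_zero] at h3
      refine squeeze_zero_norm' ?_ h3
      filter_upwards [hU (eventually_gt_atTop M.N)] with p hp
      rw [Real.norm_eq_abs, abs_of_nonneg (le_min (norm_nonneg _) (norm_nonneg _))]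
      exact min_norm_sub_add_le (hvω p hp).2 (hwω p hp).2
  · intro hwv
    exact (h.isSecondMaximal_of_tendsto htail hmean hb hκ hlim hw
      (AsympAE.of_tendstoInMeasure hwv)).1

end IsScoreArray

theorem pilingLimit_pos (hτ : 0 < τ) {μ : EuclideanSpace ℝ (Fin m)}
    (hμ : ‖μ‖ ^ 2 < δ ^ 2) (g : M.TrainIndex → EuclideanSpace ℝ (Fin m)) :
    0 < M.pilingLimit τ δ μ g := by
  have h1 := sub_pos.2 hμ
  have h2 := IsSampleLimit.sInf_preimage_nonneg M.centred (signal g ∘ₗ M.centring)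
    (μ + signal g M.diffCoef)
  refine div_pos h1 (Real.sqrt_pos.2 ?_)
  positivity

end TwoClassModel

end DataPiling


end

open DataPiling in
theorem mainTheorem4
    {Ω : Type*} [MeasurableSpace Ω] (P : Measure Ω) [IsProbabilityMeasure P]
    (M : TwoClassModel) (hm : ∀ k, 1 ≤ M.m k) (hn : ∀ k, M.m k < M.n k)
    -- independent score sequences, with one law for each class
    (ν : Fin 2 → Measure (ℕ → ℝ)) (hν : ∀ k, IsScoreLaw (ν k))
    (Z : M.Index → Ω → ℕ → ℝ) (hlaw : ∀ a, HasLaw (Z a) (ν (M.label a)) P)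
    (hind : iIndepFun Z P)
    -- the model
    (δ τ : ℝ) (m : ℕ) (hmean : M.MeanDifference δ) (htail : M.EqualTail τ)
    (hlead : M.LeadAngles) (hbasis : M.CommonBasis m)
    -- a measurable eigen-decomposition of the within-class scatter matrix
    (u : ∀ p, M.Sample p → Fin p → E p) (lam : ∀ p, M.Sample p → Fin p → ℝ)
    (hu : ∀ p, Measurable (u p)) (heig : ∀ p x, IsEigenDecomp x (u p x) (lam p x)) :
    -- the estimator built from the sample eigenvalues is consistent
    (m + 2 < M.N → TendstoInMeasure P
      (fun p ω => alphaHat M m (lam p (M.train Z p ω))) atTop (fun _ => -τ ^ 2)) ∧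
    -- for every consistent estimator of `-τ²`:
    ∀ α : ∀ p, M.Sample p → ℝ, (∀ p, Measurable (α p)) →
      TendstoInMeasure P (fun p ω => α p (M.train Z p ω)) atTop (fun _ => -τ ^ 2) →
      (∀ w : ∀ p, M.Sample p → E p, IsSecondPiling P Z w →
        ∃ v : ∀ p, M.Sample p → E p, IsDirSeq P Z v ∧
          (∀ p, M.N < p → ∀ᵐ ω ∂P, v p (M.train Z p ω) ∈
            pilingSpace m (α p (M.train Z p ω)) (u p (M.train Z p ω)) (lam p (M.train Z p ω))
              (M.train Z p ω)) ∧
          TendstoInMeasure P (fun p ω => ‖w p (M.train Z p ω) - v p (M.train Z p ω)‖)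
            atTop (fun _ => 0)) ∧
      (∀ φ : ℝ, M.LimitAngle φ → 0 < φ →
        ∀ w : ∀ p, M.Sample p → E p, IsDirSeq P Z w →
          (IsSecondMaximal P Z w ↔
            TendstoInMeasure P (fun p ω =>
              let x := M.train Z p ω
              let v := ridgeDir m (α p x) (u p x) (lam p x) x
              min ‖w p x - v‖ ‖w p x + v‖) atTop (fun _ => 0))) := by
  obtain ⟨b, θ, R, hb⟩ := hbasis.exists_isCommonBasis
  have h : TwoClassModel.IsScoreArray P M ν Z := ⟨hν, hlaw, hind⟩
  refine ⟨fun hmN => ?_, fun α hαm hα => ⟨fun w hw => ?_, fun φ hφ hφ0 w hw => ?_⟩⟩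
  · exact h.tendstoInMeasure_alphaHat (lam := lam) hn htail hmean hb heig hu hmN
  · exact h.exists_tendstoInMeasure_sub (u := u) (lam := lam) (α := α) hn htail hmean hb heig hu
      hαm hα hw
  · have hlim := h.asymp_isDirectionLimit (u := u) (lam := lam) (α := α) hn htail hmean hb heig hα
    have hv := h.isDirSeq_ridgeDir (u := u) (lam := lam) (α := α) hn htail hb heig hu hαm
    -- This is where `φ > 0` enters: the mean difference keeps a nonvanishing part outside the
    -- leading space, so the limiting distance is positive.
    have hκ : ∀ ω, 0 < M.pilingLimit τ δ (TwoClassModel.meanLimit δ θ)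
        fun a : M.TrainIndex => TwoClassModel.leadLimit R a.1 (TwoClassModel.trainScores Z ω a) :=
      fun ω => TwoClassModel.pilingLimit_pos htail.tau_pos
        (hb.norm_meanLimit_sq_lt hmean hφ hφ0) _
    exact h.isSecondMaximal_iff (u := u) (lam := lam)
      (v := fun p x => ridgeDir m (α p x) (u p x) (lam p x) x) htail hmean hb hv hκ hlim hw
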